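/- Let $(E,\rho)$ be a Polish metric space (complete and separable) with its Borel $\sigma$-algebra, let $\mathcal P_1$ be the set of Borel probability measures $\nu$ on $E$ with $\int\rho(x,x_0)\,\nu(dx)<\infty$ for some (equivalently all) $x_0\in E$, and let $$d_1(\mu,\nu)=\sup\Big\{\Big|\int f\,d\mu-\int f\,d\nu\Big| : f:E\to\mathbb R \text{ is } 1\text{-Lipschitz}\Big\},\qquad \mu,\nu\in\mathcal P_1 .$$ Let $\{P^t\}_{t\ge0}$ be a transition probability semigroup on $E$; write $P^tf(x)=\int f(y)\,P^t(x,dy)$ and $\mu P^t=\int P^t(x,\cdot)\,\mu(dx)$. Let $\{X_t\}_{t\ge0}$ be a Markov process in $E$ (with respect to its natural filtration) with transition semigroup $\{P^t\}$, jointly measurable in $(t,\omega)$, on a probability space $(\Omega,\mathfrak F,\mathbb P)$. Suppose that the law $\mu_0$ of $X_0$ belongs to $\mathcal P_1$, and let $\psi:E\to\mathbb R$ be Lipschitz. Consider the hypotheses: - H0) $P^t$ maps bounded continuous functions to bounded continuous functions for every $t\ge0$, and $\lim_{t\to0+}P^tf(x)=f(x)$ for all $x\in E$ and all bounded continuous $f$;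 - H1) $\mu P^t\in\mathcal P_1$ whenever $\mu\in\mathcal P_1$ and $t\ge 0$, and there are $\hat c,\gamma>0$ with $d_1(\mu P^t,\nu P^t)\le\hat c\,e^{-\gamma t}d_1(\mu,\nu)$ for all $t\ge0$ and $\mu,\nu\in\mathcal P_1$; - H2) there are $x_0\in E$ and $\delta>0$ such that $\sup_{t\in[0,T]}\sup_{\rho(x,x_0)<R}\int\rho(y,x_0)^{2+\delta}P^t(x,dy)<\infty$ for all $R<\infty$ and $T\ge0$; - H3) there are $x_0\in E$ and $\delta>0$ such that $\sup_{t\ge0}\mathbb E\,\rho(X_t,x_0)^{2+\delta}<\infty$. Then: 1) If H0) and H1) hold, there is a unique invariant probability measure $\mu_*$ for $\{P^t\}$ (unique among all Borel probability measures on $E$). It belongs to $\mathcal P_1$. Almost surely $\int_0^T|\psi(X_s)|\,ds<\infty$ for all $T\ge 0$, and with $v_*=\int\psi\,d\mu_*$, $$\lim_{T\to\infty}\frac1T\int_0^T\psi(X_s)\,ds=v_*\quad\text{in probability.}$$ 2) If H0)–H3) hold and $\tilde\psi=\psi-v_*$, then $\int_0^T\tilde\psi(X_s)\,ds$ is square integrable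 for every $T\ge0$, and there is $\sigma\in[0,\infty)$ such that $$\lim_{T\to\infty}\frac1T\,\mathbb E\Big[\int_0^T\tilde\psi(X_s)\,ds\Big]^2=\sigma^2 .$$ 3) If H0)–H3) hold, then, with the same $\sigma$, $T^{-1/2}\int_0^T\tilde\psi(X_s)\,ds$ converges in law to $N(0,\sigma^2)$ as $T\to\infty$, that is, $$\lim_{T\to\infty}\mathbb P\Big(\frac1{\sqrt T}\int_0^T\tilde\psi(X_s)\,ds<\xi\Big)=\Phi_\sigma(\xi)$$ for every $\xi\in\mathbb R$ if $\sigma>0$, and for every $\xi\ne0$ if $\sigma=0$, where $\Phi_\sigma$ is the distribution function of $N(0,\sigma^2)$ (the point mass at $0$ if $\sigma=0$). -/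

import Mathlib

open MeasureTheory ProbabilityTheory Filter Topology
open scoped NNReal ENNReal BoundedContinuousFunction

/-- `P` is a transition probability semigroup on `E`: `P t x` is the law at time `t` of the process
started at `x`, with `P 0 x = δ_x` and the Chapman-Kolmogorov equations. -/
structure IsTransitionSemigroup {E : Type*} [MeasurableSpace E] (P : ℝ≥0 → Kernel E E) : Prop where
  isMarkov : ∀ t, IsMarkovKernel (P t)
  zero : P 0 = Kernel.id
  add : ∀ s t, P (s + t) = P t ∘ₖ P s

/-- The natural filtration: `pastSigma X t = σ(X_s, s ≤ t)`. -/
abbrev pastSigma {E Ω : Type*} [MeasurableSpace E] (X : ℝ≥0 → Ω → E) (t : ℝ≥0) : MeasurableSpace Ω :=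
  ⨆ s ≤ t, MeasurableSpace.comap (X s) inferInstance

/-- `X` is a (jointly measurable) Markov process with transition semigroup `P`:
`𝔼[f(X_t) | σ(X_r, r ≤ s)] = (P^{t-s} f)(X_s)` for all `s ≤ t` and all bounded Borel `f`. -/
structure IsMarkovProcess {E Ω : Type*} [MeasurableSpace E] [MeasurableSpace Ω]
    (P : ℝ≥0 → Kernel E E) (X : ℝ≥0 → Ω → E) (Pr : Measure Ω) : Prop where
  measurable : Measurable (Function.uncurry X)
  markov : ∀ s t : ℝ≥0, s ≤ t → ∀ f : E → ℝ, Measurable f → (∃ C : ℝ, ∀ x, |f x| ≤ C) →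
    Pr[fun ω => f (X t ω) | pastSigma X s] =ᵐ[Pr] fun ω => ∫ y, f y ∂(P (t - s) (X s ω))

/-- The class `𝒫₁(E)` of probability measures with finite first moment. -/
structure IsP1 {E : Type*} [MetricSpace E] [MeasurableSpace E] (μ : Measure E) : Prop where
  isProb : IsProbabilityMeasure μ
  moment : ∃ x₀ : E, Integrable (fun x => dist x x₀) μ

/-- The Wasserstein-1 distance `sup { |⟨μ,f⟩ - ⟨ν,f⟩| : ‖f‖_L ≤ 1 }`; it is only applied to
measures in `𝒫₁(E)`, for which the integrals converge. -/
noncomputable def wasserstein1 {E : Type*} [MetricSpace E] [MeasurableSpace E]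
    (μ ν : Measure E) : ℝ≥0∞ :=
  ⨆ (f : E → ℝ) (_ : LipschitzWith 1 f), ENNReal.ofReal |(∫ x, f x ∂μ) - ∫ x, f x ∂ν|

/-- H0: the Feller property and stochastic continuity. -/
structure HypH0 {E : Type*} [MetricSpace E] [MeasurableSpace E] (P : ℝ≥0 → Kernel E E) : Prop where
  feller : ∀ (t : ℝ≥0) (f : E →ᵇ ℝ), Continuous fun x => ∫ y, f y ∂(P t x)
  stochCont : ∀ (x : E) (f : E →ᵇ ℝ),
    Tendsto (fun t : ℝ≥0 => ∫ y, f y ∂(P t x)) (𝓝[>] 0) (𝓝 (f x))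

/-- H1: the dual semigroup `μ ↦ μ P^t = P t ∘ₘ μ` preserves `𝒫₁(E)` and contracts the
Wasserstein-1 distance exponentially. -/
structure HypH1 {E : Type*} [MetricSpace E] [MeasurableSpace E] (P : ℝ≥0 → Kernel E E) : Prop where
  preserves : ∀ (t : ℝ≥0) (μ : Measure E), IsP1 μ → IsP1 (P t ∘ₘ μ)
  contraction : ∃ c > (0 : ℝ), ∃ γ > (0 : ℝ), ∀ (t : ℝ≥0) (μ ν : Measure E), IsP1 μ → IsP1 ν →
    wasserstein1 (P t ∘ₘ μ) (P t ∘ₘ ν) ≤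
      ENNReal.ofReal (c * Real.exp (-γ * t)) * wasserstein1 μ ν

/-- H2: local bound on a moment of order `2 + δ` of the transition probabilities. -/
def HypH2 {E : Type*} [MetricSpace E] [MeasurableSpace E] (P : ℝ≥0 → Kernel E E) : Prop :=
  ∃ x₀ : E, ∃ δ > (0 : ℝ), ∀ (R : ℝ) (T : ℝ≥0),
    (⨆ t ∈ Set.Icc 0 T, ⨆ x ∈ Metric.ball x₀ R, ∫⁻ y, edist y x₀ ^ (2 + δ) ∂(P t x)) < ⊤

/-- H3: bound, uniform in time, on a moment of order `2 + δ` of the process. -/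
def HypH3 {E Ω : Type*} [MetricSpace E] [MeasurableSpace Ω]
    (X : ℝ≥0 → Ω → E) (Pr : Measure Ω) : Prop :=
  ∃ x₀ : E, ∃ δ > (0 : ℝ), (⨆ t : ℝ≥0, ∫⁻ ω, edist (X t ω) x₀ ^ (2 + δ) ∂Pr) < ⊤

/-- The additive functional `∫₀ᵀ φ(X_s) ds`. -/
noncomputable def additiveFunctional {E Ω : Type*} (X : ℝ≥0 → Ω → E) (φ : E → ℝ) (T : ℝ) (ω : Ω) :
    ℝ :=
  ∫ s in (0 : ℝ)..T, φ (X s.toNNReal ω)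

set_option linter.unusedSectionVars false

/-! Applied to Dirac masses, the Wasserstein contraction says that `P^t f` has Lipschitz constant
`O(e^{-γt})` whenever `f` is Lipschitz. The laws `μ₀ P^n` are therefore Cauchy against Lipschitz
functions; completeness turns this into tightness, and a weak limit point is invariant by the Feller
property. Comparing `δ_x` with the invariant measure gives `|P^t f(x) - ∫ f dμ_*| ≤ C K e^{-γt} (1 +
dist x x₀)`. These estimates form `SpectralGap`, on which everything after existence rests;
uniqueness follows by integrating the last bound.

For a centered Lipschitz `f` the potential `χ = ∫₀^∞ P^r f dr` is again Lipschitz. With `Y_s =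
f(X_s)` and `S_t = ∫₀ᵗ Y_s ds`, Taylor's formula reads `h(S_T) = h(0) + h'(0) S_T + ∫₀ᵀ (S_T - S_u)
Y_u h''(S_u) du`. Conditioning on the past at `u` replaces `S_T - S_u` by the potential truncated at
`T - u`, which differs from `χ(X_u)` by `O(e^{-γ(T-u)})`. Hence, up to an error bounded in `T`, `𝔼
h(S_T) = h(0) + ∫₀ᵀ 𝔼[(f χ)(X_u) h''(S_u)] du` (`abs_integral_future_sub_le`). No martingale
approximation is needed.

Taking `h(x) = x²` gives `𝔼 S_T² = O(T)`; for clipped observables this needs only first moments and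
yields the law of large numbers, the clipping error being controlled in `L¹`.

Taking `h(x) = cos(λx + β)` gives an approximate integral equation. Since `w(S_u)`, with `w(x) =
cos(λx + β)`, moves by `O(λr)` over a lag `r` while `X_u` forgets its past at rate `e^{-γr}`, `𝔼[(f
χ)(X_u) w(S_u)]` is close to `m 𝔼 w(S_u)` (`exists_average_mul_potential`); the moment of order `2 +
δ` permits the truncation of `f χ`. With `λ = θ/√T`, Gronwall's lemma gives the limit `cos β ·
exp(-m θ²)`, so that `σ² = 2m`, and Lévy's continuity theorem concludes. -/

/-! ### Lipschitz functions and the Wasserstein distance. -/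

theorem LipschitzWith.abs_sub_le_mul_dist {E : Type*} [MetricSpace E] {K : ℝ≥0} {f : E → ℝ}
    (hf : LipschitzWith K f) (x y : E) : |f x - f y| ≤ K * dist x y := by
  simpa [Real.dist_eq] using hf.dist_le_mul x y

theorem LipschitzWith.integrable_of_integrable_dist {E : Type*} [MetricSpace E]
    [SecondCountableTopology E] [MeasurableSpace E] [BorelSpace E] {μ : Measure E}
    [IsFiniteMeasure μ] {x₀ : E} (hμ : Integrable (fun x => dist x x₀) μ) {K : ℝ≥0} {f : E → ℝ}
    (hf : LipschitzWith K f) : Integrable f μ := by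
  refine ((integrable_const |f x₀|).add (hμ.const_mul (K : ℝ))).mono'
    hf.continuous.measurable.aestronglyMeasurable (ae_of_all _ fun x => ?_)
  have h := hf.abs_sub_le_mul_dist x x₀
  have h2 : |f x| ≤ |f x - f x₀| + |f x₀| := by simpa using abs_add_le (f x - f x₀) (f x₀)
  simp only [Real.norm_eq_abs, Pi.add_apply]
  linarith

theorem IsP1.integrable_of_lipschitz {E : Type*} [MetricSpace E]
    [SecondCountableTopology E] [MeasurableSpace E] [BorelSpace E] {μ : Measure E}
    (hμ : IsP1 μ) {K : ℝ≥0} {f : E → ℝ} (hf : LipschitzWith K f) : Integrable f μ := by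
  have := hμ.isProb
  obtain ⟨x₀, h⟩ := hμ.moment
  exact hf.integrable_of_integrable_dist h

theorem IsP1.dirac {E : Type*} [MetricSpace E] [MeasurableSpace E] [BorelSpace E] (x : E) :
    IsP1 (Measure.dirac x) :=
  ⟨inferInstance, x, integrable_dirac (by simp)⟩

theorem wasserstein1_le_ofReal {E : Type*} [MetricSpace E] [MeasurableSpace E] {μ ν : Measure E}
    {D : ℝ} (h : ∀ f : E → ℝ, LipschitzWith 1 f → |(∫ x, f x ∂μ) - ∫ x, f x ∂ν| ≤ D) :
    wasserstein1 μ ν ≤ ENNReal.ofReal D :=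
  iSup₂_le fun f hf => ENNReal.ofReal_le_ofReal (h f hf)

theorem abs_integral_sub_le_of_wasserstein1_le {E : Type*} [MetricSpace E] [MeasurableSpace E]
    {μ ν : Measure E} [IsProbabilityMeasure μ] [IsProbabilityMeasure ν] {D : ℝ} (hD : 0 ≤ D)
    (h : wasserstein1 μ ν ≤ ENNReal.ofReal D) {K : ℝ≥0} {f : E → ℝ} (hf : LipschitzWith K f) :
    |(∫ x, f x ∂μ) - ∫ x, f x ∂ν| ≤ K * D := by
  have key : ∀ g : E → ℝ, LipschitzWith 1 g → |(∫ x, g x ∂μ) - ∫ x, g x ∂ν| ≤ D := fun g hg =>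
    (ENNReal.ofReal_le_ofReal_iff hD).1 ((le_iSup₂ (f := fun (g : E → ℝ) (_ : LipschitzWith 1 g) =>
      ENNReal.ofReal |(∫ x, g x ∂μ) - ∫ x, g x ∂ν|) g hg).trans h)
  -- Rescaling by `K⁻¹` needs `K ≠ 0`. For `K = 0` the function is constant and both integrals
  -- agree, the measures being probabilities.
  rcases eq_or_ne K 0 with rfl | hK
  · rcases isEmpty_or_nonempty E with hE | ⟨⟨x₀⟩⟩
    · simp [Measure.eq_zero_of_isEmpty]
    · have : f = fun _ => f x₀ := by
        ext x
        have := hf.abs_sub_le_mul_dist x x₀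
        simp only [NNReal.coe_zero, zero_mul] at this
        linarith [abs_nonpos_iff.1 this]
      rw [this]; simp
  · have hK' : (0 : ℝ) < K := by positivity
    have h1 : LipschitzWith 1 fun x => (K : ℝ)⁻¹ * f x := by
      refine LipschitzWith.of_dist_le_mul fun x y => ?_
      have := hf.abs_sub_le_mul_dist x y
      rw [Real.dist_eq, ← mul_sub, abs_mul, abs_of_pos (inv_pos.2 hK'), inv_mul_le_iff₀ hK']
      simpa using this
    have h2 := key _ h1
    rw [integral_const_mul, integral_const_mul, ← mul_sub, abs_mul, abs_of_pos (inv_pos.2 hK'),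
      inv_mul_le_iff₀ hK'] at h2
    exact h2

/-- Both integrals are compared with `f x₀`. This supplies the finite constant `D` demanded by
`HypH1.exists_contraction`. -/
theorem IsP1.exists_forall_abs_integral_sub_le {E : Type*} [MetricSpace E]
    [SecondCountableTopology E] [MeasurableSpace E] [BorelSpace E] {μ ν : Measure E} (hμ : IsP1 μ)
    (hν : IsP1 ν) (x₀ : E) {f : E → ℝ} (hf : LipschitzWith 1 f) :
    |(∫ x, f x ∂μ) - ∫ x, f x ∂ν| ≤ (∫ x, dist x x₀ ∂μ) + ∫ x, dist x x₀ ∂ν := by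
  have hpμ := hμ.isProb
  have hpν := hν.isProb
  have hd : LipschitzWith 1 fun x => dist x x₀ := LipschitzWith.dist_left x₀
  have key : ∀ {ρ : Measure E}, IsP1 ρ → |(∫ x, f x ∂ρ) - f x₀| ≤ ∫ x, dist x x₀ ∂ρ := by
    intro ρ hρ
    have := hρ.isProb
    have e : (∫ x, f x ∂ρ) - f x₀ = ∫ x, (f x - f x₀) ∂ρ := by
      rw [integral_sub (hρ.integrable_of_lipschitz hf) (integrable_const _)]; simp
    rw [e]
    refine (abs_integral_le_integral_abs).trans (integral_mono
      ((hρ.integrable_of_lipschitz hf).sub (integrable_const _)).abs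
      (hρ.integrable_of_lipschitz hd) fun x => ?_)
    simpa using hf.abs_sub_le_mul_dist x x₀
  have h1 := key hμ
  have h2 := key hν
  rw [abs_sub_comm] at h2
  calc |(∫ x, f x ∂μ) - ∫ x, f x ∂ν|
      = |((∫ x, f x ∂μ) - f x₀) + (f x₀ - ∫ x, f x ∂ν)| := by ring_nf
    _ ≤ _ := (abs_add_le _ _).trans (add_le_add h1 h2)

/-- The contraction estimate of `HypH1`, read on integrals of Lipschitz functions. -/
theorem HypH1.exists_contraction {E : Type*} [MetricSpace E] [MeasurableSpace E]
    {P : ℝ≥0 → Kernel E E} (h1 : HypH1 P) :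
    ∃ c > (0 : ℝ), ∃ γ > (0 : ℝ), ∀ (t : ℝ≥0) (μ ν : Measure E), IsP1 μ → IsP1 ν →
      ∀ D : ℝ, 0 ≤ D →
      (∀ f : E → ℝ, LipschitzWith 1 f → |(∫ x, f x ∂μ) - ∫ x, f x ∂ν| ≤ D) →
      ∀ (K : ℝ≥0) (f : E → ℝ), LipschitzWith K f →
        |(∫ x, f x ∂(P t ∘ₘ μ)) - ∫ x, f x ∂(P t ∘ₘ ν)| ≤ c * Real.exp (-γ * t) * K * D := by
  obtain ⟨c, hc, γ, hγ, h⟩ := h1.contraction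
  refine ⟨c, hc, γ, hγ, fun t μ ν hμ hν D hD hf K f hfK => ?_⟩
  have := (h1.preserves t μ hμ).isProb
  have := (h1.preserves t ν hν).isProb
  have h2 : wasserstein1 (P t ∘ₘ μ) (P t ∘ₘ ν) ≤ ENNReal.ofReal (c * Real.exp (-γ * t) * D) := by
    rw [ENNReal.ofReal_mul (by positivity)]
    exact (h t μ ν hμ hν).trans (by gcongr; exact wasserstein1_le_ofReal hf)
  have h3 := abs_integral_sub_le_of_wasserstein1_le (by positivity) h2 hfK
  linarith

theorem MeasureTheory.Measure.integral_comp_kernel {α β : Type*} [MeasurableSpace α]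
    [MeasurableSpace β] {μ : Measure α} {κ : Kernel α β} {f : β → ℝ}
    (hf : Integrable f (κ ∘ₘ μ)) : ∫ y, f y ∂(κ ∘ₘ μ) = ∫ x, ∫ y, f y ∂(κ x) ∂μ := by
  rw [Measure.comp_eq_comp_const_apply] at hf ⊢
  rw [Kernel.integral_comp hf]
  simp

/-! ### Clipping of real-valued functions. -/

/-- Clipping to `[-n, n]`. -/
def clip (n : ℝ) (y : ℝ) : ℝ := max (-n) (min y n)

theorem lipschitzWith_clip (n : ℝ) : LipschitzWith 1 (clip n) :=
  (LipschitzWith.id.min_const n).const_max (-n)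

theorem abs_clip_le {n : ℝ} (hn : 0 ≤ n) (y : ℝ) : |clip n y| ≤ n :=
  abs_le.2 ⟨le_max_left _ _, max_le (by linarith) (min_le_right _ _)⟩

theorem abs_clip_le_abs {n : ℝ} (hn : 0 ≤ n) (y : ℝ) : |clip n y| ≤ |y| := by
  rw [clip]
  rcases le_total 0 y with h | h
  · rw [abs_of_nonneg h, max_eq_right (by linarith [le_min h hn]), abs_of_nonneg (le_min h hn)]
    exact min_le_left _ _
  · rw [min_eq_left (by linarith), abs_of_nonpos h, abs_of_nonpos (max_le (by linarith) h)]
    linarith [le_max_right (-n) y]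

theorem clip_eq_self {n y : ℝ} (h : |y| ≤ n) : clip n y = y := by
  rw [clip, min_eq_left (abs_le.1 h).2, max_eq_right (abs_le.1 h).1]

theorem tendsto_clip (y : ℝ) : Tendsto (fun n : ℕ => clip n y) atTop (𝓝 y) := by
  refine tendsto_const_nhds.congr' ?_
  filter_upwards [eventually_ge_atTop ⌈|y|⌉₊] with n hn
  exact (clip_eq_self ((Nat.le_ceil _).trans (by exact_mod_cast hn))).symm

theorem LipschitzWith.clip_comp {E : Type*} [MetricSpace E] {K : ℝ≥0} {f : E → ℝ}
    (hf : LipschitzWith K f) (n : ℝ) : LipschitzWith K fun x => clip n (f x) := by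
  simpa [Function.comp_def] using (lipschitzWith_clip n).comp hf

/-! ### Tightness and existence of an invariant measure. -/

/-- A sequence of probability measures on a Polish space whose integrals of `1`-Lipschitz
functions are uniformly Cauchy is tight. -/
theorem isTightMeasureSet_of_lipschitz_cauchy {E : Type*} [MetricSpace E] [CompleteSpace E]
    [SecondCountableTopology E] [MeasurableSpace E] [BorelSpace E]
    {μ : ℕ → Measure E} [∀ n, IsProbabilityMeasure (μ n)] {a : ℕ → ℝ}
    (ha : Tendsto a atTop (𝓝 0))
    (h : ∀ n m, n ≤ m → ∀ (K : ℝ≥0) (f : E → ℝ), LipschitzWith K f →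
      |(∫ x, f x ∂(μ n)) - ∫ x, f x ∂(μ m)| ≤ K * a n) :
    IsTightMeasureSet (Set.range μ) := by
  have single : ∀ n, ∀ ε : ℝ≥0∞, 0 < ε → ∃ A : Set E, IsCompact A ∧ μ n Aᶜ ≤ ε := by
    intro n ε hε
    obtain ⟨A, hA, h2⟩ := isTightMeasureSet_iff_exists_isCompact_measure_compl_le.1
      (isTightMeasureSet_singleton (μ := μ n)) ε hε
    exact ⟨A, hA, h2 _ rfl⟩
  -- One compact set whose `δ`-thickening serves all `n`: the indices `n ≤ N` are treated one by
  -- one, the later ones are compared with `μ N` through the distance to `A N` truncated at `δ`.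
  have step : ∀ δ : ℝ, 0 < δ → ∀ ε : ℝ, 0 < ε → ∃ A : Set E, IsCompact A ∧
      ∀ n, μ n (Metric.cthickening δ A)ᶜ ≤ ENNReal.ofReal ε := by
    intro δ hδ ε hε
    have hε2 : 0 < ENNReal.ofReal (ε / 2) := ENNReal.ofReal_pos.2 (by positivity)
    -- Markov's inequality at level `δ` will divide by `δ`; the other `ε / 2` is the mass that `μ N`
    -- leaves outside `A N`.
    obtain ⟨N, hN⟩ := (ha.eventually_lt_const (show 0 < δ * (ε / 2) by positivity)).exists
    choose A hA hμA using fun n => single n _ hε2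
    refine ⟨⋃ n ∈ Finset.range (N + 1), A n,
      (Finset.range (N + 1)).isCompact_biUnion fun n _ => hA n, fun n => ?_⟩
    rcases le_total n N with hn | hn
    · refine (measure_mono (Set.compl_subset_compl.2 ?_)).trans
        ((hμA n).trans (ENNReal.ofReal_le_ofReal (by linarith)))
      exact (Set.subset_biUnion_of_mem (u := fun n => A n)
        (show n ∈ (Finset.range (N + 1) : Set ℕ) by simpa using Nat.lt_succ_of_le hn)).trans
        (Metric.self_subset_cthickening _)
    · refine (measure_mono (Set.compl_subset_compl.2 (Metric.cthickening_subset_of_subset δ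
        (Set.subset_biUnion_of_mem (u := fun n => A n)
        (show N ∈ (Finset.range (N + 1) : Set ℕ) by simp))))).trans ?_
      set B := A N with hB
      -- `infDist` to the empty set is `0`, so the test function would be useless; but then `1 ≤ ε /
      -- 2` and the bound is trivial.
      rcases B.eq_empty_or_nonempty with hBe | hBn
      · have h1 := hμA N
        rw [← hB, hBe, Set.compl_empty, measure_univ] at h1
        exact prob_le_one.trans (h1.trans (ENNReal.ofReal_le_ofReal (by linarith)))
      set f : E → ℝ := fun x => min (Metric.infDist x B) δ with hf
      have hfL : LipschitzWith 1 f := (Metric.lipschitz_infDist_pt B).min_const δ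
      have hfm : Measurable f := hfL.continuous.measurable
      have hf0 : ∀ x, 0 ≤ f x := fun x => le_min Metric.infDist_nonneg hδ.le
      have hfi : ∀ n, Integrable f (μ n) := fun n =>
        (integrable_const δ).mono' hfm.aestronglyMeasurable (ae_of_all _ fun x => by
          rw [Real.norm_eq_abs, abs_of_nonneg (hf0 x)]; exact min_le_right _ _)
      have h1 := h N n hn 1 f hfL
      have h2 : ∫ x, f x ∂(μ N) ≤ δ * (ε / 2) := by
        calc ∫ x, f x ∂(μ N) ≤ ∫ x, Bᶜ.indicator (fun _ => δ) x ∂(μ N) := by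
              refine integral_mono (hfi N)
                ((integrable_const δ).indicator (hA N).isClosed.measurableSet.compl) fun x => ?_
              by_cases hx : x ∈ B
              · simp [f, hx, Metric.infDist_zero_of_mem hx, hδ.le]
              · simp [f, hx]
          _ = (μ N).real Bᶜ * δ := by
              rw [integral_indicator_const _ (hA N).isClosed.measurableSet.compl, smul_eq_mul]
          _ ≤ (ε / 2) * δ := by
              gcongr
              exact ENNReal.toReal_le_of_le_ofReal (by positivity) (hμA N)
          _ = _ := mul_comm _ _
      have h3 : δ * (μ n).real (Metric.cthickening δ B)ᶜ ≤ ∫ x, f x ∂(μ n) := by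
        refine le_trans ?_ (mul_meas_ge_le_integral_of_nonneg (ae_of_all _ hf0) (hfi n) δ)
        refine mul_le_mul_of_nonneg_left (measureReal_mono fun x hx => ?_) hδ.le
        have : δ < Metric.infDist x B := by
          by_contra! hcon
          refine hx (Metric.mem_cthickening_iff.2 ?_)
          rwa [ENNReal.le_ofReal_iff_toReal_le (Metric.infEDist_ne_top hBn) hδ.le]
        simp [f, this.le]
      have h4 : δ * (μ n).real (Metric.cthickening δ B)ᶜ ≤ δ * ε := by
        have := (abs_le.1 h1).1
        simp only [NNReal.coe_one, one_mul] at this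
        nlinarith
      rw [← ofReal_measureReal]
      exact ENNReal.ofReal_le_ofReal (le_of_mul_le_mul_left h4 hδ)
  rw [isTightMeasureSet_iff_exists_isCompact_measure_compl_le]
  intro ε hε
  obtain ⟨ε', hε'0, hε'⟩ : ∃ ε' : ℝ, 0 < ε' ∧ ENNReal.ofReal ε' ≤ ε := by
    obtain ⟨r, hr0, hr⟩ := ENNReal.lt_iff_exists_nnreal_btwn.1 hε
    exact ⟨r, by simpa using hr0, by simpa using hr.le⟩
  -- Radii tending to `0` make the intersection of the thickenings totally bounded, hence compact by
  -- completeness; the masses `ε' 2^{-(k+1)}` left outside sum to `ε'`.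
  choose A hA hμA using fun k : ℕ =>
    step (1 / (k + 1)) (by positivity) (ε' * (1 / 2) ^ (k + 1)) (by positivity)
  refine ⟨⋂ k : ℕ, Metric.cthickening (1 / ((k : ℝ) + 1)) (A k), ?_, ?_⟩
  · refine isCompact_iff_totallyBounded_isComplete.2 ⟨?_,
      (isClosed_iInter fun k => Metric.isClosed_cthickening).isComplete⟩
    rw [Metric.totallyBounded_iff]
    intro r hr
    obtain ⟨k, hk⟩ := exists_nat_one_div_lt (show 0 < r / 2 by positivity)
    obtain ⟨s, hs, hsA⟩ := Metric.totallyBounded_iff.1 (hA k).totallyBounded (r / 2) (by positivity)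
    refine ⟨s, hs, fun x hx => ?_⟩
    have hx1 := Set.mem_iInter.1 hx k
    have hx2 := Metric.cthickening_subset_thickening' (by positivity) hk (A k) hx1
    obtain ⟨y, hy, hxy⟩ := Metric.mem_thickening_iff.1 hx2
    obtain ⟨z, hz, hyz⟩ := Set.mem_iUnion₂.1 (hsA hy)
    refine Set.mem_iUnion₂.2 ⟨z, hz, ?_⟩
    rw [Metric.mem_ball] at hyz ⊢
    linarith [dist_triangle x y z]
  · rintro _ ⟨n, rfl⟩
    rw [Set.compl_iInter]
    refine (measure_iUnion_le _).trans (le_trans ?_ hε')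
    calc ∑' k : ℕ, μ n (Metric.cthickening (1 / ((k : ℝ) + 1)) (A k))ᶜ
        ≤ ∑' k : ℕ, ENNReal.ofReal (ε' * (1 / 2) ^ (k + 1)) := ENNReal.tsum_le_tsum fun k => hμA k n
      _ = ENNReal.ofReal ε' := by
          have hs : HasSum (fun k : ℕ => ε' * (1 / 2 : ℝ) ^ (k + 1)) ε' := by
            have := hasSum_geometric_two' ε'
            simpa [pow_succ, div_eq_mul_inv, mul_comm, mul_assoc, mul_left_comm] using this
          rw [← ENNReal.ofReal_tsum_of_nonneg (fun k => by positivity) hs.summable, hs.tsum_eq]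

/-- A sequence of probability measures on a Polish space whose integrals of `1`-Lipschitz
functions are uniformly Cauchy has a weakly convergent subsequence. -/
theorem exists_subseq_tendsto_of_lipschitz_cauchy {E : Type*} [MetricSpace E] [CompleteSpace E]
    [SecondCountableTopology E] [MeasurableSpace E] [BorelSpace E]
    {μ : ℕ → ProbabilityMeasure E} {a : ℕ → ℝ} (ha : Tendsto a atTop (𝓝 0))
    (h : ∀ n m, n ≤ m → ∀ (K : ℝ≥0) (f : E → ℝ), LipschitzWith K f →
      |(∫ x, f x ∂(μ n : Measure E)) - ∫ x, f x ∂(μ m : Measure E)| ≤ K * a n) :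
    ∃ (ν : ProbabilityMeasure E) (φ : ℕ → ℕ), StrictMono φ ∧ Tendsto (μ ∘ φ) atTop (𝓝 ν) := by
  have ht := isTightMeasureSet_of_lipschitz_cauchy (μ := fun n => (μ n : Measure E)) ha h
  have hc : IsCompact (closure (Set.range μ)) := by
    refine isCompact_closure_of_isTightMeasureSet ?_
    convert ht using 1
    ext; simp
  obtain ⟨ν, -, φ, hφ, hν⟩ := hc.isSeqCompact fun n => subset_closure (Set.mem_range_self n)
  exact ⟨ν, φ, hφ, hν⟩

theorem IsTransitionSemigroup.comp_comp {E : Type*} [MeasurableSpace E] {P : ℝ≥0 → Kernel E E}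
    (hP : IsTransitionSemigroup P) (s t : ℝ≥0) (μ : Measure E) :
    P t ∘ₘ (P s ∘ₘ μ) = P (s + t) ∘ₘ μ := by
  rw [Measure.comp_assoc, hP.add]

/-- Fatou's lemma for weak convergence, from the open-set form of the portmanteau theorem. It
carries the first moment, an unbounded function, to the limit measure. -/
theorem integrable_of_tendsto_probabilityMeasure {E : Type*} [MetricSpace E]
    [MeasurableSpace E] [BorelSpace E] {μ : ℕ → ProbabilityMeasure E} {ν : ProbabilityMeasure E}
    (h : Tendsto μ atTop (𝓝 ν)) {f : E → ℝ} (hf : Continuous f) (hf0 : 0 ≤ f) {B : ℝ}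
    (hfi : ∀ n, Integrable f (μ n : Measure E)) (hB : ∀ n, ∫ x, f x ∂(μ n : Measure E) ≤ B) :
    Integrable f (ν : Measure E) := by
  have h1 := lintegral_le_liminf_lintegral_of_forall_isOpen_measure_le_liminf_measure
    (μ := (ν : Measure E)) (μs := fun n => (μ n : Measure E)) hf hf0
    (fun G hG => ProbabilityMeasure.le_liminf_measure_open_of_tendsto h hG)
  refine ⟨hf.measurable.aestronglyMeasurable, ?_⟩
  rw [hasFiniteIntegral_iff_ofReal (ae_of_all _ hf0)]
  refine (h1.trans ?_).trans_lt (ENNReal.ofReal_lt_top (r := B))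
  refine liminf_le_of_le (by isBoundedDefault) fun b hb => ?_
  obtain ⟨n, hn⟩ := hb.exists
  refine hn.trans ?_
  rw [← ofReal_integral_eq_lintegral_ofReal (hfi n) (ae_of_all _ hf0)]
  exact ENNReal.ofReal_le_ofReal (hB n)

theorem exists_invariant_isP1 {E : Type*} [MetricSpace E] [CompleteSpace E]
    [SecondCountableTopology E] [MeasurableSpace E] [BorelSpace E]
    {P : ℝ≥0 → Kernel E E} (hP : IsTransitionSemigroup P) (h0 : HypH0 P) (h1 : HypH1 P)
    {μ₀ : Measure E} (hμ₀ : IsP1 μ₀) :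
    ∃ μs : Measure E, IsP1 μs ∧ ∀ t, Kernel.Invariant (P t) μs := by
  have hM := hP.isMarkov
  have hpμ₀ := hμ₀.isProb
  obtain ⟨x₀, hx₀⟩ := hμ₀.moment
  obtain ⟨c, hc, γ, hγ, hcon⟩ := h1.exists_contraction
  have hd : LipschitzWith 1 fun x => dist x x₀ := LipschitzWith.dist_left x₀
  have hd0 : (0 : E → ℝ) ≤ fun x => dist x x₀ := fun _ => dist_nonneg
  have hPP : ∀ t, IsP1 (P t ∘ₘ μ₀) := fun t => h1.preserves t μ₀ hμ₀
  -- distance between `μ₀` and `μ₀ P^t`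
  have hshift : ∀ t : ℝ≥0, ∃ D : ℝ, 0 ≤ D ∧ ∀ (s : ℝ≥0) (K : ℝ≥0) (f : E → ℝ),
      LipschitzWith K f → |(∫ x, f x ∂(P s ∘ₘ μ₀)) - ∫ x, f x ∂(P (s + t) ∘ₘ μ₀)| ≤
        c * Real.exp (-γ * s) * K * D := by
    intro t
    refine ⟨(∫ x, dist x x₀ ∂μ₀) + ∫ x, dist x x₀ ∂(P t ∘ₘ μ₀), add_nonneg
      (integral_nonneg hd0) (integral_nonneg hd0), fun s K f hf => ?_⟩
    rw [add_comm s t, ← hP.comp_comp t s]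
    exact hcon s _ _ hμ₀ (hPP t) _ (add_nonneg (integral_nonneg hd0) (integral_nonneg hd0))
      (fun g hg => hμ₀.exists_forall_abs_integral_sub_le (hPP t) x₀ hg) K f hf
  set μ : ℕ → ProbabilityMeasure E := fun n => ⟨P n ∘ₘ μ₀, (hPP n).isProb⟩ with hμ
  obtain ⟨D, hD0, hD⟩ := hshift 1
  set r := Real.exp (-γ) with hr
  have hr1 : r < 1 := by rw [hr, Real.exp_lt_one_iff]; linarith
  have hr0 : 0 < r := Real.exp_pos _
  have hexp : ∀ n : ℕ, Real.exp (-γ * ((n : ℝ≥0) : ℝ)) = r ^ n := fun n => by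
    rw [hr, ← Real.exp_nat_mul]; congr 1; push_cast; ring
  -- The partial geometric sum is written as `(r ^ n - r ^ m) / (1 - r)` so that the induction on
  -- `m` closes with equality.
  have hcauchy : ∀ n m, n ≤ m → ∀ (K : ℝ≥0) (f : E → ℝ), LipschitzWith K f →
      |(∫ x, f x ∂(μ n : Measure E)) - ∫ x, f x ∂(μ m : Measure E)| ≤
        K * (c * D / (1 - r) * (r ^ n - r ^ m)) := by
    intro n m hnm K f hf
    induction m, hnm using Nat.le_induction with
    | base => simp
    | succ m _ ih =>
      have h2 := hD m K f hf
      rw [hexp] at h2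
      have h3 : ((m : ℝ≥0) + 1) = ((m + 1 : ℕ) : ℝ≥0) := by push_cast; rfl
      rw [h3] at h2
      have h4 : c * r ^ m * K * D = K * (c * D / (1 - r) * (r ^ m - r ^ (m + 1))) := by
        have : 1 - r ≠ 0 := by linarith
        field_simp; ring
      rw [h4] at h2
      refine (abs_sub_le _ (∫ x, f x ∂(μ m : Measure E)) _).trans ?_
      calc _ ≤ _ := add_le_add ih h2
        _ = _ := by ring
  have ha : Tendsto (fun n : ℕ => c * D / (1 - r) * r ^ n) atTop (𝓝 0) := by
    simpa using (tendsto_pow_atTop_nhds_zero_of_lt_one hr0.le hr1).const_mul (c * D / (1 - r))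
  have hcD : 0 ≤ c * D / (1 - r) := div_nonneg (by positivity) (by linarith)
  obtain ⟨ν, φ, hφ, hν⟩ := exists_subseq_tendsto_of_lipschitz_cauchy ha
    (fun n m hnm K f hf => (hcauchy n m hnm K f hf).trans (by
      have : 0 ≤ r ^ m := by positivity
      gcongr; linarith))
  refine ⟨ν, ⟨inferInstance, x₀, ?_⟩, fun t => ?_⟩
  · refine integrable_of_tendsto_probabilityMeasure (B := (∫ x, dist x x₀ ∂(μ 0 : Measure E)) +
      c * D / (1 - r)) hν hd.continuous hd0
      (fun n => (hPP (φ n)).integrable_of_lipschitz hd) fun n => ?_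
    have h2 := (abs_le.1 (hcauchy 0 (φ n) (Nat.zero_le _) 1 _ hd)).1
    have : 0 ≤ c * D / (1 - r) * r ^ φ n := by positivity
    simp only [NNReal.coe_one, one_mul, pow_zero] at h2
    simp only [Function.comp_apply]
    linarith [mul_sub (c * D / (1 - r)) 1 (r ^ φ n)]
  -- The measures `μ (φ n) P^t` have two weak limits: `ν P^t` by the Feller property, and `ν`
  -- because a shift in time by `t` alters integrals of Lipschitz functions by `O(r ^ φ n)`.
  · have hpr : ∀ ρ : ProbabilityMeasure E, IsProbabilityMeasure (P t ∘ₘ (ρ : Measure E)) :=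
      fun ρ => inferInstance
    set ρ : ℕ → ProbabilityMeasure E := fun n => ⟨P t ∘ₘ (μ (φ n) : Measure E), hpr _⟩
    set ν' : ProbabilityMeasure E := ⟨P t ∘ₘ (ν : Measure E), hpr ν⟩ with hν'
    have hlim1 : Tendsto ρ atTop (𝓝 ν') := by
      rw [ProbabilityMeasure.tendsto_iff_forall_integral_tendsto]
      intro f
      have e : ∀ κ : ProbabilityMeasure E, ∫ x, f x ∂(P t ∘ₘ (κ : Measure E)) =
          ∫ x, ∫ y, f y ∂(P t x) ∂(κ : Measure E) := fun κ =>
        Measure.integral_comp_kernel (f.integrable _)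
      have := (ProbabilityMeasure.tendsto_iff_forall_integral_tendsto.1 hν)
        (BoundedContinuousFunction.ofNormedAddCommGroup _ (h0.feller t f) ‖f‖ fun x => by
          simpa using norm_integral_le_of_norm_le_const (μ := P t x)
            (ae_of_all _ fun y => f.norm_coe_le_norm y))
      simp only [ProbabilityMeasure.coe_mk, ρ, ν']
      simp only [e]
      exact this
    have hlim2 : Tendsto ρ atTop (𝓝 ν) := by
      rw [tendsto_iff_forall_lipschitz_integral_tendsto] at hν ⊢
      rintro f hfb ⟨K, hfK⟩
      have h3 := hν f hfb ⟨K, hfK⟩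
      obtain ⟨D', hD'0, hD'⟩ := hshift t
      have h4 : Tendsto (fun n => c * r ^ φ n * K * D') atTop (𝓝 0) := by
        have := (((tendsto_pow_atTop_nhds_zero_of_lt_one hr0.le hr1).comp
          hφ.tendsto_atTop).const_mul
          c).mul_const (K * D' : ℝ)
        simpa [Function.comp_def, mul_assoc] using this
      have h5 : Tendsto (fun n => (∫ x, f x ∂(μ (φ n) : Measure E)) -
          ∫ x, f x ∂(ρ n : Measure E)) atTop (𝓝 0) := by
        refine squeeze_zero_norm (fun n => ?_) h4
        have := hD' (φ n) K f hfK
        rw [hexp] at this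
        simp only [ρ, μ, ProbabilityMeasure.coe_mk, hP.comp_comp]
        exact this
      simpa using h3.sub h5
    have := tendsto_nhds_unique hlim1 hlim2
    exact congrArg (fun κ : ProbabilityMeasure E => (κ : Measure E)) this

/-! ### Spectral gap and uniqueness of the invariant measure. -/

/-- Exponential convergence of `P^t` on Lipschitz functions towards the measure `μ`, with the
weight `1 + dist x x₀`. -/
structure SpectralGap {E : Type*} [MetricSpace E] [MeasurableSpace E] (P : ℝ≥0 → Kernel E E)
    (μ : Measure E) (x₀ : E) (C γ : ℝ) : Prop where
  const_pos : 0 < C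
  rate_pos : 0 < γ
  isP1 : IsP1 μ
  integrable : ∀ (t : ℝ≥0) (x : E) (K : ℝ≥0) (f : E → ℝ), LipschitzWith K f →
    Integrable f (P t x)
  lipschitz : ∀ (t K : ℝ≥0) (f : E → ℝ), LipschitzWith K f → ∀ x y,
    |(∫ z, f z ∂(P t x)) - ∫ z, f z ∂(P t y)| ≤ C * K * Real.exp (-γ * t) * dist x y
  ergodic : ∀ (t K : ℝ≥0) (f : E → ℝ), LipschitzWith K f → ∀ x,
    |(∫ z, f z ∂(P t x)) - ∫ z, f z ∂μ| ≤ C * K * Real.exp (-γ * t) * (1 + dist x x₀)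
  measurable : ∀ (K : ℝ≥0) (f : E → ℝ), LipschitzWith K f → ∀ x,
    Measurable fun t : ℝ≥0 => ∫ z, f z ∂(P t x)

/-- A right-continuous function is the pointwise limit of its values at grid points lying to the
right, and each such approximation factors through `ℕ`. The `+ 1` in the numerator makes the grid
point strictly larger than `t`, as `𝓝[>] 0` requires. -/
theorem measurable_of_tendsto_nhdsGT {g : ℝ≥0 → ℝ}
    (hg : ∀ t, Tendsto (fun h => g (t + h)) (𝓝[>] 0) (𝓝 (g t))) : Measurable g := by
  have hpos : ∀ n : ℕ, (0 : ℝ≥0) < n + 1 := fun n => by positivity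
  have hlt : ∀ (t : ℝ≥0) (n : ℕ), t < (⌊(n + 1 : ℝ≥0) * t⌋₊ + 1 : ℝ≥0) / (n + 1) := fun t n => by
    rw [lt_div_iff₀ (hpos n), mul_comm]
    exact Nat.lt_floor_add_one _
  have hle : ∀ (t : ℝ≥0) (n : ℕ),
      (⌊(n + 1 : ℝ≥0) * t⌋₊ + 1 : ℝ≥0) / (n + 1) ≤ t + 1 / (n + 1) := fun t n => by
    have e : (t + 1 / (n + 1)) * (n + 1 : ℝ≥0) = (n + 1) * t + 1 := by
      have := (hpos n).ne'
      field_simp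
    rw [div_le_iff₀ (hpos n), e]
    gcongr
    exact Nat.floor_le zero_le
  refine measurable_of_tendsto_metrizable
    (f := fun (n : ℕ) t => g ((⌊(n + 1 : ℝ≥0) * t⌋₊ + 1 : ℝ≥0) / (n + 1))) (fun n => ?_)
    (tendsto_pi_nhds.2 fun t => ?_)
  · exact (measurable_from_nat (f := fun k : ℕ => g ((k + 1 : ℝ≥0) / (n + 1)))).comp
      (Nat.measurable_floor.comp (measurable_const.mul measurable_id))
  · have h1 : Tendsto (fun n : ℕ => (⌊(n + 1 : ℝ≥0) * t⌋₊ + 1 : ℝ≥0) / (n + 1) - t) atTop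
        (𝓝[>] 0) := by
      refine tendsto_nhdsWithin_iff.2 ⟨?_, Eventually.of_forall fun n => tsub_pos_of_lt (hlt t n)⟩
      refine tendsto_of_tendsto_of_tendsto_of_le_of_le tendsto_const_nhds
        (tendsto_one_div_add_atTop_nhds_zero_nat (𝕜 := ℝ≥0)) (fun n => zero_le) fun n => ?_
      exact tsub_le_iff_left.2 (hle t n)
    refine ((hg t).comp h1).congr fun n => ?_
    simp only [Function.comp_apply, add_tsub_cancel_of_le (hlt t n).le]

theorem IsTransitionSemigroup.integral_add {E : Type*} [MeasurableSpace E] {P : ℝ≥0 → Kernel E E}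
    (hP : IsTransitionSemigroup P) (s t : ℝ≥0) (x : E) {f : E → ℝ}
    (hf : Integrable f (P (s + t) x)) :
    ∫ z, f z ∂(P (s + t) x) = ∫ y, ∫ z, f z ∂(P t y) ∂(P s x) := by
  rw [hP.add] at hf ⊢
  exact Kernel.integral_comp hf

/-- Right continuity in time: `P^{t+h} f = P^t (P^h f)`, and `P^h f → f` pointwise and boundedly. -/
theorem HypH0.measurable_integral {E : Type*} [MetricSpace E] [MeasurableSpace E] [BorelSpace E]
    {P : ℝ≥0 → Kernel E E} (h0 : HypH0 P) (hP : IsTransitionSemigroup P) (f : E →ᵇ ℝ) (x : E) :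
    Measurable fun t : ℝ≥0 => ∫ z, f z ∂(P t x) := by
  have hM := hP.isMarkov
  refine measurable_of_tendsto_nhdsGT fun t => ?_
  simp_rw [hP.integral_add t _ x (f.integrable _)]
  refine tendsto_integral_filter_of_dominated_convergence (fun _ => ‖f‖)
    (Eventually.of_forall fun h => (h0.feller h f).measurable.aestronglyMeasurable)
    (Eventually.of_forall fun h => ae_of_all _ fun y => ?_) (integrable_const _)
    (ae_of_all _ fun y => h0.stochCont y f)
  simpa using norm_integral_le_of_norm_le_const (μ := P h y)
    (ae_of_all _ fun y => f.norm_coe_le_norm y)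

/-- The contraction is applied to `δ_x` against `δ_y`, then to `δ_x` against `μs`. The factor `1 +
M`, with `M` the first moment of `μs`, absorbs `dist x x₀ + M` into the weight `1 + dist x x₀`.
Measurability in time passes from bounded to Lipschitz functions by clipping. -/
theorem exists_spectralGap {E : Type*} [MetricSpace E]
    [SecondCountableTopology E] [MeasurableSpace E] [BorelSpace E]
    {P : ℝ≥0 → Kernel E E} (hP : IsTransitionSemigroup P) (h0 : HypH0 P) (h1 : HypH1 P)
    {μs : Measure E} (hμs : IsP1 μs) (hinv : ∀ t, Kernel.Invariant (P t) μs) (x₀ : E) :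
    ∃ C γ : ℝ, SpectralGap P μs x₀ C γ := by
  have hM := hP.isMarkov
  have hp := hμs.isProb
  obtain ⟨c, hc, γ, hγ, hcon⟩ := h1.exists_contraction
  have hd : LipschitzWith 1 fun x => dist x x₀ := LipschitzWith.dist_left x₀
  have hdirac : ∀ t x, P t ∘ₘ Measure.dirac x = P t x := fun t x =>
    Measure.dirac_bind (P t).measurable x
  have hPP : ∀ t x, IsP1 (P t x) := fun t x => by
    rw [← hdirac]; exact h1.preserves t _ (IsP1.dirac x)
  set M := ∫ x, dist x x₀ ∂μs with hMdef
  have hM0 : 0 ≤ M := integral_nonneg fun _ => dist_nonneg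
  have hcC : c ≤ c * (1 + M) := by nlinarith
  refine ⟨c * (1 + M), γ, by positivity, hγ, hμs, fun t x K f hf =>
    (hPP t x).integrable_of_lipschitz hf, fun t K f hf x y => ?_, fun t K f hf x => ?_,
    fun K f hf x => ?_⟩
  · have h2 := hcon t _ _ (IsP1.dirac x) (IsP1.dirac y) (dist x y) dist_nonneg
      (fun g hg => by simpa using hg.abs_sub_le_mul_dist x y) K f hf
    rw [hdirac, hdirac] at h2
    refine h2.trans ?_
    calc c * Real.exp (-γ * t) * K * dist x y = c * K * Real.exp (-γ * t) * dist x y := by ring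
      _ ≤ _ := by gcongr
  · have h2 := hcon t _ _ (IsP1.dirac x) hμs (dist x x₀ + M) (by positivity)
      (fun g hg => by
        simpa using (IsP1.dirac x).exists_forall_abs_integral_sub_le hμs x₀ hg) K f hf
    rw [hdirac, show P t ∘ₘ μs = μs from hinv t] at h2
    refine h2.trans ?_
    have : dist x x₀ + M ≤ (1 + M) * (1 + dist x x₀) := by
      nlinarith [dist_nonneg (x := x) (y := x₀), mul_nonneg hM0 (dist_nonneg (x := x) (y := x₀))]
    calc c * Real.exp (-γ * t) * K * (dist x x₀ + M)
        ≤ c * Real.exp (-γ * t) * K * ((1 + M) * (1 + dist x x₀)) := by gcongr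
      _ = _ := by ring
  · refine measurable_of_tendsto_metrizable (f := fun (n : ℕ) t => ∫ z, clip n (f z) ∂(P t x))
      (fun n => ?_) (tendsto_pi_nhds.2 fun t => ?_)
    · exact h0.measurable_integral hP (BoundedContinuousFunction.ofNormedAddCommGroup
        (fun z => clip n (f z)) (hf.clip_comp n).continuous n
        (fun z => abs_clip_le (Nat.cast_nonneg n) _)) x
    · refine tendsto_integral_of_dominated_convergence (fun z => |f z|)
        (fun n => (hf.clip_comp n).continuous.measurable.aestronglyMeasurable)
        ((hPP t x).integrable_of_lipschitz hf).abs
        (fun n => ae_of_all _ fun z => abs_clip_le_abs (Nat.cast_nonneg n) _)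
        (ae_of_all _ fun z => tendsto_clip _)

theorem SpectralGap.exp_le_one {E : Type*} [MetricSpace E] [MeasurableSpace E]
    {P : ℝ≥0 → Kernel E E} {μs : Measure E} {x₀ : E} {C γ : ℝ} (hG : SpectralGap P μs x₀ C γ)
    (t : ℝ≥0) : Real.exp (-γ * t) ≤ 1 := by
  rw [Real.exp_le_one_iff]
  nlinarith [hG.rate_pos, t.2, mul_nonneg hG.rate_pos.le t.2]

theorem tendsto_exp_neg_mul_nat {γ : ℝ} (hγ : 0 < γ) :
    Tendsto (fun n : ℕ => Real.exp (-γ * ((n : ℝ≥0) : ℝ))) atTop (𝓝 0) := by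
  refine Real.tendsto_exp_atBot.comp ?_
  simp only [NNReal.coe_natCast]
  exact tendsto_natCast_atTop_atTop.const_mul_atTop_of_neg (by linarith)

/-- As `ν` is not assumed to have a first moment, the contraction cannot be applied to it. Instead
`P^n f → ∫ f dμs` pointwise for bounded Lipschitz `f`, and dominated convergence under `ν` gives `∫
f dν = ∫ f dμs`. -/
theorem SpectralGap.eq_of_invariant {E : Type*} [MetricSpace E]
    [SecondCountableTopology E] [MeasurableSpace E] [BorelSpace E]
    {P : ℝ≥0 → Kernel E E} (hP : IsTransitionSemigroup P) {μs : Measure E} {x₀ : E} {C γ : ℝ}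
    (hG : SpectralGap P μs x₀ C γ) {ν : Measure E} [IsProbabilityMeasure ν]
    (hν : ∀ t, Kernel.Invariant (P t) ν) : ν = μs := by
  have hM := hP.isMarkov
  have hp := hG.isP1.isProb
  set ν' : ProbabilityMeasure E := ⟨ν, inferInstance⟩
  set μ' : ProbabilityMeasure E := ⟨μs, hp⟩
  have key : Tendsto (fun _ : ℕ => ν') atTop (𝓝 μ') := by
    rw [tendsto_iff_forall_lipschitz_integral_tendsto]
    rintro f ⟨A, hA⟩ ⟨K, hf⟩
    have hb : ∀ x, |f x| ≤ |f x₀| + A := fun x => by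
      have h1 := hA x x₀
      rw [Real.dist_eq] at h1
      have := abs_add_le (f x - f x₀) (f x₀)
      rw [sub_add_cancel] at this
      linarith
    have hi : ∀ (ρ : Measure E) [IsFiniteMeasure ρ], Integrable f ρ := fun ρ _ =>
      (integrable_const (|f x₀| + A)).mono' hf.continuous.measurable.aestronglyMeasurable
        (ae_of_all _ hb)
    have e : ∀ n : ℕ, ∫ x, f x ∂ν = ∫ x, ∫ z, f z ∂(P n x) ∂ν := fun n => by
      rw [← Measure.integral_comp_kernel (hi _), show P n ∘ₘ ν = ν from hν n]
    have lim : Tendsto (fun n : ℕ => ∫ x, ∫ z, f z ∂(P n x) ∂ν) atTop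
        (𝓝 (∫ _, (∫ z, f z ∂μs) ∂ν)) := by
      refine tendsto_integral_of_dominated_convergence (fun _ => |f x₀| + A) (fun n => ?_)
        (integrable_const _) (fun n => ae_of_all _ fun x => ?_) (ae_of_all _ fun x => ?_)
      · exact (hf.continuous.measurable.stronglyMeasurable.integral_kernel
          (κ := P n)).aestronglyMeasurable
      · simpa using norm_integral_le_of_norm_le_const (f := f) (C := |f x₀| + A) (μ := P n x)
          (ae_of_all _ hb)
      · rw [tendsto_iff_norm_sub_tendsto_zero]
        refine squeeze_zero (fun _ => norm_nonneg _) (fun n => hG.ergodic n K f hf x) ?_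
        simpa using ((tendsto_exp_neg_mul_nat hG.rate_pos).const_mul (C * K)).mul_const
          (1 + dist x x₀)
    simp only [integral_const, probReal_univ, one_smul] at lim
    exact lim.congr fun n => (e n).symm
  have := tendsto_nhds_unique tendsto_const_nhds key
  exact congrArg (fun κ : ProbabilityMeasure E => (κ : Measure E)) this

/-! ### The Markov property for Lipschitz functions. -/

theorem LipschitzWith.abs_comp {E : Type*} [MetricSpace E] {K : ℝ≥0} {f : E → ℝ}
    (hf : LipschitzWith K f) : LipschitzWith K fun x => |f x| :=
  LipschitzWith.of_dist_le_mul fun x y =>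
    (abs_abs_sub_abs_le_abs_sub _ _).trans (hf.abs_sub_le_mul_dist x y)

theorem IsMarkovProcess.measurable_apply {E Ω : Type*} [MeasurableSpace E] [MeasurableSpace Ω]
    {P : ℝ≥0 → Kernel E E} {X : ℝ≥0 → Ω → E} {Pr : Measure Ω} (hX : IsMarkovProcess P X Pr)
    (t : ℝ≥0) : Measurable (X t) :=
  hX.measurable.comp measurable_prodMk_left

theorem IsMarkovProcess.pastSigma_le {E Ω : Type*} [MeasurableSpace E] [mΩ : MeasurableSpace Ω]
    {P : ℝ≥0 → Kernel E E} {X : ℝ≥0 → Ω → E} {Pr : Measure Ω} (hX : IsMarkovProcess P X Pr)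
    (t : ℝ≥0) : pastSigma X t ≤ mΩ :=
  iSup₂_le fun s _ => (hX.measurable_apply s).comap_le

theorem measurable_pastSigma {E Ω : Type*} [MeasurableSpace E] {X : ℝ≥0 → Ω → E} {s t : ℝ≥0}
    (hst : s ≤ t) : Measurable[pastSigma X t] (X s) :=
  (comap_measurable (X s)).mono (le_iSup₂ (f := fun s (_ : s ≤ t) =>
    MeasurableSpace.comap (X s) inferInstance) s hst) le_rfl

/-- The weight `Y` is only almost everywhere measurable with respect to the past, because time
integrals of the process will be known to be past-measurable only up to null sets. -/
theorem IsMarkovProcess.integral_mul_of_bounded {E Ω : Type*} [MeasurableSpace E]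
    [MeasurableSpace Ω] {P : ℝ≥0 → Kernel E E} {X : ℝ≥0 → Ω → E} {Pr : Measure Ω}
    [IsProbabilityMeasure Pr] (hX : IsMarkovProcess P X Pr) {s t : ℝ≥0} (hst : s ≤ t) {f : E → ℝ}
    (hf : Measurable f) {A : ℝ} (hA : ∀ x, |f x| ≤ A) {Y : Ω → ℝ}
    (hY : AEStronglyMeasurable[pastSigma X s] Y Pr) (hYi : Integrable Y Pr) :
    ∫ ω, f (X t ω) * Y ω ∂Pr = ∫ ω, (∫ z, f z ∂(P (t - s) (X s ω))) * Y ω ∂Pr := by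
  have hm := hX.pastSigma_le s
  have hfm : Measurable fun ω => f (X t ω) := hf.comp (hX.measurable_apply t)
  have hfi : Integrable (fun ω => f (X t ω)) Pr :=
    (integrable_const A).mono' hfm.aestronglyMeasurable (ae_of_all _ fun ω => hA _)
  have hfY : Integrable (fun ω => f (X t ω) * Y ω) Pr :=
    hYi.bdd_mul hfm.aestronglyMeasurable (ae_of_all _ fun ω => hA (X t ω))
  rw [← integral_condExp hm]
  refine integral_congr_ae ?_
  filter_upwards [condExp_mul_of_aestronglyMeasurable_right (m := pastSigma X s) hY hfY hfi,
    hX.markov s t hst f hf ⟨A, hA⟩] with ω h1 h2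
  rw [← h2]
  exact h1

theorem IsMarkovProcess.map_eq {E Ω : Type*} [MeasurableSpace E]
    [MeasurableSpace Ω] {P : ℝ≥0 → Kernel E E} {X : ℝ≥0 → Ω → E} {Pr : Measure Ω}
    [IsProbabilityMeasure Pr] (hX : IsMarkovProcess P X Pr) (hP : IsTransitionSemigroup P)
    (t : ℝ≥0) : Pr.map (X t) = P t ∘ₘ Pr.map (X 0) := by
  have hM := hP.isMarkov
  have h0 := Measure.isProbabilityMeasure_map (μ := Pr) (hX.measurable_apply 0).aemeasurable
  have ht := Measure.isProbabilityMeasure_map (μ := Pr) (hX.measurable_apply t).aemeasurable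
  ext A hA
  have h1 : Measurable (A.indicator fun _ => (1 : ℝ)) := measurable_const.indicator hA
  have hb : ∀ x, |A.indicator (fun _ => (1 : ℝ)) x| ≤ 1 := fun x => by
    by_cases hx : x ∈ A <;> simp [hx]
  have h2 := hX.integral_mul_of_bounded (zero_le : (0 : ℝ≥0) ≤ t) h1 hb (Y := fun _ => 1)
    (@stronglyMeasurable_const _ _ (pastSigma X 0) _ 1).aestronglyMeasurable (integrable_const 1)
  simp only [mul_one, tsub_zero] at h2
  have hi : Integrable (A.indicator fun _ => (1 : ℝ)) (P t ∘ₘ Pr.map (X 0)) :=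
    (integrable_const 1).indicator hA
  rw [← integral_map (hX.measurable_apply t).aemeasurable h1.aestronglyMeasurable,
    ← integral_map (f := fun x => ∫ z, A.indicator (fun _ => (1 : ℝ)) z ∂(P t x))
      (hX.measurable_apply 0).aemeasurable
      (h1.stronglyMeasurable.integral_kernel).aestronglyMeasurable,
    ← Measure.integral_comp_kernel hi, integral_indicator_const _ hA,
    integral_indicator_const _ hA, smul_eq_mul, smul_eq_mul, mul_one, mul_one] at h2
  rwa [measureReal_eq_measureReal_iff] at h2

theorem SpectralGap.abs_integral_le {E : Type*} [MetricSpace E] [MeasurableSpace E]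
    {P : ℝ≥0 → Kernel E E} {μs : Measure E} {x₀ : E} {C γ : ℝ} (hG : SpectralGap P μs x₀ C γ)
    (t : ℝ≥0) {K : ℝ≥0} {f : E → ℝ} (hf : LipschitzWith K f) (x : E) :
    |∫ z, f z ∂(P t x)| ≤ (|∫ z, f z ∂μs| + C * K) * (1 + dist x x₀) := by
  have h1 := hG.ergodic t K f hf x
  have h2 := hG.exp_le_one t
  have h3 : C * K * Real.exp (-γ * t) * (1 + dist x x₀) ≤ C * K * 1 * (1 + dist x x₀) := by
    have := hG.const_pos
    gcongr
  have h4 : 0 ≤ |∫ z, f z ∂μs| * dist x x₀ := by positivity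
  have h5 := abs_sub_abs_le_abs_sub (∫ z, f z ∂(P t x)) (∫ z, f z ∂μs)
  nlinarith

/-- The Markov property for Lipschitz functions, tested against a random variable of the past. -/
theorem IsMarkovProcess.integral_mul {E Ω : Type*} [MetricSpace E]
    [SecondCountableTopology E] [MeasurableSpace E] [BorelSpace E]
    [MeasurableSpace Ω] {P : ℝ≥0 → Kernel E E} {X : ℝ≥0 → Ω → E} {Pr : Measure Ω}
    [IsProbabilityMeasure Pr] (hX : IsMarkovProcess P X Pr) (hP : IsTransitionSemigroup P)
    {μs : Measure E} {x₀ : E} {C γ : ℝ}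
    (hG : SpectralGap P μs x₀ C γ) {s t : ℝ≥0} (hst : s ≤ t) {K : ℝ≥0} {f : E → ℝ}
    (hf : LipschitzWith K f) {Y : Ω → ℝ} (hY : AEStronglyMeasurable[pastSigma X s] Y Pr)
    (h1 : Integrable (fun ω => f (X t ω) * Y ω) Pr)
    (h2 : Integrable (fun ω => (1 + dist (X s ω) x₀) * Y ω) Pr) :
    ∫ ω, f (X t ω) * Y ω ∂Pr = ∫ ω, (∫ z, f z ∂(P (t - s) (X s ω))) * Y ω ∂Pr := by
  have hM := hP.isMarkov
  have hYm : AEStronglyMeasurable Y Pr := hY.mono (hX.pastSigma_le s)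
  have hYi : Integrable Y Pr := h2.mono hYm (ae_of_all _ fun ω => by
    rw [norm_mul, Real.norm_of_nonneg (by positivity : 0 ≤ 1 + dist (X s ω) x₀)]
    exact le_mul_of_one_le_left (norm_nonneg _) (by linarith [dist_nonneg (x := X s ω) (y := x₀)]))
  have hm : ∀ n : ℕ, Measurable fun z => clip n (f z) := fun n =>
    (hf.clip_comp n).continuous.measurable
  have habs : LipschitzWith K fun z => |f z| := hf.abs_comp
  have hn : ∀ n : ℕ, ∫ ω, clip n (f (X t ω)) * Y ω ∂Pr =
      ∫ ω, (∫ z, clip n (f z) ∂(P (t - s) (X s ω))) * Y ω ∂Pr := fun n =>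
    hX.integral_mul_of_bounded hst (hm n) (fun x => abs_clip_le (Nat.cast_nonneg n) _) hY hYi
  -- Both sides of the bounded identity `hn` pass to the limit in the clipping level, `h1` and `h2`
  -- providing the dominating functions.
  refine tendsto_nhds_unique (f := fun n : ℕ => ∫ ω, clip n (f (X t ω)) * Y ω ∂Pr) (l := atTop)
    ?_ ?_
  · refine tendsto_integral_of_dominated_convergence (fun ω => |f (X t ω) * Y ω|) (fun n =>
      ((hm n).comp (hX.measurable_apply t)).aestronglyMeasurable.mul hYm) h1.abs
      (fun n => ae_of_all _ fun ω => ?_) (ae_of_all _ fun ω => (tendsto_clip _).mul_const _)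
    rw [Real.norm_eq_abs, abs_mul, abs_mul]
    exact mul_le_mul_of_nonneg_right (abs_clip_le_abs (Nat.cast_nonneg n) _) (abs_nonneg _)
  · simp_rw [hn]
    refine tendsto_integral_of_dominated_convergence
      (fun ω => (|∫ z, |f z| ∂μs| + C * K) * |(1 + dist (X s ω) x₀) * Y ω|) (fun n =>
      (((hm n).stronglyMeasurable.integral_kernel (κ := P (t - s))).measurable.comp
        (hX.measurable_apply s)).aestronglyMeasurable.mul hYm) (h2.abs.const_mul _)
      (fun n => ae_of_all _ fun ω => ?_) (ae_of_all _ fun ω => ?_)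
    · rw [Real.norm_eq_abs, abs_mul, abs_mul, ← mul_assoc]
      refine mul_le_mul_of_nonneg_right ?_ (abs_nonneg _)
      rw [abs_of_nonneg (by positivity : 0 ≤ 1 + dist (X s ω) x₀)]
      refine le_trans ?_ ((le_abs_self _).trans (hG.abs_integral_le (t - s) habs (X s ω)))
      refine abs_integral_le_integral_abs.trans (integral_mono
        (hG.integrable _ _ _ _ (hf.clip_comp n)).abs (hG.integrable _ _ _ _ habs) fun z => ?_)
      exact abs_clip_le_abs (Nat.cast_nonneg n) _
    · refine Tendsto.mul_const _ ?_
      exact tendsto_integral_of_dominated_convergence (fun z => |f z|)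
        (fun n => (hm n).aestronglyMeasurable) (hG.integrable _ _ _ _ habs)
        (fun n => ae_of_all _ fun z => abs_clip_le_abs (Nat.cast_nonneg n) _)
        (ae_of_all _ fun z => tendsto_clip _)

/-- Exponential convergence of the expectations of Lipschitz functions. -/
theorem IsMarkovProcess.abs_integral_sub_le {E Ω : Type*} [MetricSpace E]
    [SecondCountableTopology E] [MeasurableSpace E] [BorelSpace E]
    [MeasurableSpace Ω] {P : ℝ≥0 → Kernel E E} {X : ℝ≥0 → Ω → E} {Pr : Measure Ω}
    [IsProbabilityMeasure Pr] (hX : IsMarkovProcess P X Pr) (hP : IsTransitionSemigroup P)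
    {μs : Measure E} {x₀ : E} {C γ : ℝ} (hG : SpectralGap P μs x₀ C γ)
    (hi : Integrable (fun ω => dist (X 0 ω) x₀) Pr) (t : ℝ≥0) {K : ℝ≥0} {f : E → ℝ}
    (hf : LipschitzWith K f) :
    Integrable (fun ω => f (X t ω)) Pr ∧
    |(∫ ω, f (X t ω) ∂Pr) - ∫ z, f z ∂μs| ≤
      C * K * Real.exp (-γ * t) * ∫ ω, (1 + dist (X 0 ω) x₀) ∂Pr := by
  have hM := hP.isMarkov
  have h0 := Measure.isProbabilityMeasure_map (μ := Pr) (hX.measurable_apply 0).aemeasurable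
  have hV : Integrable (fun ω => 1 + dist (X 0 ω) x₀) Pr := (integrable_const 1).add hi
  have key : ∀ {K : ℝ≥0} {g : E → ℝ}, LipschitzWith K g →
      Integrable (fun ω => ∫ z, g z ∂(P t (X 0 ω))) Pr := fun {K g} hg =>
    (hV.const_mul (|∫ z, g z ∂μs| + C * K)).mono'
      ((hg.continuous.measurable.stronglyMeasurable.integral_kernel
        (κ := P t)).measurable.comp (hX.measurable_apply 0)).aestronglyMeasurable
      (ae_of_all _ fun ω => hG.abs_integral_le t hg _)
  have hfi : Integrable f (Pr.map (X t)) := by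
    rw [hX.map_eq hP, Measure.comp_eq_comp_const_apply,
      ProbabilityTheory.integrable_comp_iff hf.continuous.measurable.aestronglyMeasurable]
    refine ⟨ae_of_all _ fun x => hG.integrable t x K f hf, ?_⟩
    have habs : LipschitzWith K fun z => ‖f z‖ := hf.abs_comp
    rw [Kernel.const_apply, integrable_map_measure
      (habs.continuous.measurable.stronglyMeasurable.integral_kernel
        (κ := P t)).aestronglyMeasurable (hX.measurable_apply 0).aemeasurable]
    exact key habs
  have hfX : Integrable (fun ω => f (X t ω)) Pr := hfi.comp_measurable (hX.measurable_apply t)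
  refine ⟨hfX, ?_⟩
  have e := hX.integral_mul hP hG (zero_le : (0 : ℝ≥0) ≤ t) hf (Y := fun _ => 1)
    (@stronglyMeasurable_const _ _ (pastSigma X 0) _ 1).aestronglyMeasurable
    (by simpa using hfX) (by simpa using hV)
  simp only [mul_one, tsub_zero] at e
  have e2 : (∫ ω, f (X t ω) ∂Pr) - ∫ z, f z ∂μs =
      ∫ ω, ((∫ z, f z ∂(P t (X 0 ω))) - ∫ z, f z ∂μs) ∂Pr := by
    rw [integral_sub (key hf) (integrable_const _), e]; simp
  rw [e2, ← integral_const_mul]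
  exact abs_integral_le_integral_abs.trans (integral_mono
    ((key hf).sub (integrable_const _)).abs (hV.const_mul _) fun ω => hG.ergodic t K f hf _)

/-! ### Taylor expansion along additive functionals. -/

/-- Chain rule for the primitive of an integrable function. -/
theorem comp_integral_sub_eq_integral {y : ℝ → ℝ} {T : ℝ}
    (hy : IntervalIntegrable y volume 0 T) {g g' : ℝ → ℝ} (hg : ∀ x, HasDerivAt g (g' x) x)
    (hg' : Continuous g') :
    g (∫ s in (0 : ℝ)..T, y s) - g 0 =
      ∫ u in (0 : ℝ)..T, g' (∫ s in (0 : ℝ)..u, y s) * y u := by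
  have hac := hy.absolutelyContinuousOnInterval_intervalIntegral (Set.left_mem_uIcc)
  obtain ⟨A, hA⟩ := hac.exists_bound
  have hC1 : ContDiff ℝ 1 g := by
    rw [contDiff_one_iff_deriv]
    refine ⟨fun x => (hg x).differentiableAt, ?_⟩
    have : deriv g = g' := funext fun x => (hg x).deriv
    rwa [this]
  obtain ⟨L, hL⟩ := hC1.contDiffOn.exists_lipschitzOnWith (by decide)
    (convex_Icc (-A) A) isCompact_Icc
  -- The primitive of `y` is differentiable only almost everywhere, so the fundamental theorem is
  -- used in its absolutely continuous form; `g` is Lipschitz on the bounded range of the primitive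
  -- and preserves absolute continuity.
  have hac2 : AbsolutelyContinuousOnInterval (fun u => g (∫ s in (0 : ℝ)..u, y s)) 0 T := by
    rw [absolutelyContinuousOnInterval_iff] at hac ⊢
    intro ε hε
    obtain ⟨δ, hδ, h⟩ := hac (ε / (L + 1)) (by positivity)
    refine ⟨δ, hδ, fun I hI hIδ => ?_⟩
    have h1 := h I hI hIδ
    rw [lt_div_iff₀ (by positivity)] at h1
    refine lt_of_le_of_lt ?_ h1
    rw [Finset.sum_mul]
    refine Finset.sum_le_sum fun i hi => ?_
    have hmem := hI.1 i hi
    have h2 := hL.dist_le_mul _ (abs_le.1 (hA _ hmem.1)) _ (abs_le.1 (hA _ hmem.2))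
    refine h2.trans ?_
    nlinarith [dist_nonneg (x := ∫ s in (0 : ℝ)..(I.2 i).1, y s)
      (y := ∫ s in (0 : ℝ)..(I.2 i).2, y s)]
  have h1 := hac2.integral_deriv_eq_sub
  simp only [intervalIntegral.integral_same] at h1
  rw [← h1]
  refine intervalIntegral.integral_congr_ae ?_
  filter_upwards [hy.ae_hasDerivAt_integral] with u hu hmem
  have h2 := hu (Set.uIoc_subset_uIcc hmem) 0 Set.left_mem_uIcc
  exact ((hg _).comp u h2).deriv

/-- Second order Taylor expansion along the primitive of an integrable function. -/
theorem comp_integral_eq_taylor {y : ℝ → ℝ} {T : ℝ}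
    (hy : IntervalIntegrable y volume 0 T) {h h' h'' : ℝ → ℝ}
    (hh : ∀ x, HasDerivAt h (h' x) x) (hh' : ∀ x, HasDerivAt h' (h'' x) x)
    (hc : Continuous h'') :
    h (∫ s in (0 : ℝ)..T, y s) = h 0 + h' 0 * (∫ s in (0 : ℝ)..T, y s) +
      ∫ u in (0 : ℝ)..T, (∫ s in u..T, y s) * y u * h'' (∫ s in (0 : ℝ)..u, y s) := by
  set c := ∫ s in (0 : ℝ)..T, y s with hcdef
  -- The derivative of this function telescopes to `h'' x * (c - x)`. At `x = c` it equals `h c`, at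
  -- `x = 0` it is the first order expansion, and `c` minus the primitive at `u` is `∫_u^T y`.
  have h1 := comp_integral_sub_eq_integral hy (g := fun x => h x + h' x * (c - x))
    (g' := fun x => h'' x * (c - x)) (fun x => by
      have := (hh x).add ((hh' x).mul ((hasDerivAt_id x).const_sub c))
      convert! this using 1
      simp) (by fun_prop)
  simp only [← hcdef, sub_self, mul_zero, add_zero, sub_zero] at h1
  have h2 : ∫ u in (0 : ℝ)..T, (∫ s in u..T, y s) * y u * h'' (∫ s in (0 : ℝ)..u, y s) =
      ∫ u in (0 : ℝ)..T, h'' (∫ s in (0 : ℝ)..u, y s) * (c - ∫ s in (0 : ℝ)..u, y s) * y u := by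
    refine intervalIntegral.integral_congr fun u hu => ?_
    have h3 : (∫ s in u..T, y s) = c - ∫ s in (0 : ℝ)..u, y s := by
      rw [hcdef, ← intervalIntegral.integral_add_adjacent_intervals
        (hy.mono_set (Set.uIcc_subset_uIcc_left hu)) (hy.mono_set (Set.uIcc_subset_uIcc_right hu))]
      ring
    simp only [h3]; ring
  rw [h2, ← h1]; ring

/-- Variable endpoints are moved into the indicator of a measurable set, after which this is
measurability of a parametric integral. -/
theorem measurable_uncurry_intervalIntegral {Ω : Type*} [MeasurableSpace Ω] {Y : ℝ → Ω → ℝ}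
    (hY : Measurable (Function.uncurry Y)) :
    Measurable fun p : (ℝ × ℝ) × Ω => ∫ s in p.1.1..p.1.2, Y s p.2 := by
  have key : ∀ g h : (ℝ × ℝ) × Ω → ℝ, Measurable g → Measurable h →
      Measurable fun p : (ℝ × ℝ) × Ω => ∫ s in Set.Ioc (g p) (h p), Y s p.2 := by
    intro g h hg hh
    have e : (fun p : (ℝ × ℝ) × Ω => ∫ s in Set.Ioc (g p) (h p), Y s p.2) =
        fun p => ∫ s, {q : ((ℝ × ℝ) × Ω) × ℝ | g q.1 < q.2 ∧ q.2 ≤ h q.1}.indicator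
          (fun q => Y q.2 q.1.2) (p, s) := by
      ext p
      rw [← integral_indicator measurableSet_Ioc]
      rfl
    rw [e]
    refine (StronglyMeasurable.integral_prod_right' (ν := volume) (f := fun q =>
      {q : ((ℝ × ℝ) × Ω) × ℝ | g q.1 < q.2 ∧ q.2 ≤ h q.1}.indicator
          (fun q => Y q.2 q.1.2) q) ?_).measurable
    refine (Measurable.indicator ?_ ?_).stronglyMeasurable
    · exact hY.comp (measurable_snd.prodMk (measurable_snd.comp measurable_fst))
    · exact (measurableSet_lt (hg.comp measurable_fst) measurable_snd).inter
        (measurableSet_le measurable_snd (hh.comp measurable_fst))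
  simp only [intervalIntegral]
  exact (key _ _ measurable_fst.fst measurable_fst.snd).sub
    (key _ _ measurable_fst.snd measurable_fst.fst)

theorem measurable_intervalIntegral {Ω : Type*} [MeasurableSpace Ω] {Y : ℝ → Ω → ℝ}
    (hY : Measurable (Function.uncurry Y)) (a b : ℝ) :
    Measurable fun ω : Ω => ∫ s in a..b, Y s ω :=
  (measurable_uncurry_intervalIntegral hY).comp (measurable_prodMk_left (x := (a, b)))

theorem integrable_prod_of_integral_abs_le {Ω : Type*} [MeasurableSpace Ω] {Pr : Measure Ω}
    [IsFiniteMeasure Pr] {F : ℝ → Ω → ℝ} (hF : Measurable (Function.uncurry F)) {a b B : ℝ}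
    (h : ∀ s ∈ Set.uIoc a b, Integrable (F s) Pr ∧ ∫ ω, |F s ω| ∂Pr ≤ B) :
    Integrable (Function.uncurry F) ((volume.restrict (Set.uIoc a b)).prod Pr) := by
  rw [integrable_prod_iff hF.aestronglyMeasurable]
  have hmem := ae_restrict_mem (μ := volume) (measurableSet_uIoc (a := a) (b := b))
  refine ⟨hmem.mono fun s hs => (h s hs).1, ?_⟩
  have hfin : IsFiniteMeasure (volume.restrict (Set.uIoc a b)) := by
    rw [Set.uIoc]; infer_instance
  refine (integrable_const B).mono'
    (hF.stronglyMeasurable.norm.integral_prod_right').aestronglyMeasurable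
    (hmem.mono fun s hs => ?_)
  rw [Real.norm_of_nonneg (integral_nonneg fun _ => norm_nonneg _)]
  exact (h s hs).2

/-- Integer horizons suffice, so a single null set serves all `T`. -/
theorem ae_forall_intervalIntegrable {Ω : Type*} [MeasurableSpace Ω] {Pr : Measure Ω}
    [IsFiniteMeasure Pr] {F : ℝ → Ω → ℝ}
    (h : ∀ T : ℝ, 0 ≤ T →
      Integrable (Function.uncurry F) ((volume.restrict (Set.uIoc 0 T)).prod Pr)) :
    ∀ᵐ ω ∂Pr, ∀ T : ℝ, 0 ≤ T → IntervalIntegrable (fun s => F s ω) volume 0 T := by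
  have h1 : ∀ᵐ ω ∂Pr, ∀ n : ℕ, IntervalIntegrable (fun s => F s ω) volume 0 n := by
    rw [ae_all_iff]
    intro n
    filter_upwards [(h n (Nat.cast_nonneg n)).prod_left_ae] with ω hω
    rw [intervalIntegrable_iff]
    exact hω
  filter_upwards [h1] with ω hω T hT
  refine (hω ⌈T⌉₊).mono_set (Set.uIcc_subset_uIcc_left ?_)
  rw [Set.uIcc_of_le (Nat.cast_nonneg _)]
  exact ⟨hT, Nat.le_ceil T⟩

/-- Cauchy–Schwarz, read off from the nonnegative integral of `(y - c / T) ^ 2`, where `c / T` is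
the mean of `y`. -/
theorem sq_intervalIntegral_le {y : ℝ → ℝ} {T : ℝ} (hT : 0 ≤ T)
    (hy : IntervalIntegrable y volume 0 T)
    (hy2 : IntervalIntegrable (fun s => y s ^ 2) volume 0 T) :
    (∫ s in (0 : ℝ)..T, y s) ^ 2 ≤ T * ∫ s in (0 : ℝ)..T, y s ^ 2 := by
  rcases hT.eq_or_lt with rfl | hT'
  · simp
  set c := ∫ s in (0 : ℝ)..T, y s with hc
  have h1 : 0 ≤ ∫ s in (0 : ℝ)..T, (y s - c / T) ^ 2 :=
    intervalIntegral.integral_nonneg hT fun s _ => sq_nonneg _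
  have h2 : ∫ s in (0 : ℝ)..T, (y s - c / T) ^ 2 =
      (∫ s in (0 : ℝ)..T, y s ^ 2) - 2 * (c / T) * c + T * (c / T) ^ 2 := by
    have e : ∀ s, (y s - c / T) ^ 2 = y s ^ 2 - 2 * (c / T) * y s + (c / T) ^ 2 := fun s => by ring
    simp_rw [e]
    rw [intervalIntegral.integral_add (hy2.sub (hy.const_mul _)) intervalIntegrable_const,
      intervalIntegral.integral_sub hy2 (hy.const_mul _), intervalIntegral.integral_const_mul,
      intervalIntegral.integral_const, ← hc]
    simp
  rw [h2] at h1
  have h3 : 2 * (c / T) * c - T * (c / T) ^ 2 = c ^ 2 / T := by field_simp; ring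
  have h4 : c ^ 2 / T ≤ ∫ s in (0 : ℝ)..T, y s ^ 2 := by linarith
  rwa [div_le_iff₀ hT', mul_comm] at h4

/-- A jointly measurable real process with second moments bounded by `B`. -/
structure IsSquareBounded {Ω : Type*} [MeasurableSpace Ω] (Y : ℝ → Ω → ℝ) (Pr : Measure Ω)
    (B : ℝ) : Prop where
  measurable : Measurable (Function.uncurry Y)
  integrable_sq : ∀ s, Integrable (fun ω => Y s ω ^ 2) Pr
  integral_sq_le : ∀ s, ∫ ω, Y s ω ^ 2 ∂Pr ≤ B

namespace IsSquareBounded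

variable {Ω : Type*} [MeasurableSpace Ω] {Y : ℝ → Ω → ℝ} {Pr : Measure Ω} {B : ℝ}

theorem measurable_apply (hY : IsSquareBounded Y Pr B) (s : ℝ) : Measurable (Y s) :=
  hY.measurable.comp measurable_prodMk_left

theorem memLp (hY : IsSquareBounded Y Pr B) (s : ℝ) : MemLp (Y s) 2 Pr :=
  (memLp_two_iff_integrable_sq (hY.measurable_apply s).aestronglyMeasurable).2 (hY.integrable_sq s)

theorem integrable [IsProbabilityMeasure Pr] (hY : IsSquareBounded Y Pr B) (s : ℝ) :
    Integrable (Y s) Pr := (hY.memLp s).integrable (by norm_num)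

theorem integrable_sq_prod [IsProbabilityMeasure Pr] (hY : IsSquareBounded Y Pr B) (a b : ℝ) :
    Integrable (Function.uncurry fun s ω => Y s ω ^ 2)
      ((volume.restrict (Set.uIoc a b)).prod Pr) := by
  refine integrable_prod_of_integral_abs_le (B := B) (hY.measurable.pow_const 2)
    fun s _ => ⟨hY.integrable_sq s, ?_⟩
  simpa using hY.integral_sq_le s

theorem integrable_prod [IsProbabilityMeasure Pr] (hY : IsSquareBounded Y Pr B) (a b : ℝ) :
    Integrable (Function.uncurry Y) ((volume.restrict (Set.uIoc a b)).prod Pr) := by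
  have hfin : IsFiniteMeasure (volume.restrict (Set.uIoc a b)) := by
    rw [Set.uIoc]; infer_instance
  refine ((integrable_const (1 : ℝ)).add (hY.integrable_sq_prod a b)).mono'
    hY.measurable.aestronglyMeasurable (ae_of_all _ fun p => ?_)
  simp only [Function.uncurry, Real.norm_eq_abs, Pi.add_apply]
  nlinarith [sq_abs (Y p.1 p.2), sq_nonneg (|Y p.1 p.2| - 1)]

theorem ae_intervalIntegrable [IsProbabilityMeasure Pr] (hY : IsSquareBounded Y Pr B) :
    ∀ᵐ ω ∂Pr, ∀ T : ℝ, 0 ≤ T → IntervalIntegrable (fun s => Y s ω) volume 0 T ∧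
      IntervalIntegrable (fun s => Y s ω ^ 2) volume 0 T := by
  filter_upwards [ae_forall_intervalIntegrable fun T _ => hY.integrable_prod 0 T,
    ae_forall_intervalIntegrable fun T _ => hY.integrable_sq_prod 0 T] with ω h1 h2 T hT
  exact ⟨h1 T hT, h2 T hT⟩

theorem abs (hY : IsSquareBounded Y Pr B) : IsSquareBounded (fun s ω => |Y s ω|) Pr B where
  measurable := hY.measurable.abs
  integrable_sq s := by simpa using hY.integrable_sq s
  integral_sq_le s := by simpa using hY.integral_sq_le s

theorem integrable_sq_integral [IsProbabilityMeasure Pr] (hY : IsSquareBounded Y Pr B) {T : ℝ}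
    (hT : 0 ≤ T) : Integrable (fun ω => (∫ s in (0 : ℝ)..T, Y s ω) ^ 2) Pr := by
  have h1 : Integrable (fun ω => T * ∫ s in (0 : ℝ)..T, Y s ω ^ 2) Pr := by
    have := (hY.integrable_sq_prod 0 T).integral_prod_right
    rw [Set.uIoc_of_le hT] at this
    simp only [intervalIntegral.integral_of_le hT]
    exact this.const_mul T
  refine h1.mono' ((measurable_intervalIntegral hY.measurable 0 T).pow_const 2).aestronglyMeasurable
    ?_
  filter_upwards [hY.ae_intervalIntegrable] with ω hω
  rw [Real.norm_of_nonneg (sq_nonneg _)]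
  exact sq_intervalIntegral_le hT (hω T hT).1 (hω T hT).2

theorem memLp_integral [IsProbabilityMeasure Pr] (hY : IsSquareBounded Y Pr B) {T : ℝ}
    (hT : 0 ≤ T) : MemLp (fun ω => ∫ s in (0 : ℝ)..T, Y s ω) 2 Pr :=
  (memLp_two_iff_integrable_sq
    (measurable_intervalIntegral hY.measurable 0 T).aestronglyMeasurable).2
    (hY.integrable_sq_integral hT)

theorem integral_integral_mul [IsProbabilityMeasure Pr] (hY : IsSquareBounded Y Pr B) {Z : Ω → ℝ}
    (hZ : AEStronglyMeasurable Z Pr) (hZ2 : Integrable (fun ω => Z ω ^ 2) Pr) (a b : ℝ) :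
    ∫ ω, (∫ s in a..b, Y s ω) * Z ω ∂Pr = ∫ s in a..b, ∫ ω, Y s ω * Z ω ∂Pr := by
  have hfin : IsFiniteMeasure (volume.restrict (Set.uIoc a b)) := by
    rw [Set.uIoc]; infer_instance
  rw [intervalIntegral_integral_swap]
  · simp_rw [intervalIntegral.integral_mul_const]
  · refine ((hY.integrable_sq_prod a b).add (hZ2.comp_snd (volume.restrict (Set.uIoc a b)))).mono'
      (hY.measurable.aestronglyMeasurable.mul hZ.comp_snd) (ae_of_all _ fun p => ?_)
    simp only [Function.uncurry, Real.norm_eq_abs, Pi.add_apply, abs_mul]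
    nlinarith [sq_abs (Y p.1 p.2), sq_abs (Z p.2), sq_nonneg (|Y p.1 p.2| - |Z p.2|),
      sq_nonneg (Y p.1 p.2), sq_nonneg (Z p.2)]

/-- Licence for Fubini on the Taylor remainder: the integrand is dominated by `M ((∫₀ᵀ |Y|)² +
Y_u²)`. -/
theorem integrable_prod_remainder [IsProbabilityMeasure Pr] (hY : IsSquareBounded Y Pr B)
    {w : ℝ → Ω → ℝ} (hw : Measurable (Function.uncurry w)) {M : ℝ} (hM : ∀ s ω, |w s ω| ≤ M)
    {T : ℝ} (hT : 0 ≤ T) :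
    Integrable (Function.uncurry fun u ω => (∫ s in u..T, Y s ω) * Y u ω * w u ω)
      ((volume.restrict (Set.uIoc 0 T)).prod Pr) := by
  have hfin : IsFiniteMeasure (volume.restrict (Set.uIoc 0 T)) := by
    rw [Set.uIoc]; infer_instance
  have hA := (hY.abs.integrable_sq_integral hT).comp_snd (volume.restrict (Set.uIoc 0 T))
  refine ((hA.add (hY.integrable_sq_prod 0 T)).const_mul M).mono' ?_ ?_
  · have h1 : Measurable fun p : ℝ × Ω => ∫ s in p.1..T, Y s p.2 :=
      (measurable_uncurry_intervalIntegral hY.measurable).comp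
        ((measurable_fst.prodMk measurable_const).prodMk measurable_snd)
    exact ((h1.mul hY.measurable).mul hw).aestronglyMeasurable
  · have h1 := (Measure.quasiMeasurePreserving_snd (μ := volume.restrict (Set.uIoc 0 T))
      (ν := Pr)).ae hY.abs.ae_intervalIntegrable
    have h2 := (Measure.quasiMeasurePreserving_fst (μ := volume.restrict (Set.uIoc 0 T))
      (ν := Pr)).ae (ae_restrict_mem (μ := volume) (measurableSet_uIoc (a := 0) (b := T)))
    filter_upwards [h1, h2] with p hp hu
    rw [Set.uIoc_of_le hT] at hu
    have h3 : |∫ s in p.1..T, Y s p.2| ≤ ∫ s in (0 : ℝ)..T, |Y s p.2| := by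
      refine (intervalIntegral.abs_integral_le_integral_abs hu.2).trans ?_
      rw [intervalIntegral.integral_of_le hu.2, intervalIntegral.integral_of_le hT]
      refine setIntegral_mono_set ?_ (ae_of_all _ fun _ => abs_nonneg _)
        (Set.Ioc_subset_Ioc_left hu.1.le).eventuallyLE
      exact (intervalIntegrable_iff_integrableOn_Ioc_of_le hT).1 (hp T hT).1
    simp only [Function.uncurry, Real.norm_eq_abs, Pi.add_apply, abs_mul]
    set A := ∫ s in (0 : ℝ)..T, |Y s p.2|
    have hA0 : 0 ≤ A := (abs_nonneg _).trans h3
    have h4 : |∫ s in p.1..T, Y s p.2| * |Y p.1 p.2| ≤ A ^ 2 + Y p.1 p.2 ^ 2 := by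
      have := mul_le_mul_of_nonneg_right h3 (abs_nonneg (Y p.1 p.2))
      nlinarith [sq_abs (Y p.1 p.2), sq_nonneg (A - |Y p.1 p.2|), sq_nonneg A,
        sq_nonneg (Y p.1 p.2)]
    rw [mul_comm M]
    exact mul_le_mul h4 (hM _ _) (abs_nonneg _) (by positivity)

/-- Second order Taylor expansion of `𝔼 h(∫₀ᵀ Y)`. -/
theorem integral_comp_eq_taylor [IsProbabilityMeasure Pr] (hY : IsSquareBounded Y Pr B) {T : ℝ}
    (hT : 0 ≤ T) {h h' h'' : ℝ → ℝ} (hh : ∀ x, HasDerivAt h (h' x) x)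
    (hh' : ∀ x, HasDerivAt h' (h'' x) x) (hc : Continuous h'') {M : ℝ} (hM : ∀ x, |h'' x| ≤ M) :
    ∫ ω, h (∫ s in (0 : ℝ)..T, Y s ω) ∂Pr = h 0 + h' 0 * ∫ ω, (∫ s in (0 : ℝ)..T, Y s ω) ∂Pr +
      ∫ u in (0 : ℝ)..T, ∫ ω, (∫ s in u..T, Y s ω) * Y u ω *
        h'' (∫ s in (0 : ℝ)..u, Y s ω) ∂Pr := by
  have hwm : Measurable (Function.uncurry fun u ω => h'' (∫ s in (0 : ℝ)..u, Y s ω)) :=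
    hc.measurable.comp ((measurable_uncurry_intervalIntegral hY.measurable).comp
        ((measurable_const.prodMk measurable_fst).prodMk measurable_snd))
  have hint := hY.integrable_prod_remainder hwm (fun s ω => hM _) hT
  have h1 : Integrable (fun ω => ∫ u in (0 : ℝ)..T, (∫ s in u..T, Y s ω) * Y u ω *
        h'' (∫ s in (0 : ℝ)..u, Y s ω)) Pr := by
    have := hint.integral_prod_right
    rw [Set.uIoc_of_le hT] at this
    simp only [intervalIntegral.integral_of_le hT]
    exact this
  have h2 : Integrable (fun ω => ∫ s in (0 : ℝ)..T, Y s ω) Pr :=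
    (hY.memLp_integral hT).integrable (by norm_num)
  rw [intervalIntegral_integral_swap hint, ← integral_const_mul]
  have h3 : ∫ _, h 0 ∂Pr = h 0 := by simp
  have h5 : Integrable (fun ω => h 0 + h' 0 * ∫ s in (0 : ℝ)..T, Y s ω) Pr :=
    (integrable_const _).add (h2.const_mul _)
  rw [← h3, ← integral_add (integrable_const _) (h2.const_mul _), ← integral_add h5 h1]
  refine integral_congr_ae ?_
  filter_upwards [hY.ae_intervalIntegrable] with ω hω
  exact comp_integral_eq_taylor (hω T hT).1 hh hh' hc

/-- The time integral of a process is measurable, up to null sets, for any `σ`-algebra for which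
the process is. No joint measurability with respect to this `σ`-algebra is needed. -/
theorem aestronglyMeasurable_integral {Ω : Type*} {m mΩ : MeasurableSpace Ω} {Y : ℝ → Ω → ℝ}
    {Pr : Measure Ω} {B : ℝ} [IsProbabilityMeasure Pr] (hY : IsSquareBounded Y Pr B) (hm : m ≤ mΩ) {T : ℝ}
    (hT : 0 ≤ T) (hYm : ∀ s ∈ Set.Icc 0 T, StronglyMeasurable[m] (Y s)) :
    AEStronglyMeasurable[m] (fun ω => ∫ s in (0 : ℝ)..T, Y s ω) Pr := by
  set S : Ω → ℝ := fun ω => ∫ s in (0 : ℝ)..T, Y s ω with hS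
  have hS2 : MemLp S 2 Pr := hY.memLp_integral hT
  have hSi : Integrable S Pr := hS2.integrable (by norm_num)
  have hE2 : MemLp (Pr[S | m]) 2 Pr := hS2.condExp (by norm_num)
  -- `Z` is orthogonal to every square integrable `m`-measurable variable: to each `Y s`, hence by
  -- Fubini to `S`, and also to `Pr[S | m]`. So `𝔼 Z² = 0` and `S` agrees almost surely with its
  -- conditional expectation.
  set Z : Ω → ℝ := S - Pr[S | m] with hZ
  have hZ2 : MemLp Z 2 Pr := hS2.sub hE2
  have hZi : Integrable Z Pr := hZ2.integrable (by norm_num)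
  have hZ0 : Pr[Z | m] =ᵐ[Pr] 0 := by
    filter_upwards [condExp_sub hSi (hE2.integrable (by norm_num)) m,
      condExp_condExp_of_le (μ := Pr) (f := S) le_rfl hm] with ω h1 h2
    rw [h1, Pi.sub_apply, h2, sub_self]; rfl
  have orth : ∀ U : Ω → ℝ, StronglyMeasurable[m] U → MemLp U 2 Pr → ∫ ω, U ω * Z ω ∂Pr = 0 := by
    intro U hU hU2
    rw [← integral_condExp hm]
    refine integral_eq_zero_of_ae ?_
    filter_upwards [condExp_mul_of_stronglyMeasurable_left hU (hU2.integrable_mul hZ2) hZi, hZ0]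
      with ω h1 h2
    refine h1.trans ?_
    simp [h2]
  have h1 : ∫ ω, S ω * Z ω ∂Pr = 0 := by
    rw [hY.integral_integral_mul hZ2.1 ((memLp_two_iff_integrable_sq hZ2.1).1 hZ2)]
    refine (intervalIntegral.integral_congr fun s hs => ?_).trans intervalIntegral.integral_zero
    rw [Set.uIcc_of_le hT] at hs
    exact orth _ (hYm s hs) (hY.memLp s)
  have h2 : ∫ ω, (Pr[S | m]) ω * Z ω ∂Pr = 0 := orth _ stronglyMeasurable_condExp hE2
  have h3 : ∫ ω, Z ω ^ 2 ∂Pr = 0 := by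
    have e : (fun ω => Z ω ^ 2) = fun ω => S ω * Z ω - (Pr[S | m]) ω * Z ω := by
      ext ω; simp only [hZ, Pi.sub_apply]; ring
    have i1 : Integrable (fun ω => S ω * Z ω) Pr := hS2.integrable_mul hZ2
    have i2 : Integrable (fun ω => (Pr[S | m]) ω * Z ω) Pr := hE2.integrable_mul hZ2
    rw [e, integral_sub i1 i2, h1, h2, sub_zero]
  refine ⟨Pr[S | m], stronglyMeasurable_condExp, ?_⟩
  filter_upwards [(integral_eq_zero_iff_of_nonneg (fun ω => sq_nonneg (Z ω))
    ((memLp_two_iff_integrable_sq hZ2.1).1 hZ2)).1 h3] with ω hω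
  have : Z ω = 0 := by simpa using hω
  simp only [hZ, Pi.sub_apply] at this
  linarith

end IsSquareBounded

/-! ### Potentials of centered Lipschitz functions. -/

/-- The potential `∫₀ᵇ Pʳ f dr` up to time `b`. -/
noncomputable def truncatedPotential {E : Type*} [MeasurableSpace E] (P : ℝ≥0 → Kernel E E)
    (f : E → ℝ) (b : ℝ) (x : E) : ℝ :=
  ∫ r in (0 : ℝ)..b, ∫ z, f z ∂(P r.toNNReal x)

/-- The potential `∫₀^∞ Pʳ f dr`. -/
noncomputable def potential {E : Type*} [MeasurableSpace E] (P : ℝ≥0 → Kernel E E)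
    (f : E → ℝ) (x : E) : ℝ :=
  ∫ r in Set.Ioi (0 : ℝ), ∫ z, f z ∂(P r.toNNReal x)

section Gap

variable {E : Type*} [MetricSpace E] [MeasurableSpace E]
  {P : ℝ≥0 → Kernel E E} {μs : Measure E} {x₀ : E} {C γ : ℝ} {K : ℝ≥0} {f : E → ℝ}

theorem SpectralGap.abs_integral_le_of_centered (hG : SpectralGap P μs x₀ C γ)
    (hf : LipschitzWith K f) (h0 : ∫ z, f z ∂μs = 0) {r : ℝ} (hr : 0 ≤ r) (x : E) :
    |∫ z, f z ∂(P r.toNNReal x)| ≤ C * K * (1 + dist x x₀) * Real.exp (-γ * r) := by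
  have h := hG.ergodic r.toNNReal K f hf x
  rw [h0, sub_zero, Real.coe_toNNReal r hr] at h
  linarith

/-- A Carathéodory function: continuous in the space variable by `lipschitz`, measurable in time. -/
theorem SpectralGap.measurable_uncurry [SecondCountableTopology E] [BorelSpace E]
    (hG : SpectralGap P μs x₀ C γ) (hf : LipschitzWith K f) :
    Measurable (Function.uncurry fun (r : ℝ) x => ∫ z, f z ∂(P r.toNNReal x)) := by
  have hcont : ∀ t : ℝ≥0, Continuous fun x => ∫ z, f z ∂(P t x) := fun t => by
    refine (LipschitzWith.of_dist_le_mul (K := (C * K * Real.exp (-γ * t)).toNNReal)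
      fun x y => ?_).continuous
    rw [Real.coe_toNNReal _ (by have := hG.const_pos; positivity), Real.dist_eq]
    exact hG.lipschitz t K f hf x y
  have h := measurable_uncurry_of_continuous_of_measurable
    (u := fun x (r : ℝ) => ∫ z, f z ∂(P r.toNNReal x)) (fun r => hcont _)
    (fun x => (hG.measurable K f hf x).comp measurable_real_toNNReal)
  exact h.comp measurable_swap

theorem integrableOn_exp_neg_mul {γ : ℝ} (hγ : 0 < γ) (b : ℝ) :
    IntegrableOn (fun r => Real.exp (-γ * r)) (Set.Ioi b) :=
  integrableOn_exp_mul_Ioi (by linarith) b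

theorem integral_exp_neg_mul_Ioi {γ : ℝ} (hγ : 0 < γ) (b : ℝ) :
    ∫ r in Set.Ioi b, Real.exp (-γ * r) = Real.exp (-γ * b) / γ := by
  rw [integral_exp_mul_Ioi (by linarith) b]; field_simp

theorem SpectralGap.integrableOn [SecondCountableTopology E] [BorelSpace E]
    (hG : SpectralGap P μs x₀ C γ) (hf : LipschitzWith K f) (h0 : ∫ z, f z ∂μs = 0) {b : ℝ}
    (hb : 0 ≤ b) (x : E) :
    IntegrableOn (fun r : ℝ => ∫ z, f z ∂(P r.toNNReal x)) (Set.Ioi b) := by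
  refine ((integrableOn_exp_neg_mul hG.rate_pos b).const_mul (C * K * (1 + dist x x₀))).mono'
    ((hG.measurable K f hf x).comp measurable_real_toNNReal).aestronglyMeasurable ?_
  filter_upwards [ae_restrict_mem measurableSet_Ioi] with r hr
  exact hG.abs_integral_le_of_centered hf h0 (hb.trans (le_of_lt hr)) x

theorem SpectralGap.abs_potential_sub_truncatedPotential_le [SecondCountableTopology E]
    [BorelSpace E] (hG : SpectralGap P μs x₀ C γ) (hf : LipschitzWith K f)
    (h0 : ∫ z, f z ∂μs = 0) {b : ℝ} (hb : 0 ≤ b) (x : E) :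
    |potential P f x - truncatedPotential P f b x| ≤
      C * K / γ * (1 + dist x x₀) * Real.exp (-γ * b) := by
  have e : potential P f x - truncatedPotential P f b x =
      ∫ r in Set.Ioi b, ∫ z, f z ∂(P r.toNNReal x) := by
    rw [potential, truncatedPotential, intervalIntegral.integral_of_le hb,
      ← Set.Ioc_union_Ioi_eq_Ioi hb, setIntegral_union (Set.Ioc_disjoint_Ioi le_rfl)
        measurableSet_Ioi ((hG.integrableOn hf h0 le_rfl x).mono_set Set.Ioc_subset_Ioi_self)
        (hG.integrableOn hf h0 hb x)]
    ring
  rw [e]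
  have h1 : |∫ r in Set.Ioi b, ∫ z, f z ∂(P r.toNNReal x)| ≤
      ∫ r in Set.Ioi b, C * K * (1 + dist x x₀) * Real.exp (-γ * r) := by
    rw [← Real.norm_eq_abs]
    refine norm_integral_le_of_norm_le
      ((integrableOn_exp_neg_mul hG.rate_pos b).const_mul (C * K * (1 + dist x x₀))) ?_
    filter_upwards [ae_restrict_mem measurableSet_Ioi] with r hr
    exact hG.abs_integral_le_of_centered hf h0 (hb.trans (le_of_lt hr)) x
  rw [integral_const_mul, integral_exp_neg_mul_Ioi hG.rate_pos] at h1
  refine h1.trans (le_of_eq ?_)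
  ring

theorem SpectralGap.abs_potential_le [SecondCountableTopology E] [BorelSpace E]
    (hG : SpectralGap P μs x₀ C γ) (hf : LipschitzWith K f)
    (h0 : ∫ z, f z ∂μs = 0) (x : E) : |potential P f x| ≤ C * K / γ * (1 + dist x x₀) := by
  simpa [truncatedPotential] using hG.abs_potential_sub_truncatedPotential_le hf h0 le_rfl x

theorem SpectralGap.abs_truncatedPotential_le [SecondCountableTopology E] [BorelSpace E]
    (hG : SpectralGap P μs x₀ C γ) (hf : LipschitzWith K f)
    (h0 : ∫ z, f z ∂μs = 0) {b : ℝ} (hb : 0 ≤ b) (x : E) :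
    |truncatedPotential P f b x| ≤ C * K / γ * (1 + dist x x₀) := by
  rw [truncatedPotential, intervalIntegral.integral_of_le hb]
  have h1 : |∫ r in Set.Ioc 0 b, ∫ z, f z ∂(P r.toNNReal x)| ≤
      ∫ r in Set.Ioi (0 : ℝ), C * K * (1 + dist x x₀) * Real.exp (-γ * r) := by
    have hi := (integrableOn_exp_neg_mul hG.rate_pos 0).const_mul (C * K * (1 + dist x x₀))
    have hb : ∀ r ∈ Set.Ioi (0 : ℝ), ‖∫ z, f z ∂(P r.toNNReal x)‖ ≤
        C * K * (1 + dist x x₀) * Real.exp (-γ * r) := fun r hr =>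
      hG.abs_integral_le_of_centered hf h0 (le_of_lt hr) x
    rw [← Real.norm_eq_abs]
    refine (norm_integral_le_of_norm_le (hi.mono_measure (Measure.restrict_mono
      Set.Ioc_subset_Ioi_self le_rfl)) ?_).trans (setIntegral_mono_set hi
      (ae_of_all _ fun r => ?_) Set.Ioc_subset_Ioi_self.eventuallyLE)
    · filter_upwards [ae_restrict_mem measurableSet_Ioc] with r hr using hb r hr.1
    · have := hG.const_pos
      simp only [Pi.zero_apply]
      positivity
  rw [integral_const_mul, integral_exp_neg_mul_Ioi hG.rate_pos] at h1
  refine h1.trans (le_of_eq ?_)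
  simp; ring

/-- The decaying Lipschitz constants `C K e^{-γr}` of `P^r f` integrate to `C K / γ`. That the
potential is again Lipschitz is what later makes truncations of `f χ` accessible to the spectral
gap. -/
theorem SpectralGap.lipschitzWith_potential [SecondCountableTopology E] [BorelSpace E]
    (hG : SpectralGap P μs x₀ C γ) (hf : LipschitzWith K f) (h0 : ∫ z, f z ∂μs = 0) :
    LipschitzWith (C * K / γ).toNNReal (potential P f) := by
  have hC := hG.const_pos
  have hγ := hG.rate_pos
  refine LipschitzWith.of_dist_le_mul fun x y => ?_
  rw [Real.coe_toNNReal _ (by positivity), Real.dist_eq, potential, potential,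
    ← integral_sub (hG.integrableOn hf h0 le_rfl x) (hG.integrableOn hf h0 le_rfl y)]
  have h1 : |∫ r in Set.Ioi (0 : ℝ), ((∫ z, f z ∂(P r.toNNReal x)) -
      ∫ z, f z ∂(P r.toNNReal y))| ≤
      ∫ r in Set.Ioi (0 : ℝ), C * K * dist x y * Real.exp (-γ * r) := by
    rw [← Real.norm_eq_abs]
    refine norm_integral_le_of_norm_le
      ((integrableOn_exp_neg_mul hG.rate_pos 0).const_mul (C * K * dist x y)) ?_
    filter_upwards [ae_restrict_mem measurableSet_Ioi] with r hr
    have := hG.lipschitz r.toNNReal K f hf x y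
    rw [Real.coe_toNNReal r (le_of_lt hr)] at this
    rw [Real.norm_eq_abs]
    linarith
  rw [integral_const_mul, integral_exp_neg_mul_Ioi hG.rate_pos] at h1
  refine h1.trans (le_of_eq ?_)
  simp; ring

theorem SpectralGap.measurable_truncatedPotential [SecondCountableTopology E] [BorelSpace E]
    (hG : SpectralGap P μs x₀ C γ) (hf : LipschitzWith K f) :
    Measurable (Function.uncurry (truncatedPotential P f)) :=
  (measurable_uncurry_intervalIntegral (hG.measurable_uncurry hf)).comp
    ((measurable_const.prodMk measurable_fst).prodMk measurable_snd)

/-- The ergodic estimate at time `0`, where `P 0 x` is the Dirac mass at `x`. -/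
theorem SpectralGap.abs_le (hG : SpectralGap P μs x₀ C γ) [BorelSpace E]
    (hP : IsTransitionSemigroup P) (hf : LipschitzWith K f) (h0 : ∫ z, f z ∂μs = 0) (x : E) :
    |f x| ≤ C * K * (1 + dist x x₀) := by
  have h := hG.abs_integral_le_of_centered hf h0 le_rfl x
  rw [Real.toNNReal_zero, hP.zero, Kernel.id_apply,
    integral_dirac' _ _ hf.continuous.measurable.stronglyMeasurable] at h
  simpa using h

end Gap

/-! ### Moments and trigonometric moments of the additive functional. -/

/-- A Lipschitz observable `f`, centered for the invariant measure, of a Markov process whose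
semigroup has a spectral gap, with the moment bound `𝔼 (1 + dist X_t x₀) (1 + |f X_t|) ≤ B`. -/
structure IsCenteredObservable {E Ω : Type*} [MetricSpace E] [MeasurableSpace E]
    [MeasurableSpace Ω] (P : ℝ≥0 → Kernel E E) (X : ℝ≥0 → Ω → E) (Pr : Measure Ω)
    (μs : Measure E) (x₀ : E) (C γ : ℝ) (f : E → ℝ) (K : ℝ≥0) (B : ℝ) : Prop where
  semigroup : IsTransitionSemigroup P
  markov : IsMarkovProcess P X Pr
  gap : SpectralGap P μs x₀ C γ
  lipschitz : LipschitzWith K f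
  centered : ∫ z, f z ∂μs = 0
  integrable_moment : ∀ t, Integrable (fun ω => (1 + dist (X t ω) x₀) * (1 + |f (X t ω)|)) Pr
  moment_le : ∀ t, ∫ ω, (1 + dist (X t ω) x₀) * (1 + |f (X t ω)|) ∂Pr ≤ B

namespace IsCenteredObservable

variable {E Ω : Type*} [MetricSpace E] [SecondCountableTopology E] [MeasurableSpace E]
  [BorelSpace E] [MeasurableSpace Ω] {P : ℝ≥0 → Kernel E E} {X : ℝ≥0 → Ω → E} {Pr : Measure Ω}
  [IsProbabilityMeasure Pr] {μs : Measure E} {x₀ : E} {C γ : ℝ} {f : E → ℝ} {K : ℝ≥0} {B : ℝ}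

theorem measurable_comp (h : IsCenteredObservable P X Pr μs x₀ C γ f K B) (t : ℝ≥0) :
    Measurable fun ω => f (X t ω) :=
  h.lipschitz.continuous.measurable.comp (h.markov.measurable_apply t)

theorem sq_le (h : IsCenteredObservable P X Pr μs x₀ C γ f K B) (x : E) :
    f x ^ 2 ≤ C * K * ((1 + dist x x₀) * (1 + |f x|)) := by
  have h1 := h.gap.abs_le h.semigroup h.lipschitz h.centered x
  have h2 : 0 ≤ C * K := mul_nonneg h.gap.const_pos.le K.2
  have h3 : 0 ≤ C * K * (1 + dist x x₀) := by positivity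
  rw [← sq_abs]
  nlinarith [abs_nonneg (f x)]

theorem isSquareBounded (h : IsCenteredObservable P X Pr μs x₀ C γ f K B) :
    IsSquareBounded (fun (s : ℝ) ω => f (X s.toNNReal ω)) Pr (C * K * B) := by
  have h2 : 0 ≤ C * K := mul_nonneg h.gap.const_pos.le K.2
  have hi : ∀ s : ℝ, Integrable (fun ω => f (X s.toNNReal ω) ^ 2) Pr := fun s =>
    ((h.integrable_moment s.toNNReal).const_mul (C * K)).mono'
      ((h.measurable_comp _).pow_const 2).aestronglyMeasurable (ae_of_all _ fun ω => by
        rw [Real.norm_of_nonneg (sq_nonneg _)]; exact h.sq_le _)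
  refine ⟨?_, hi, fun s => ?_⟩
  · exact h.lipschitz.continuous.measurable.comp (h.markov.measurable.comp
      ((measurable_real_toNNReal.comp measurable_fst).prodMk measurable_snd))
  · refine (integral_mono (hi s) ((h.integrable_moment s.toNNReal).const_mul (C * K))
      fun ω => h.sq_le _).trans ?_
    rw [integral_const_mul]
    exact mul_le_mul_of_nonneg_left (h.moment_le _) h2

theorem bound_nonneg (h : IsCenteredObservable P X Pr μs x₀ C γ f K B) : 0 ≤ B :=
  (integral_nonneg fun ω => by positivity).trans (h.moment_le 0)

/-- `𝔼 |f X_t| |g X_t| ≤ M B` when `|g| ≤ M (1 + dist · x₀)`. -/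
theorem integrable_mul_and_integral_abs_le (h : IsCenteredObservable P X Pr μs x₀ C γ f K B)
    {g : E → ℝ} (hg : Measurable g) {M : ℝ} (hM : ∀ x, |g x| ≤ M * (1 + dist x x₀))
    {W : Ω → ℝ} (hW : AEStronglyMeasurable W Pr) (hW1 : ∀ ω, |W ω| ≤ 1) (t : ℝ≥0) :
    Integrable (fun ω => f (X t ω) * g (X t ω) * W ω) Pr ∧
      ∫ ω, |f (X t ω) * g (X t ω) * W ω| ∂Pr ≤ M * B := by
  have hM0 : 0 ≤ M := by
    have := (abs_nonneg _).trans (hM x₀)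
    simpa using this
  have hb : ∀ ω, |f (X t ω) * g (X t ω) * W ω| ≤
      M * ((1 + dist (X t ω) x₀) * (1 + |f (X t ω)|)) := fun ω => by
    rw [abs_mul, abs_mul]
    have h1 : 0 ≤ |f (X t ω)| * |g (X t ω)| := by positivity
    have h2 := hM (X t ω)
    have h3 : 0 ≤ M * (1 + dist (X t ω) x₀) := by positivity
    calc |f (X t ω)| * |g (X t ω)| * |W ω| ≤ |f (X t ω)| * |g (X t ω)| :=
          mul_le_of_le_one_right h1 (hW1 ω)
      _ ≤ |f (X t ω)| * (M * (1 + dist (X t ω) x₀)) := by gcongr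
      _ ≤ _ := by nlinarith
  have hi : Integrable (fun ω => f (X t ω) * g (X t ω) * W ω) Pr :=
    ((h.integrable_moment t).const_mul M).mono' (((h.measurable_comp t).mul
      (hg.comp (h.markov.measurable_apply t))).aestronglyMeasurable.mul hW) (ae_of_all _ hb)
  refine ⟨hi, (integral_mono hi.abs ((h.integrable_moment t).const_mul M) hb).trans ?_⟩
  rw [integral_const_mul]
  exact mul_le_mul_of_nonneg_left (h.moment_le t) hM0

/-- Conditioning on the past at time `u` replaces the future of the additive functional by the
truncated potential. -/
theorem integral_future_mul (h : IsCenteredObservable P X Pr μs x₀ C γ f K B) {u T : ℝ}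
    (hu : 0 ≤ u) (huT : u ≤ T) {W : Ω → ℝ}
    (hW : AEStronglyMeasurable[pastSigma X u.toNNReal] W Pr) (hW1 : ∀ ω, |W ω| ≤ 1) :
    ∫ ω, (∫ s in u..T, f (X s.toNNReal ω)) * f (X u.toNNReal ω) * W ω ∂Pr =
      ∫ ω, f (X u.toNNReal ω) * truncatedPotential P f (T - u) (X u.toNNReal ω) * W ω ∂Pr := by
  have hY := h.isSquareBounded
  have hCK : 0 ≤ C * K := mul_nonneg h.gap.const_pos.le K.2
  have hWm : AEStronglyMeasurable W Pr := hW.mono (h.markov.pastSigma_le _)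
  set U := X u.toNNReal with hU
  have hUm : Measurable U := h.markov.measurable_apply _
  set Z : Ω → ℝ := fun ω => f (U ω) * W ω with hZ
  have hZm : AEStronglyMeasurable Z Pr := (h.measurable_comp _).aestronglyMeasurable.mul hWm
  have hZ2 : Integrable (fun ω => Z ω ^ 2) Pr :=
    (hY.integrable_sq u).mono' (hZm.pow 2) (ae_of_all _ fun ω => by
      rw [Real.norm_of_nonneg (sq_nonneg _), hZ, mul_pow, ← sq_abs (W ω)]
      exact mul_le_of_le_one_right (sq_nonneg _) (pow_le_one₀ (abs_nonneg _) (hW1 ω)))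
  have hZp : AEStronglyMeasurable[pastSigma X u.toNNReal] Z Pr :=
    (h.lipschitz.continuous.measurable.comp
      (measurable_pastSigma le_rfl)).stronglyMeasurable.aestronglyMeasurable.mul hW
  have hVZ : Integrable (fun ω => (1 + dist (U ω) x₀) * Z ω) Pr := by
    have := (h.integrable_mul_and_integral_abs_le (g := fun x => 1 + dist x x₀) (M := 1)
      (by fun_prop) (fun x => by rw [abs_of_nonneg (by positivity), one_mul]) hWm hW1
      u.toNNReal).1
    refine this.congr (ae_of_all _ fun ω => ?_)
    simp only [hZ, hU]; ring
  have e1 : ∀ ω, (∫ s in u..T, f (X s.toNNReal ω)) * f (U ω) * W ω =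
      (∫ s in u..T, f (X s.toNNReal ω)) * Z ω := fun ω => mul_assoc _ _ _
  simp_rw [e1]
  rw [hY.integral_integral_mul hZm hZ2]
  -- The Markov property is applied at each fixed `s`, between two uses of Fubini; the shift `r = s
  -- - u` then produces the potential truncated at `T - u`.
  have e2 : ∫ s in u..T, ∫ ω, f (X s.toNNReal ω) * Z ω ∂Pr =
      ∫ s in u..T, ∫ ω, (∫ z, f z ∂(P (s - u).toNNReal (U ω))) * Z ω ∂Pr := by
    refine intervalIntegral.integral_congr fun s hs => ?_
    rw [Set.uIcc_of_le huT] at hs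
    have hst : u.toNNReal ≤ s.toNNReal := Real.toNNReal_le_toNNReal hs.1
    have e3 : (s - u).toNNReal = s.toNNReal - u.toNNReal := by
      rw [← NNReal.coe_inj, Real.coe_toNNReal _ (by linarith [hs.1]), NNReal.coe_sub hst,
        Real.coe_toNNReal _ (hu.trans hs.1), Real.coe_toNNReal _ hu]
    simp only [e3]
    exact h.markov.integral_mul h.semigroup h.gap hst h.lipschitz hZp
      ((hY.memLp s).integrable_mul ((memLp_two_iff_integrable_sq hZm).2 hZ2)) hVZ
  rw [e2, intervalIntegral.integral_comp_sub_right
    (fun r => ∫ ω, (∫ z, f z ∂(P r.toNNReal (U ω))) * Z ω ∂Pr) u, sub_self,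
    intervalIntegral_integral_swap]
  · refine integral_congr_ae (ae_of_all _ fun ω => ?_)
    simp only [intervalIntegral.integral_mul_const, truncatedPotential, hZ]
    ring
  · have hfin : IsFiniteMeasure (volume.restrict (Set.uIoc 0 (T - u))) := by
      rw [Set.uIoc]; infer_instance
    refine ((hVZ.abs.const_mul (C * K)).comp_snd
      (volume.restrict (Set.uIoc 0 (T - u)))).mono' ?_ ?_
    · exact ((h.gap.measurable_uncurry h.lipschitz).comp
        (measurable_fst.prodMk (hUm.comp measurable_snd))).aestronglyMeasurable.mul hZm.comp_snd
    · have h2 := (Measure.quasiMeasurePreserving_fst (μ := volume.restrict (Set.uIoc 0 (T - u)))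
        (ν := Pr)).ae (ae_restrict_mem (μ := volume)
          (measurableSet_uIoc (a := 0) (b := T - u)))
      filter_upwards [h2] with p hp
      rw [Set.uIoc_of_le (by linarith)] at hp
      have h3 := h.gap.abs_integral_le_of_centered h.lipschitz h.centered hp.1.le (U p.2)
      have h4 : Real.exp (-γ * p.1) ≤ 1 := by
        rw [Real.exp_le_one_iff]; nlinarith [h.gap.rate_pos, hp.1]
      simp only [Function.uncurry, Real.norm_eq_abs, abs_mul]
      rw [abs_of_nonneg (by positivity : 0 ≤ 1 + dist (U p.2) x₀), ← mul_assoc]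
      refine mul_le_mul_of_nonneg_right (h3.trans ?_) (abs_nonneg _)
      exact mul_le_of_le_one_right (by positivity) h4

theorem aestronglyMeasurable_integral (h : IsCenteredObservable P X Pr μs x₀ C γ f K B) {u : ℝ}
    (hu : 0 ≤ u) : AEStronglyMeasurable[pastSigma X u.toNNReal]
      (fun ω => ∫ s in (0 : ℝ)..u, f (X s.toNNReal ω)) Pr :=
  h.isSquareBounded.aestronglyMeasurable_integral (h.markov.pastSigma_le _) hu fun _ hs =>
    (h.lipschitz.continuous.measurable.comp
      (measurable_pastSigma (Real.toNNReal_le_toNNReal hs.2))).stronglyMeasurable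

end IsCenteredObservable

theorem integral_exp_neg_mul_le {γ : ℝ} (hγ : 0 < γ) {T : ℝ} (hT : 0 ≤ T) :
    ∫ u in (0 : ℝ)..T, Real.exp (-γ * u) ≤ 1 / γ := by
  rw [intervalIntegral.integral_of_le hT]
  refine (setIntegral_mono_set (integrableOn_exp_neg_mul hγ 0)
    (ae_of_all _ fun r => (Real.exp_pos _).le) Set.Ioc_subset_Ioi_self.eventuallyLE).trans ?_
  rw [integral_exp_neg_mul_Ioi hγ]; simp

theorem integral_exp_neg_mul_sub_le {γ : ℝ} (hγ : 0 < γ) {T : ℝ} (hT : 0 ≤ T) :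
    ∫ u in (0 : ℝ)..T, Real.exp (-γ * (T - u)) ≤ 1 / γ := by
  rw [intervalIntegral.integral_comp_sub_left (fun u => Real.exp (-γ * u)) T, sub_self, sub_zero]
  exact integral_exp_neg_mul_le hγ hT

namespace IsCenteredObservable

variable {E Ω : Type*} [MetricSpace E] [SecondCountableTopology E] [MeasurableSpace E]
  [BorelSpace E] [MeasurableSpace Ω] {P : ℝ≥0 → Kernel E E} {X : ℝ≥0 → Ω → E} {Pr : Measure Ω}
  [IsProbabilityMeasure Pr] {μs : Measure E} {x₀ : E} {C γ : ℝ} {f : E → ℝ} {K : ℝ≥0} {B : ℝ}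

theorem aestronglyMeasurable_comp_integral (h : IsCenteredObservable P X Pr μs x₀ C γ f K B)
    {w : ℝ → ℝ} (hw : Continuous w) {u : ℝ} (hu : 0 ≤ u) :
    AEStronglyMeasurable[pastSigma X u.toNNReal]
      (fun ω => w (∫ s in (0 : ℝ)..u, f (X s.toNNReal ω))) Pr :=
  hw.comp_aestronglyMeasurable (h.aestronglyMeasurable_integral hu)

theorem measurable_uncurry_comp_integral (h : IsCenteredObservable P X Pr μs x₀ C γ f K B)
    {w : ℝ → ℝ} (hw : Continuous w) :
    Measurable (Function.uncurry fun u ω => w (∫ s in (0 : ℝ)..u, f (X s.toNNReal ω))) :=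
  hw.measurable.comp ((measurable_uncurry_intervalIntegral h.isSquareBounded.measurable).comp
    ((measurable_const.prodMk measurable_fst).prodMk measurable_snd))

theorem measurable_comp_integral (h : IsCenteredObservable P X Pr μs x₀ C γ f K B)
    {w : ℝ → ℝ} (hw : Continuous w) (u : ℝ) :
    Measurable fun ω => w (∫ s in (0 : ℝ)..u, f (X s.toNNReal ω)) :=
  (h.measurable_uncurry_comp_integral hw).comp (measurable_prodMk_left (x := u))

theorem measurable_uncurry_process (h : IsCenteredObservable P X Pr μs x₀ C γ f K B) :
    Measurable (Function.uncurry fun (u : ℝ) ω => X u.toNNReal ω) :=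
  h.markov.measurable.comp ((measurable_real_toNNReal.comp measurable_fst).prodMk measurable_snd)

theorem measurable_integral_mul_comp (h : IsCenteredObservable P X Pr μs x₀ C γ f K B)
    {g : E → ℝ} (hg : Measurable g) {w : ℝ → ℝ} (hw : Continuous w) :
    StronglyMeasurable fun u : ℝ =>
      ∫ ω, g (X u.toNNReal ω) * w (∫ s in (0 : ℝ)..u, f (X s.toNNReal ω)) ∂Pr :=
  StronglyMeasurable.integral_prod_right' (ν := Pr) (f := fun p : ℝ × Ω =>
    g (X p.1.toNNReal p.2) * w (∫ s in (0 : ℝ)..p.1, f (X s.toNNReal p.2)))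
    ((hg.comp h.measurable_uncurry_process).mul
      (h.measurable_uncurry_comp_integral hw)).stronglyMeasurable

theorem measurable_potential (h : IsCenteredObservable P X Pr μs x₀ C γ f K B) :
    Measurable (potential P f) :=
  (h.gap.lipschitzWith_potential h.lipschitz h.centered).continuous.measurable

theorem abs_integral_mul_potential_le (h : IsCenteredObservable P X Pr μs x₀ C γ f K B)
    {w : ℝ → ℝ} (hw : Continuous w) (hw1 : ∀ x, |w x| ≤ 1) (u : ℝ) :
    |∫ ω, f (X u.toNNReal ω) * potential P f (X u.toNNReal ω) *
      w (∫ s in (0 : ℝ)..u, f (X s.toNNReal ω)) ∂Pr| ≤ C * K / γ * B :=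
  abs_integral_le_integral_abs.trans
    (h.integrable_mul_and_integral_abs_le h.measurable_potential
      (h.gap.abs_potential_le h.lipschitz h.centered)
      (h.measurable_comp_integral hw u).aestronglyMeasurable
      (fun _ => hw1 _) u.toNNReal).2

theorem intervalIntegrable_integral_mul_potential
    (h : IsCenteredObservable P X Pr μs x₀ C γ f K B)
    {w : ℝ → ℝ} (hw : Continuous w) (hw1 : ∀ x, |w x| ≤ 1) (a b : ℝ) :
    IntervalIntegrable (fun u : ℝ => ∫ ω, f (X u.toNNReal ω) * potential P f (X u.toNNReal ω) *
      w (∫ s in (0 : ℝ)..u, f (X s.toNNReal ω)) ∂Pr) volume a b := by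
  rw [intervalIntegrable_iff]
  have hfin : IsFiniteMeasure (volume.restrict (Set.uIoc a b)) := by
    rw [Set.uIoc]; infer_instance
  exact (integrable_const (C * K / γ * B)).mono'
    (h.measurable_integral_mul_comp (g := fun x => f x * potential P f x)
      (h.lipschitz.continuous.measurable.mul h.measurable_potential) hw).aestronglyMeasurable
    (ae_of_all _ fun u => h.abs_integral_mul_potential_le hw hw1 u)

theorem integral_future_mul_comp (h : IsCenteredObservable P X Pr μs x₀ C γ f K B)
    {w : ℝ → ℝ} (hw : Continuous w) (hw1 : ∀ x, |w x| ≤ 1) {u T : ℝ} (hu : 0 ≤ u) (huT : u ≤ T) :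
    ∫ ω, (∫ s in u..T, f (X s.toNNReal ω)) * f (X u.toNNReal ω) *
        w (∫ s in (0 : ℝ)..u, f (X s.toNNReal ω)) ∂Pr =
      ∫ ω, f (X u.toNNReal ω) * truncatedPotential P f (T - u) (X u.toNNReal ω) *
        w (∫ s in (0 : ℝ)..u, f (X s.toNNReal ω)) ∂Pr :=
  h.integral_future_mul hu huT (h.aestronglyMeasurable_comp_integral hw hu) fun _ => hw1 _

theorem abs_integral_future_mul_le (h : IsCenteredObservable P X Pr μs x₀ C γ f K B)
    {w : ℝ → ℝ} (hw : Continuous w) (hw1 : ∀ x, |w x| ≤ 1) {u T : ℝ} (hu : 0 ≤ u) (huT : u ≤ T) :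
    |∫ ω, (∫ s in u..T, f (X s.toNNReal ω)) * f (X u.toNNReal ω) *
        w (∫ s in (0 : ℝ)..u, f (X s.toNNReal ω)) ∂Pr| ≤ C * K / γ * B := by
  rw [h.integral_future_mul_comp hw hw1 hu huT]
  exact abs_integral_le_integral_abs.trans
    (h.integrable_mul_and_integral_abs_le
      ((h.gap.measurable_truncatedPotential h.lipschitz).comp
        (measurable_prodMk_left (x := T - u)))
      (h.gap.abs_truncatedPotential_le h.lipschitz h.centered (sub_nonneg.2 huT))
      (h.measurable_comp_integral hw u).aestronglyMeasurable
      (fun _ => hw1 _) u.toNNReal).2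

/-- Truncating the potential at `T - u` costs a multiple of `e^{-γ(T-u)}`, whose integral over `u`
is at most `1 / γ`. The total error is thus independent of `T`, hence negligible after division by
`T`. -/
theorem abs_integral_future_sub_le (h : IsCenteredObservable P X Pr μs x₀ C γ f K B)
    {w : ℝ → ℝ} (hw : Continuous w) (hw1 : ∀ x, |w x| ≤ 1) {T : ℝ} (hT : 0 ≤ T) :
    |(∫ u in (0 : ℝ)..T, ∫ ω, (∫ s in u..T, f (X s.toNNReal ω)) * f (X u.toNNReal ω) *
        w (∫ s in (0 : ℝ)..u, f (X s.toNNReal ω)) ∂Pr) -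
      ∫ u in (0 : ℝ)..T, ∫ ω, f (X u.toNNReal ω) * potential P f (X u.toNNReal ω) *
        w (∫ s in (0 : ℝ)..u, f (X s.toNNReal ω)) ∂Pr| ≤ C * K / γ * B / γ := by
  have hCK : 0 ≤ C * K := mul_nonneg h.gap.const_pos.le K.2
  have hγ := h.gap.rate_pos
  have hB := h.bound_nonneg
  have hwm : ∀ u, AEStronglyMeasurable
      (fun ω => w (∫ s in (0 : ℝ)..u, f (X s.toNNReal ω))) Pr := fun u =>
    (h.measurable_comp_integral hw u).aestronglyMeasurable
  have i1 : IntervalIntegrable (fun u => ∫ ω, (∫ s in u..T, f (X s.toNNReal ω)) *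
      f (X u.toNNReal ω) * w (∫ s in (0 : ℝ)..u, f (X s.toNNReal ω)) ∂Pr) volume 0 T := by
    rw [intervalIntegrable_iff]
    exact (h.isSquareBounded.integrable_prod_remainder (h.measurable_uncurry_comp_integral hw)
      (fun _ _ => hw1 _) hT).integral_prod_left
  rw [← intervalIntegral.integral_sub i1
    (h.intervalIntegrable_integral_mul_potential hw hw1 0 T)]
  have hbound : ∀ u ∈ Set.Ioc 0 T, ‖(∫ ω, (∫ s in u..T, f (X s.toNNReal ω)) *
      f (X u.toNNReal ω) * w (∫ s in (0 : ℝ)..u, f (X s.toNNReal ω)) ∂Pr) -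
      ∫ ω, f (X u.toNNReal ω) * potential P f (X u.toNNReal ω) *
        w (∫ s in (0 : ℝ)..u, f (X s.toNNReal ω)) ∂Pr‖ ≤
      C * K / γ * B * Real.exp (-γ * (T - u)) := by
    intro u hu
    have hb : 0 ≤ T - u := by linarith [hu.2]
    have hχm : Measurable (truncatedPotential P f (T - u)) :=
      (h.gap.measurable_truncatedPotential h.lipschitz).comp (measurable_prodMk_left (x := T - u))
    rw [h.integral_future_mul_comp hw hw1 hu.1.le hu.2, norm_sub_rev]
    have j1 := (h.integrable_mul_and_integral_abs_le h.measurable_potential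
      (h.gap.abs_potential_le h.lipschitz h.centered) (hwm u) (fun _ => hw1 _) u.toNNReal).1
    have j2 := (h.integrable_mul_and_integral_abs_le hχm
      (h.gap.abs_truncatedPotential_le h.lipschitz h.centered hb) (hwm u)
      (fun _ => hw1 _) u.toNNReal).1
    have j3 := (h.integrable_mul_and_integral_abs_le (h.measurable_potential.sub hχm)
      (M := C * K / γ * Real.exp (-γ * (T - u)))
      (fun x => by
        have := h.gap.abs_potential_sub_truncatedPotential_le h.lipschitz h.centered hb x
        simp only [Pi.sub_apply]
        linarith) (hwm u) (fun _ => hw1 _) u.toNNReal).2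
    rw [← integral_sub j1 j2]
    refine abs_integral_le_integral_abs.trans (le_trans (le_of_eq ?_) (j3.trans (le_of_eq ?_)))
    · refine integral_congr_ae (ae_of_all _ fun ω => ?_)
      simp only [Pi.sub_apply]
      congr 1; ring
    · ring
  have hexp : IntervalIntegrable (fun u => C * K / γ * B * Real.exp (-γ * (T - u))) volume 0 T :=
    (by fun_prop : Continuous fun u => C * K / γ * B * Real.exp (-γ * (T - u))).intervalIntegrable
      _ _
  refine (intervalIntegral.norm_integral_le_of_norm_le hT
    (ae_of_all _ hbound) hexp).trans ?_
  rw [intervalIntegral.integral_const_mul]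
  have := integral_exp_neg_mul_sub_le hγ hT
  calc C * K / γ * B * ∫ u in (0 : ℝ)..T, Real.exp (-γ * (T - u)) ≤ C * K / γ * B * (1 / γ) := by
        gcongr
    _ = _ := by ring

/-- Taylor's formula for `x ^ 2`. The constant weight is kept as a function so that the estimates
for a general `w` apply verbatim. -/
theorem integral_sq_integral_eq (h : IsCenteredObservable P X Pr μs x₀ C γ f K B) {T : ℝ}
    (hT : 0 ≤ T) :
    ∫ ω, (∫ s in (0 : ℝ)..T, f (X s.toNNReal ω)) ^ 2 ∂Pr =
      2 * ∫ u in (0 : ℝ)..T, ∫ ω, (∫ s in u..T, f (X s.toNNReal ω)) * f (X u.toNNReal ω) *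
        (fun _ => 1 : ℝ → ℝ) (∫ s in (0 : ℝ)..u, f (X s.toNNReal ω)) ∂Pr := by
  have := h.isSquareBounded.integral_comp_eq_taylor hT (h := fun x => x ^ 2)
    (h' := fun x => 2 * x) (h'' := fun _ => 2) (M := 2) (fun x => by
      simpa using hasDerivAt_pow 2 x) (fun x => by simpa using (hasDerivAt_id x).const_mul 2)
    continuous_const (fun _ => by norm_num)
  rw [this, ← intervalIntegral.integral_const_mul]
  simp only [mul_one, integral_mul_const]
  simp [mul_comm]

theorem integral_sq_integral_le (h : IsCenteredObservable P X Pr μs x₀ C γ f K B) {T : ℝ}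
    (hT : 0 ≤ T) :
    ∫ ω, (∫ s in (0 : ℝ)..T, f (X s.toNNReal ω)) ^ 2 ∂Pr ≤ 2 * (C * K / γ * B) * T := by
  rw [h.integral_sq_integral_eq hT]
  have := intervalIntegral.norm_integral_le_of_norm_le_const (a := 0) (b := T)
    (C := C * K / γ * B) (f := fun u => ∫ ω, (∫ s in u..T, f (X s.toNNReal ω)) *
      f (X u.toNNReal ω) * (fun _ => 1 : ℝ → ℝ) (∫ s in (0 : ℝ)..u, f (X s.toNNReal ω)) ∂Pr)
    (fun u hu => by
      rw [Set.uIoc_of_le hT] at hu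
      exact h.abs_integral_future_mul_le continuous_const (fun _ => by simp) hu.1.le hu.2)
  rw [sub_zero, abs_of_nonneg hT] at this
  linarith [le_abs_self (∫ u in (0 : ℝ)..T, ∫ ω, (∫ s in u..T, f (X s.toNNReal ω)) *
      f (X u.toNNReal ω) * (fun _ => 1 : ℝ → ℝ) (∫ s in (0 : ℝ)..u, f (X s.toNNReal ω)) ∂Pr),
    Real.norm_eq_abs (∫ u in (0 : ℝ)..T, ∫ ω, (∫ s in u..T, f (X s.toNNReal ω)) *
      f (X u.toNNReal ω) * (fun _ => 1 : ℝ → ℝ) (∫ s in (0 : ℝ)..u, f (X s.toNNReal ω)) ∂Pr)]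

theorem abs_integral_sq_integral_sub_le (h : IsCenteredObservable P X Pr μs x₀ C γ f K B) {T : ℝ}
    (hT : 0 ≤ T) :
    |(∫ ω, (∫ s in (0 : ℝ)..T, f (X s.toNNReal ω)) ^ 2 ∂Pr) -
      2 * ∫ u in (0 : ℝ)..T, ∫ ω, f (X u.toNNReal ω) * potential P f (X u.toNNReal ω) *
        (fun _ => 1 : ℝ → ℝ) (∫ s in (0 : ℝ)..u, f (X s.toNNReal ω)) ∂Pr| ≤
      2 * (C * K / γ * B / γ) := by
  rw [h.integral_sq_integral_eq hT, ← mul_sub, abs_mul, abs_two]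
  exact mul_le_mul_of_nonneg_left
    (h.abs_integral_future_sub_le continuous_const (fun _ => by simp) hT) zero_le_two

/-- The mean of `f (X u)` decays like `e^{-γu}` since `f` is centered, so the first order Taylor
term stays bounded in `T`. -/
theorem abs_integral_integral_le (h : IsCenteredObservable P X Pr μs x₀ C γ f K B) {T : ℝ}
    (hT : 0 ≤ T) : |∫ ω, (∫ s in (0 : ℝ)..T, f (X s.toNNReal ω)) ∂Pr| ≤ C * K / γ * B := by
  have hCK : 0 ≤ C * K := mul_nonneg h.gap.const_pos.le K.2
  have hγ := h.gap.rate_pos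
  have hV : ∀ ω, 1 + dist (X 0 ω) x₀ ≤ (1 + dist (X 0 ω) x₀) * (1 + |f (X 0 ω)|) := fun ω =>
    le_mul_of_one_le_right (by positivity) (by linarith [abs_nonneg (f (X 0 ω))])
  have hVm : Measurable fun ω => 1 + dist (X 0 ω) x₀ :=
    measurable_const.add ((continuous_id.dist continuous_const).measurable.comp
      (h.markov.measurable_apply 0))
  have hVi : Integrable (fun ω => 1 + dist (X 0 ω) x₀) Pr :=
    (h.integrable_moment 0).mono' hVm.aestronglyMeasurable (ae_of_all _ fun ω => by
      rw [Real.norm_of_nonneg (by positivity)]; exact hV ω)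
  have hVB : ∫ ω, (1 + dist (X 0 ω) x₀) ∂Pr ≤ B :=
    (integral_mono hVi (h.integrable_moment 0) hV).trans (h.moment_le 0)
  have hdi : Integrable (fun ω => dist (X 0 ω) x₀) Pr := by
    refine (hVi.sub (integrable_const (1 : ℝ))).congr (ae_of_all _ fun ω => ?_)
    simp
  rw [← intervalIntegral_integral_swap (h.isSquareBounded.integrable_prod 0 T),
    ← Real.norm_eq_abs]
  have hexp : IntervalIntegrable (fun u => C * K * B * Real.exp (-γ * u)) volume 0 T :=
    (by fun_prop : Continuous fun u => C * K * B * Real.exp (-γ * u)).intervalIntegrable _ _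
  refine (intervalIntegral.norm_integral_le_of_norm_le hT
    (g := fun u => C * K * B * Real.exp (-γ * u)) (ae_of_all _ fun u hu => ?_) hexp).trans ?_
  · have h1 := (h.markov.abs_integral_sub_le h.semigroup h.gap hdi u.toNNReal h.lipschitz).2
    rw [h.centered, sub_zero, Real.coe_toNNReal _ hu.1.le] at h1
    refine h1.trans ?_
    calc C * K * Real.exp (-γ * u) * ∫ ω, (1 + dist (X 0 ω) x₀) ∂Pr
        ≤ C * K * Real.exp (-γ * u) * B := by gcongr
      _ = _ := by ring
  · rw [intervalIntegral.integral_const_mul]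
    have hB := h.bound_nonneg
    calc C * K * B * ∫ u in (0 : ℝ)..T, Real.exp (-γ * u) ≤ C * K * B * (1 / γ) := by
          gcongr
          exact integral_exp_neg_mul_le hγ hT
      _ = _ := by ring

/-- The approximate integral equation satisfied by the characteristic function. -/
theorem abs_integral_cos_sub_le (h : IsCenteredObservable P X Pr μs x₀ C γ f K B) {T : ℝ}
    (hT : 0 ≤ T) (lam β : ℝ) :
    |(∫ ω, Real.cos (lam * (∫ s in (0 : ℝ)..T, f (X s.toNNReal ω)) + β) ∂Pr) - Real.cos β +
      lam ^ 2 * ∫ u in (0 : ℝ)..T, ∫ ω, f (X u.toNNReal ω) * potential P f (X u.toNNReal ω) *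
        Real.cos (lam * (∫ s in (0 : ℝ)..u, f (X s.toNNReal ω)) + β) ∂Pr| ≤
      |lam| * (C * K / γ * B) + lam ^ 2 * (C * K / γ * B / γ) := by
  have hw : Continuous fun x => Real.cos (lam * x + β) := by fun_prop
  have hlin : ∀ x, HasDerivAt (fun x => lam * x + β) lam x := fun x => by
    simpa using ((hasDerivAt_id x).const_mul lam).add_const β
  -- The second derivative of `cos (lam * x + β)` is `-lam ^ 2` times the function itself; this
  -- closes the equation. The phase `β` lets one statement cover cosine and sine.
  have h1 := h.isSquareBounded.integral_comp_eq_taylor hT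
    (h := fun x => Real.cos (lam * x + β)) (h' := fun x => -Real.sin (lam * x + β) * lam)
    (h'' := fun x => -lam ^ 2 * Real.cos (lam * x + β)) (M := lam ^ 2)
    (fun x => (Real.hasDerivAt_cos _).comp x (hlin x))
    (fun x => by
      have := (((Real.hasDerivAt_sin _).comp x (hlin x)).neg).mul_const lam
      convert! this using 1
      ring) (by fun_prop) (fun x => by
      rw [abs_mul, abs_neg, abs_of_nonneg (sq_nonneg lam)]
      exact mul_le_of_le_one_right (sq_nonneg _) (Real.abs_cos_le_one _))
  have h2 := h.abs_integral_future_sub_le hw (fun x => Real.abs_cos_le_one _) hT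
  have h3 := h.abs_integral_integral_le hT
  have h4 : ∫ u in (0 : ℝ)..T, ∫ ω, (∫ s in u..T, f (X s.toNNReal ω)) * f (X u.toNNReal ω) *
      (-lam ^ 2 * Real.cos (lam * (∫ s in (0 : ℝ)..u, f (X s.toNNReal ω)) + β)) ∂Pr =
      -lam ^ 2 * ∫ u in (0 : ℝ)..T, ∫ ω, (∫ s in u..T, f (X s.toNNReal ω)) *
        f (X u.toNNReal ω) *
        Real.cos (lam * (∫ s in (0 : ℝ)..u, f (X s.toNNReal ω)) + β) ∂Pr := by
    simp_rw [mul_left_comm _ (-lam ^ 2), integral_const_mul]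
    rw [intervalIntegral.integral_const_mul]
  rw [h4] at h1
  simp only [mul_zero, zero_add] at h1
  rw [h1]
  set I1 := ∫ u in (0 : ℝ)..T, ∫ ω, (∫ s in u..T, f (X s.toNNReal ω)) *
        f (X u.toNNReal ω) *
        Real.cos (lam * (∫ s in (0 : ℝ)..u, f (X s.toNNReal ω)) + β) ∂Pr
  set I2 := ∫ u in (0 : ℝ)..T, ∫ ω, f (X u.toNNReal ω) * potential P f (X u.toNNReal ω) *
        Real.cos (lam * (∫ s in (0 : ℝ)..u, f (X s.toNNReal ω)) + β) ∂Pr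
  set m := ∫ ω, (∫ s in (0 : ℝ)..T, f (X s.toNNReal ω)) ∂Pr
  have e : Real.cos β + -Real.sin β * lam * m + -lam ^ 2 * I1 - Real.cos β + lam ^ 2 * I2 =
      -(Real.sin β * lam * m) - lam ^ 2 * (I1 - I2) := by ring
  rw [e]
  refine (abs_sub _ _).trans (add_le_add ?_ ?_)
  · rw [abs_neg, abs_mul, abs_mul]
    calc |Real.sin β| * |lam| * |m| ≤ 1 * |lam| * (C * K / γ * B) := by
          gcongr
          exact Real.abs_sin_le_one _
      _ = _ := by ring
  · rw [abs_mul, abs_of_nonneg (sq_nonneg lam)]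
    exact mul_le_mul_of_nonneg_left h2 (sq_nonneg _)

end IsCenteredObservable

/-! ### The weak law of large numbers. -/

section LawOfLargeNumbers

variable {E Ω : Type*} [MetricSpace E] [SecondCountableTopology E] [MeasurableSpace E]
  [BorelSpace E] [MeasurableSpace Ω] {P : ℝ≥0 → Kernel E E} {X : ℝ≥0 → Ω → E} {Pr : Measure Ω}
  [IsProbabilityMeasure Pr] {μs : Measure E} {x₀ : E} {C γ : ℝ}

theorem IsMarkovProcess.integral_abs_le (hX : IsMarkovProcess P X Pr)
    (hP : IsTransitionSemigroup P) (hG : SpectralGap P μs x₀ C γ)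
    (hi : Integrable (fun ω => dist (X 0 ω) x₀) Pr) {K : ℝ≥0} {g : E → ℝ}
    (hg : LipschitzWith K g) (t : ℝ≥0) :
    ∫ ω, |g (X t ω)| ∂Pr ≤ (∫ z, |g z| ∂μs) +
      C * K * (∫ ω, (1 + dist (X 0 ω) x₀) ∂Pr) * Real.exp (-γ * t) := by
  have h := (abs_le.1 (hX.abs_integral_sub_le hP hG hi t hg.abs_comp).2).2
  linarith

theorem IsMarkovProcess.integrable_prod_of_lipschitz (hX : IsMarkovProcess P X Pr)
    (hP : IsTransitionSemigroup P) (hG : SpectralGap P μs x₀ C γ)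
    (hi : Integrable (fun ω => dist (X 0 ω) x₀) Pr) {K : ℝ≥0} {g : E → ℝ}
    (hg : LipschitzWith K g) (a b : ℝ) :
    Integrable (Function.uncurry fun (s : ℝ) ω => g (X s.toNNReal ω))
      ((volume.restrict (Set.uIoc a b)).prod Pr) := by
  refine integrable_prod_of_integral_abs_le (B := (∫ z, |g z| ∂μs) +
      C * K * (∫ ω, (1 + dist (X 0 ω) x₀) ∂Pr)) ?_ fun s _ =>
      ⟨(hX.abs_integral_sub_le hP hG hi _ hg).1, ?_⟩
  · exact hg.continuous.measurable.comp (hX.measurable.comp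
      ((measurable_real_toNNReal.comp measurable_fst).prodMk measurable_snd))
  · refine (hX.integral_abs_le hP hG hi hg _).trans ?_
    have hA : 0 ≤ ∫ ω, (1 + dist (X 0 ω) x₀) ∂Pr := integral_nonneg fun ω => by positivity
    have hC := hG.const_pos
    have := mul_le_of_le_one_right (by positivity : 0 ≤ C * K * (∫ ω, (1 + dist (X 0 ω) x₀) ∂Pr))
      (hG.exp_le_one s.toNNReal)
    linarith

theorem IsMarkovProcess.ae_intervalIntegrable_of_lipschitz (hX : IsMarkovProcess P X Pr)
    (hP : IsTransitionSemigroup P) (hG : SpectralGap P μs x₀ C γ)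
    (hi : Integrable (fun ω => dist (X 0 ω) x₀) Pr) {K : ℝ≥0} {g : E → ℝ}
    (hg : LipschitzWith K g) :
    ∀ᵐ ω ∂Pr, ∀ T : ℝ, 0 ≤ T → IntervalIntegrable (fun s : ℝ => g (X s.toNNReal ω)) volume 0 T :=
  ae_forall_intervalIntegrable fun T _ => hX.integrable_prod_of_lipschitz hP hG hi hg 0 T

theorem IsMarkovProcess.integral_abs_integral_le (hX : IsMarkovProcess P X Pr)
    (hP : IsTransitionSemigroup P) (hG : SpectralGap P μs x₀ C γ)
    (hi : Integrable (fun ω => dist (X 0 ω) x₀) Pr) {K : ℝ≥0} {g : E → ℝ}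
    (hg : LipschitzWith K g) {T : ℝ} (hT : 0 ≤ T) :
    Integrable (fun ω => ∫ s in (0 : ℝ)..T, g (X s.toNNReal ω)) Pr ∧
    ∫ ω, |∫ s in (0 : ℝ)..T, g (X s.toNNReal ω)| ∂Pr ≤ T * (∫ z, |g z| ∂μs) +
      C * K * (∫ ω, (1 + dist (X 0 ω) x₀) ∂Pr) / γ := by
  have h1 := hX.integrable_prod_of_lipschitz hP hG hi hg 0 T
  have h2 := hX.integrable_prod_of_lipschitz hP hG hi hg.abs_comp 0 T
  have i1 : Integrable (fun ω => ∫ s in (0 : ℝ)..T, g (X s.toNNReal ω)) Pr := by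
    have := h1.integral_prod_right
    rw [Set.uIoc_of_le hT] at this
    simp only [intervalIntegral.integral_of_le hT]
    exact this
  have i2 : Integrable (fun ω => ∫ s in (0 : ℝ)..T, |g (X s.toNNReal ω)|) Pr := by
    have := h2.integral_prod_right
    rw [Set.uIoc_of_le hT] at this
    simp only [intervalIntegral.integral_of_le hT]
    exact this
  refine ⟨i1, (integral_mono i1.abs i2 fun ω =>
    intervalIntegral.abs_integral_le_integral_abs hT).trans ?_⟩
  have hC := hG.const_pos
  have hA : 0 ≤ ∫ ω, (1 + dist (X 0 ω) x₀) ∂Pr := integral_nonneg fun ω => by positivity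
  set A := ∫ ω, (1 + dist (X 0 ω) x₀) ∂Pr
  rw [← intervalIntegral_integral_swap h2]
  have i3 : IntervalIntegrable (fun s : ℝ => ∫ ω, |g (X s.toNNReal ω)| ∂Pr) volume 0 T := by
    rw [intervalIntegrable_iff]
    exact h2.integral_prod_left
  have i4 : IntervalIntegrable (fun s : ℝ => C * K * A * Real.exp (-γ * s)) volume 0 T :=
    (by fun_prop : Continuous fun s => C * K * A * Real.exp (-γ * s)).intervalIntegrable _ _
  refine (intervalIntegral.integral_mono_on hT i3
    ((intervalIntegrable_const (c := ∫ z, |g z| ∂μs)).add i4) fun s hs => ?_).trans ?_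
  · have := hX.integral_abs_le hP hG hi hg s.toNNReal
    rwa [Real.coe_toNNReal _ hs.1] at this
  · rw [intervalIntegral.integral_add intervalIntegrable_const i4,
      intervalIntegral.integral_const, intervalIntegral.integral_const_mul, sub_zero, smul_eq_mul]
    have := mul_le_mul_of_nonneg_left (integral_exp_neg_mul_le hG.rate_pos hT)
      (by positivity : 0 ≤ C * K * A)
    rw [mul_one_div] at this
    linarith

/-- For bounded `f` the mixed moment is controlled by the first moment alone, so the second moment
bound is available without H2 and H3. -/
theorem IsMarkovProcess.isCenteredObservable_of_bounded (hX : IsMarkovProcess P X Pr)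
    (hP : IsTransitionSemigroup P) (hG : SpectralGap P μs x₀ C γ)
    (hi : Integrable (fun ω => dist (X 0 ω) x₀) Pr) {K : ℝ≥0} {f : E → ℝ}
    (hf : LipschitzWith K f) (h0 : ∫ z, f z ∂μs = 0) {A : ℝ} (hA : ∀ x, |f x| ≤ A) :
    ∃ B, IsCenteredObservable P X Pr μs x₀ C γ f K B := by
  have hA0 : 0 ≤ A := (abs_nonneg _).trans (hA x₀)
  have hV : LipschitzWith 1 fun x => 1 + dist x x₀ := by
    refine LipschitzWith.of_dist_le_mul fun x y => ?_
    simpa [Real.dist_eq] using abs_dist_sub_le x y x₀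
  have hVi := fun t => (hX.abs_integral_sub_le hP hG hi t hV).1
  have hle : ∀ x, (1 + dist x x₀) * (1 + |f x|) ≤ (1 + A) * (1 + dist x x₀) := fun x => by
    rw [mul_comm]
    have := hA x
    gcongr
  have hint : ∀ t, Integrable (fun ω => (1 + dist (X t ω) x₀) * (1 + |f (X t ω)|)) Pr := fun t =>
    ((hVi t).const_mul (1 + A)).mono'
      (((hV.continuous.measurable.mul (measurable_const.add hf.continuous.measurable.abs)).comp
        (hX.measurable_apply t)).aestronglyMeasurable) (ae_of_all _ fun ω => by
        rw [Real.norm_of_nonneg (by positivity)]; exact hle _)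
  refine ⟨(1 + A) * ((∫ z, |1 + dist z x₀| ∂μs) +
      C * (1 : ℝ≥0) * (∫ ω, (1 + dist (X 0 ω) x₀) ∂Pr)), hP, hX, hG, hf, h0, hint, fun t => ?_⟩
  refine (integral_mono (hint t) ((hVi t).const_mul (1 + A)) fun ω => hle _).trans ?_
  rw [integral_const_mul]
  refine mul_le_mul_of_nonneg_left ?_ (by positivity)
  have h1 := hX.integral_abs_le hP hG hi hV t
  have h2 : ∫ ω, (1 + dist (X t ω) x₀) ∂Pr = ∫ ω, |1 + dist (X t ω) x₀| ∂Pr :=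
    integral_congr_ae (ae_of_all _ fun ω => (abs_of_nonneg (by positivity)).symm)
  rw [h2]
  have hAn : 0 ≤ ∫ ω, (1 + dist (X 0 ω) x₀) ∂Pr := integral_nonneg fun ω => by positivity
  have hC := hG.const_pos
  have := mul_le_of_le_one_right
    (by positivity : 0 ≤ C * (1 : ℝ≥0) * (∫ ω, (1 + dist (X 0 ω) x₀) ∂Pr)) (hG.exp_le_one t)
  linarith

/-- Quantitative law of large numbers in `L¹`. -/
theorem IsMarkovProcess.exists_integral_abs_average_sub_le (hX : IsMarkovProcess P X Pr)
    (hP : IsTransitionSemigroup P) (hG : SpectralGap P μs x₀ C γ)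
    (hi : Integrable (fun ω => dist (X 0 ω) x₀) Pr) {K : ℝ≥0} {ψ : E → ℝ}
    (hψ : LipschitzWith K ψ) (n : ℕ) :
    ∃ D : ℝ, ∀ T : ℝ, 1 ≤ T →
      ∫ ω, |1 / T * additiveFunctional X ψ T ω - ∫ z, ψ z ∂μs| ∂Pr ≤
        D / √T + 2 * ∫ z, |ψ z - clip n (ψ z)| ∂μs := by
  have hp := hG.isP1.isProb
  set v := ∫ z, ψ z ∂μs with hv
  set vn := ∫ z, clip n (ψ z) ∂μs with hvn
  have hcl := hψ.clip_comp n
  have hψi := hG.isP1.integrable_of_lipschitz hψ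
  have hci := hG.isP1.integrable_of_lipschitz hcl
  -- Splitting `ψ = f + g + vn`: the centered clipped part `f` is handled in `L²`, the clipped-off
  -- part `g` in `L¹`. The integral of `|g|` enters twice, through the time average of `g` and
  -- through `vn - v`, whence the factor `2`.
  set f : E → ℝ := fun x => clip n (ψ x) - vn with hf
  set g : E → ℝ := fun x => ψ x - clip n (ψ x) with hg
  have hfL : LipschitzWith K f := LipschitzWith.of_dist_le_mul fun x y => by
    simpa [f, Real.dist_eq] using hcl.abs_sub_le_mul_dist x y
  have hgL : LipschitzWith (K + K) g := hψ.sub hcl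
  have hf0 : ∫ z, f z ∂μs = 0 := by
    simp only [hf]
    rw [integral_sub hci (integrable_const _), integral_const, probReal_univ, one_smul, ← hvn,
      sub_self]
  have hfb : ∀ x, |f x| ≤ n + |vn| := fun x =>
    (abs_sub _ _).trans (add_le_add (abs_clip_le (Nat.cast_nonneg n) _) le_rfl)
  obtain ⟨B, hB⟩ := hX.isCenteredObservable_of_bounded hP hG hi hfL hf0 hfb
  have hgv : |vn - v| ≤ ∫ z, |g z| ∂μs := by
    rw [abs_sub_comm, hv, hvn, ← integral_sub hψi hci]
    exact abs_integral_le_integral_abs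
  set A := C * (K + K : ℝ≥0) * (∫ ω, (1 + dist (X 0 ω) x₀) ∂Pr) / γ with hA
  have hA0 : 0 ≤ A := by
    have := hG.const_pos
    have := hG.rate_pos
    have : 0 ≤ ∫ ω, (1 + dist (X 0 ω) x₀) ∂Pr := integral_nonneg fun ω => by positivity
    positivity
  refine ⟨C * K / γ * B + 1 + A, fun T hT => ?_⟩
  have hT0 : 0 < T := by linarith
  have hsT : 0 < √T := Real.sqrt_pos.2 hT0
  have hsq : √T * √T = T := Real.mul_self_sqrt hT0.le
  have h1T : 1 ≤ √T := Real.one_le_sqrt.2 hT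
  set S : Ω → ℝ := fun ω => ∫ s in (0 : ℝ)..T, f (X s.toNNReal ω) with hS
  set R : Ω → ℝ := fun ω => ∫ s in (0 : ℝ)..T, g (X s.toNNReal ω) with hR
  have hS2 := hB.integral_sq_integral_le hT0.le
  have hSi : Integrable (fun ω => S ω ^ 2) Pr := hB.isSquareBounded.integrable_sq_integral hT0.le
  obtain ⟨hRi, hRle⟩ := hX.integral_abs_integral_le hP hG hi hgL hT0.le
  have hbound : ∀ᵐ ω ∂Pr, |1 / T * additiveFunctional X ψ T ω - v| ≤
      1 / T * (S ω ^ 2 / (2 * √T) + √T / 2) + (1 / T * |R ω| + ∫ z, |g z| ∂μs) := by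
    filter_upwards [hX.ae_intervalIntegrable_of_lipschitz hP hG hi hfL,
      hX.ae_intervalIntegrable_of_lipschitz hP hG hi hgL] with ω h1 h2
    have e : additiveFunctional X ψ T ω = S ω + R ω + T * vn := by
      have e1 : ∀ s : ℝ, ψ (X s.toNNReal ω) = f (X s.toNNReal ω) + g (X s.toNNReal ω) + vn :=
        fun s => by simp only [hf, hg]; ring
      simp only [additiveFunctional, e1]
      rw [intervalIntegral.integral_add ((h1 T hT0.le).add (h2 T hT0.le)) intervalIntegrable_const,
        intervalIntegral.integral_add (h1 T hT0.le) (h2 T hT0.le), intervalIntegral.integral_const,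
        sub_zero, smul_eq_mul]
    have e2 : 1 / T * additiveFunctional X ψ T ω - v =
        1 / T * S ω + 1 / T * R ω + (vn - v) := by
      rw [e]; field_simp; ring
    -- The arithmetic–geometric mean inequality, balanced at the size `√T` of `S`, takes the place
    -- of Cauchy–Schwarz in `Ω`.
    have h3 : |S ω| ≤ S ω ^ 2 / (2 * √T) + √T / 2 := by
      have : S ω ^ 2 / (2 * √T) + √T / 2 - |S ω| = (|S ω| - √T) ^ 2 / (2 * √T) := by
        rw [← sq_abs (S ω)]; field_simp; ring
      have h4 : 0 ≤ (|S ω| - √T) ^ 2 / (2 * √T) := by positivity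
      linarith
    rw [e2]
    refine (abs_add_three _ _ _).trans ?_
    rw [abs_mul, abs_mul, abs_of_pos (by positivity : 0 < 1 / T)]
    have := mul_le_mul_of_nonneg_left h3 (by positivity : 0 ≤ 1 / T)
    linarith
  have j1 : Integrable (fun ω => 1 / T * (S ω ^ 2 / (2 * √T) + √T / 2)) Pr :=
    ((hSi.div_const _).add (integrable_const _)).const_mul _
  have j2 : Integrable (fun ω => 1 / T * |R ω| + ∫ z, |g z| ∂μs) Pr :=
    (hRi.abs.const_mul _).add (integrable_const _)
  have hm : AEStronglyMeasurable (fun ω => |1 / T * additiveFunctional X ψ T ω - v|) Pr := by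
    have := measurable_intervalIntegral (Y := fun (s : ℝ) ω => ψ (X s.toNNReal ω))
      (hψ.continuous.measurable.comp (hX.measurable.comp
      ((measurable_real_toNNReal.comp measurable_fst).prodMk measurable_snd))) 0 T
    exact (((this.const_mul (1 / T)).sub_const v).abs).aestronglyMeasurable
  have j0 : Integrable (fun ω => |1 / T * additiveFunctional X ψ T ω - v|) Pr :=
    (j1.add j2).mono' hm (hbound.mono fun ω h => by simpa using h)
  refine (integral_mono_ae j0 (j1.add j2) hbound).trans ?_
  simp only [Pi.add_apply]
  rw [integral_add j1 j2, integral_const_mul, integral_add (hSi.div_const _) (integrable_const _),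
    integral_add (hRi.abs.const_mul _) (integrable_const _), integral_const_mul, integral_div]
  simp only [integral_const, probReal_univ, one_smul]
  have k1 : 1 / T * ((∫ ω, S ω ^ 2 ∂Pr) / (2 * √T) + √T / 2) ≤ (C * K / γ * B + 1) / √T := by
    calc 1 / T * ((∫ ω, S ω ^ 2 ∂Pr) / (2 * √T) + √T / 2)
        ≤ 1 / T * ((2 * (C * K / γ * B) * T) / (2 * √T) + √T / 2) := by gcongr
      _ = (C * K / γ * B + 1 / 2) / √T := by
          have h5 : T = √T * √T := hsq.symm
          generalize √T = r at *
          subst h5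
          field_simp
      _ ≤ _ := by gcongr; norm_num
  have k2 : 1 / T * ∫ ω, |R ω| ∂Pr ≤ (∫ z, |g z| ∂μs) + A / √T := by
    calc 1 / T * ∫ ω, |R ω| ∂Pr ≤ 1 / T * (T * (∫ z, |g z| ∂μs) + A) := by gcongr
      _ = (∫ z, |g z| ∂μs) + A / T := by field_simp
      _ ≤ _ := by
          have : √T ≤ T := by nlinarith
          gcongr
  have k3 : (C * K / γ * B + 1 + A) / √T = (C * K / γ * B + 1) / √T + A / √T := by ring
  rw [k3]
  linarith

theorem IsMarkovProcess.tendstoInMeasure_average (hX : IsMarkovProcess P X Pr)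
    (hP : IsTransitionSemigroup P) (hG : SpectralGap P μs x₀ C γ)
    (hi : Integrable (fun ω => dist (X 0 ω) x₀) Pr) {K : ℝ≥0} {ψ : E → ℝ}
    (hψ : LipschitzWith K ψ) :
    TendstoInMeasure Pr (fun (T : ℝ) ω => 1 / T * additiveFunctional X ψ T ω) atTop
        (fun _ => ∫ x, ψ x ∂μs) := by
  have hp := hG.isP1.isProb
  have hψi := hG.isP1.integrable_of_lipschitz hψ
  have hm : ∀ T, Measurable fun ω => 1 / T * additiveFunctional X ψ T ω := fun T =>
    (measurable_intervalIntegral (Y := fun (s : ℝ) ω => ψ (X s.toNNReal ω))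
      (hψ.continuous.measurable.comp (hX.measurable.comp
      ((measurable_real_toNNReal.comp measurable_fst).prodMk measurable_snd))) 0 T).const_mul _
  have hclip : Tendsto (fun n : ℕ => 2 * ∫ z, |ψ z - clip n (ψ z)| ∂μs) atTop (𝓝 0) := by
    have h1 : Tendsto (fun n : ℕ => ∫ z, |ψ z - clip n (ψ z)| ∂μs) atTop (𝓝 (∫ _, 0 ∂μs)) := by
      refine tendsto_integral_of_dominated_convergence (fun z => 2 * |ψ z|) (fun n =>
        (hψ.continuous.sub (hψ.clip_comp n).continuous).abs.measurable.aestronglyMeasurable)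
        (hψi.abs.const_mul 2) (fun n => ae_of_all _ fun z => ?_) (ae_of_all _ fun z => ?_)
      · rw [Real.norm_eq_abs, abs_abs]
        have := abs_clip_le_abs (Nat.cast_nonneg n) (ψ z)
        linarith [abs_sub (ψ z) (clip n (ψ z))]
      · simpa using ((tendsto_const_nhds (x := ψ z)).sub (tendsto_clip (ψ z))).abs
    simpa using h1.const_mul 2
  have hL1 : Tendsto (fun T : ℝ => ∫ ω, |1 / T * additiveFunctional X ψ T ω - ∫ z, ψ z ∂μs| ∂Pr)
      atTop (𝓝 0) := by
    -- The clipping level `n` is fixed first, then `T` is sent to infinity, since `D` depends on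
    -- `n`.
    rw [Metric.tendsto_atTop']
    intro ε hε
    obtain ⟨n, hn⟩ := (hclip.eventually_lt_const (half_pos hε)).exists
    obtain ⟨D, hD⟩ := hX.exists_integral_abs_average_sub_le hP hG hi hψ n
    have hlim : Tendsto (fun T : ℝ => D / √T) atTop (𝓝 0) :=
      Real.tendsto_sqrt_atTop.const_div_atTop D
    obtain ⟨N, hN⟩ := eventually_atTop.1 ((hlim.eventually_lt_const (half_pos hε)).and
      (eventually_ge_atTop 1))
    refine ⟨N, fun T hT => ?_⟩
    rw [Real.dist_eq, sub_zero, abs_of_nonneg (integral_nonneg fun _ => abs_nonneg _)]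
    have := hD T (hN T hT.le).2
    linarith [(hN T hT.le).1]
  refine tendstoInMeasure_of_tendsto_eLpNorm (p := 1) one_ne_zero
    (fun T => (hm T).aestronglyMeasurable) aestronglyMeasurable_const ?_
  have h2 := (ENNReal.continuous_ofReal.tendsto 0).comp hL1
  rw [ENNReal.ofReal_zero] at h2
  refine h2.congr' ?_
  filter_upwards [eventually_ge_atTop 0] with T hT
  have hint : Integrable (fun ω => 1 / T * additiveFunctional X ψ T ω - ∫ z, ψ z ∂μs) Pr :=
    ((hX.integral_abs_integral_le hP hG hi hψ hT).1.const_mul _).sub (integrable_const _)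
  rw [eLpNorm_one_eq_lintegral_enorm]
  exact ofReal_integral_norm_eq_lintegral_enorm hint

end LawOfLargeNumbers

/-! ### Averaging of the quadratic observable. -/

/-- Clipping is inactive when `V ≤ n`; when `V > n` the error is at most `2 V² = 2 V^p / V^{p-2}`. A
moment of order `p > 2` thus makes truncation of a quadratic quantity uniformly small. -/
theorem abs_mul_sub_clip_mul_clip_le {a b V n p : ℝ} (hp : 2 < p) (hn : 0 < n) (ha : |a| ≤ V)
    (hb : |b| ≤ V) : |a * b - clip n a * clip n b| ≤ 2 * V ^ p / n ^ (p - 2) := by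
  have hV : 0 ≤ V := (abs_nonneg _).trans ha
  rcases le_or_gt V n with h | h
  · rw [clip_eq_self (ha.trans h), clip_eq_self (hb.trans h), sub_self, abs_zero]
    positivity
  · have hV0 : 0 < V := hn.trans h
    have h1 : |a * b - clip n a * clip n b| ≤ 2 * V ^ 2 := by
      refine (abs_sub _ _).trans ?_
      rw [abs_mul, abs_mul]
      have h2 := mul_le_mul ha hb (abs_nonneg _) hV
      have h3 := mul_le_mul ((abs_clip_le_abs hn.le a).trans ha)
        ((abs_clip_le_abs hn.le b).trans hb) (abs_nonneg _) hV
      nlinarith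
    refine h1.trans ?_
    rw [le_div_iff₀ (by positivity), mul_assoc]
    refine mul_le_mul_of_nonneg_left ?_ zero_le_two
    have h4 : V ^ p = V ^ 2 * V ^ (p - 2) := by
      rw [← Real.rpow_natCast V 2, ← Real.rpow_add hV0]; congr 1; push_cast; ring
    rw [h4]
    refine mul_le_mul_of_nonneg_left ?_ (by positivity)
    exact Real.rpow_le_rpow hn.le h.le (by linarith)

theorem LipschitzWith.clip_mul_clip {E : Type*} [MetricSpace E] {K L : ℝ≥0} {f g : E → ℝ}
    (hf : LipschitzWith K f) (hg : LipschitzWith L g) (n : ℝ≥0) :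
    LipschitzWith (n * K + n * L) fun x => clip n (f x) * clip n (g x) := by
  refine LipschitzWith.of_dist_le_mul fun x y => ?_
  rw [Real.dist_eq]
  have e : clip n (f x) * clip n (g x) - clip n (f y) * clip n (g y) =
      (clip n (f x) - clip n (f y)) * clip n (g x) +
        clip n (f y) * (clip n (g x) - clip n (g y)) := by ring
  rw [e]
  refine (abs_add_le _ _).trans ?_
  rw [abs_mul, abs_mul]
  have h1 := (hf.clip_comp n).abs_sub_le_mul_dist x y
  have h2 := (hg.clip_comp n).abs_sub_le_mul_dist x y
  have h3 := mul_le_mul h1 (abs_clip_le n.2 (g x)) (abs_nonneg _) (by positivity)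
  have h4 := mul_le_mul (abs_clip_le n.2 (f y)) h2 (abs_nonneg _) n.2
  push_cast
  simp only [NNReal.val_eq_coe] at h3 h4
  linarith

namespace IsCenteredObservable

variable {E Ω : Type*} [MetricSpace E] [SecondCountableTopology E] [MeasurableSpace E]
  [BorelSpace E] [MeasurableSpace Ω] {P : ℝ≥0 → Kernel E E} {X : ℝ≥0 → Ω → E} {Pr : Measure Ω}
  [IsProbabilityMeasure Pr] {μs : Measure E} {x₀ : E} {C γ : ℝ} {f : E → ℝ} {K : ℝ≥0} {B : ℝ}

theorem integrable_weight (h : IsCenteredObservable P X Pr μs x₀ C γ f K B) (t : ℝ≥0) :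
    Integrable (fun ω => 1 + dist (X t ω) x₀) Pr ∧ ∫ ω, (1 + dist (X t ω) x₀) ∂Pr ≤ B := by
  have hV : ∀ ω, 1 + dist (X t ω) x₀ ≤ (1 + dist (X t ω) x₀) * (1 + |f (X t ω)|) := fun ω =>
    le_mul_of_one_le_right (by positivity) (by linarith [abs_nonneg (f (X t ω))])
  have hVm : Measurable fun ω => 1 + dist (X t ω) x₀ :=
    measurable_const.add ((continuous_id.dist continuous_const).measurable.comp
      (h.markov.measurable_apply t))
  have hVi : Integrable (fun ω => 1 + dist (X t ω) x₀) Pr :=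
    (h.integrable_moment t).mono' hVm.aestronglyMeasurable (ae_of_all _ fun ω => by
      rw [Real.norm_of_nonneg (by positivity)]; exact hV ω)
  exact ⟨hVi, (integral_mono hVi (h.integrable_moment t) hV).trans (h.moment_le t)⟩

theorem integral_abs_le (h : IsCenteredObservable P X Pr μs x₀ C γ f K B) (t : ℝ≥0) :
    ∫ ω, |f (X t ω)| ∂Pr ≤ B := by
  have hi := (h.isSquareBounded.integrable (t : ℝ)).abs
  simp only [Real.toNNReal_coe] at hi
  refine (integral_mono hi (h.integrable_moment t) fun ω => ?_).trans (h.moment_le t)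
  have := abs_nonneg (f (X t ω))
  have := dist_nonneg (x := X t ω) (y := x₀)
  nlinarith

/-- Decorrelation of a bounded Lipschitz observable and a function of the additive functional. -/
theorem abs_integral_mul_comp_le (h : IsCenteredObservable P X Pr μs x₀ C γ f K B) {g : E → ℝ}
    {L : ℝ≥0} (hg : LipschitzWith L g) (hg0 : ∫ z, g z ∂μs = 0) {A : ℝ} (hA : ∀ x, |g x| ≤ A)
    {w : ℝ → ℝ} (hw : Continuous w) (hw1 : ∀ x, |w x| ≤ 1) {lam : ℝ}
    (hwL : ∀ x y, |w x - w y| ≤ lam * |x - y|) {u r : ℝ} (hr : 0 ≤ r) (hru : r ≤ u) :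
    |∫ ω, g (X u.toNNReal ω) * w (∫ s in (0 : ℝ)..u, f (X s.toNNReal ω)) ∂Pr| ≤
      A * lam * r * B + C * L * B * Real.exp (-γ * r) := by
  have hu : 0 ≤ u := hr.trans hru
  have hur : 0 ≤ u - r := by linarith
  have hA0 : 0 ≤ A := (abs_nonneg _).trans (hA x₀)
  have hlam : 0 ≤ lam := by
    have := (abs_nonneg _).trans (hwL 1 0)
    simpa using this
  have hB := h.bound_nonneg
  have hC := h.gap.const_pos
  set W : ℝ → Ω → ℝ := fun u ω => w (∫ s in (0 : ℝ)..u, f (X s.toNNReal ω)) with hW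
  have hWm : ∀ u, Measurable (W u) := fun u => h.measurable_comp_integral hw u
  have hgm : ∀ t, Measurable fun ω => g (X t ω) := fun t =>
    hg.continuous.measurable.comp (h.markov.measurable_apply t)
  have i1 : ∀ t u, Integrable (fun ω => g (X t ω) * W u ω) Pr := fun t u =>
    (integrable_const A).mono' ((hgm t).mul (hWm u)).aestronglyMeasurable (ae_of_all _ fun ω => by
      rw [Real.norm_eq_abs, abs_mul]
      exact (mul_le_of_le_one_right (abs_nonneg _) (hw1 _)).trans (hA _))
  -- The weight is moved back by a lag `r`. Its increment is at most `lam` times the integral of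
  -- `|f|` over the lag, and the earlier weight belongs to the past at `u - r`, where conditioning
  -- turns `g (X u)` into `P^r g`, of size `e^{-γr}`.
  have hsplit : ∫ ω, g (X u.toNNReal ω) * W u ω ∂Pr =
      (∫ ω, g (X u.toNNReal ω) * (W u ω - W (u - r) ω) ∂Pr) +
        ∫ ω, g (X u.toNNReal ω) * W (u - r) ω ∂Pr := by
    rw [← integral_add _ (i1 _ _)]
    · refine integral_congr_ae (ae_of_all _ fun ω => ?_)
      simp only; ring
    · simp only [mul_sub]
      exact (i1 _ _).sub (i1 _ _)
  have hincr : |∫ ω, g (X u.toNNReal ω) * (W u ω - W (u - r) ω) ∂Pr| ≤ A * lam * r * B := by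
    have j1 : Integrable (fun ω => ∫ s in (u - r)..u, |f (X s.toNNReal ω)|) Pr := by
      have := (h.isSquareBounded.abs.integrable_prod (u - r) u).integral_prod_right
      rw [Set.uIoc_of_le (by linarith)] at this
      simp only [intervalIntegral.integral_of_le (show u - r ≤ u by linarith)]
      exact this
    have hb : ∀ᵐ ω ∂Pr, |g (X u.toNNReal ω) * (W u ω - W (u - r) ω)| ≤
        A * lam * ∫ s in (u - r)..u, |f (X s.toNNReal ω)| := by
      filter_upwards [h.isSquareBounded.ae_intervalIntegrable] with ω hω
      rw [abs_mul, mul_assoc]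
      refine mul_le_mul (hA _) ((hwL _ _).trans ?_) (abs_nonneg _) hA0
      refine mul_le_mul_of_nonneg_left ?_ hlam
      rw [intervalIntegral.integral_interval_sub_left (hω u hu).1 (hω (u - r) hur).1]
      exact intervalIntegral.abs_integral_le_integral_abs (by linarith)
    have j2 : Integrable (fun ω => |g (X u.toNNReal ω) * (W u ω - W (u - r) ω)|) Pr := by
      simp only [mul_sub]
      exact ((i1 _ _).sub (i1 _ _)).abs
    refine abs_integral_le_integral_abs.trans ((integral_mono_ae j2 (j1.const_mul _) hb).trans ?_)
    rw [integral_const_mul, mul_assoc _ r]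
    refine mul_le_mul_of_nonneg_left ?_ (by positivity)
    rw [← intervalIntegral_integral_swap (h.isSquareBounded.abs.integrable_prod (u - r) u)]
    have := intervalIntegral.norm_integral_le_of_norm_le_const (a := u - r) (b := u) (C := B)
      (f := fun s => ∫ ω, |f (X s.toNNReal ω)| ∂Pr) (fun s _ => by
        rw [Real.norm_of_nonneg (integral_nonneg fun _ => abs_nonneg _)]
        exact h.integral_abs_le _)
    rw [sub_sub_cancel, abs_of_nonneg hr] at this
    rw [mul_comm r]
    exact (le_abs_self _).trans this
  have hpast : |∫ ω, g (X u.toNNReal ω) * W (u - r) ω ∂Pr| ≤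
      C * L * B * Real.exp (-γ * r) := by
    have hst : (u - r).toNNReal ≤ u.toNNReal := Real.toNNReal_le_toNNReal (by linarith)
    have e3 : u.toNNReal - (u - r).toNNReal = r.toNNReal := by
      rw [← NNReal.coe_inj, NNReal.coe_sub hst, Real.coe_toNNReal _ hu, Real.coe_toNNReal _ hur,
        Real.coe_toNNReal _ hr]
      ring
    have hVi := h.integrable_weight (u - r).toNNReal
    have hVW : Integrable (fun ω => (1 + dist (X (u - r).toNNReal ω) x₀) * W (u - r) ω) Pr :=
      hVi.1.mono' (hVi.1.aestronglyMeasurable.mul (hWm _).aestronglyMeasurable)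
        (ae_of_all _ fun ω => by
          rw [Real.norm_eq_abs, abs_mul, abs_of_nonneg (by positivity)]
          exact mul_le_of_le_one_right (by positivity) (hw1 _))
    rw [h.markov.integral_mul h.semigroup h.gap hst hg
      (h.aestronglyMeasurable_comp_integral hw hur) (i1 _ _) hVW, e3]
    have hle : ∀ ω, |(∫ z, g z ∂(P r.toNNReal (X (u - r).toNNReal ω))) * W (u - r) ω| ≤
        C * L * Real.exp (-γ * r) * (1 + dist (X (u - r).toNNReal ω) x₀) := fun ω => by
      have h1 := h.gap.abs_integral_le_of_centered hg hg0 hr (X (u - r).toNNReal ω)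
      rw [abs_mul]
      refine (mul_le_of_le_one_right (abs_nonneg _) (hw1 _)).trans (h1.trans (le_of_eq ?_))
      ring
    rw [← Real.norm_eq_abs]
    refine (norm_integral_le_of_norm_le (hVi.1.const_mul _) (ae_of_all _ hle)).trans ?_
    rw [integral_const_mul]
    calc C * L * Real.exp (-γ * r) * ∫ ω, (1 + dist (X (u - r).toNNReal ω) x₀) ∂Pr
        ≤ C * L * Real.exp (-γ * r) * B := by gcongr; exact hVi.2
      _ = _ := by ring
  change |∫ ω, g (X u.toNNReal ω) * W u ω ∂Pr| ≤ _
  rw [hsplit]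
  exact (abs_add_le _ _).trans (add_le_add hincr hpast)

/-- Averaging of the quadratic observable `f χ` along the process, uniformly against the
characters of the additive functional. -/
theorem exists_average_mul_potential (h : IsCenteredObservable P X Pr μs x₀ C γ f K B) {p : ℝ}
    (hp : 2 < p) {A : ℝ} (hV : ∀ t, Integrable (fun ω => (1 + dist (X t ω) x₀) ^ p) Pr)
    (hVA : ∀ t, ∫ ω, (1 + dist (X t ω) x₀) ^ p ∂Pr ≤ A) :
    ∃ m : ℝ, ∀ ε > (0 : ℝ), ∃ L : ℝ, 0 ≤ L ∧ ∀ u lam β : ℝ, 0 ≤ u →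
      |(∫ ω, f (X u.toNNReal ω) * potential P f (X u.toNNReal ω) *
          Real.cos (lam * (∫ s in (0 : ℝ)..u, f (X s.toNNReal ω)) + β) ∂Pr) -
        m * ∫ ω, Real.cos (lam * (∫ s in (0 : ℝ)..u, f (X s.toNNReal ω)) + β) ∂Pr| ≤
      ε + L * (|lam| + Real.exp (-γ * u)) := by
  have hμp := h.gap.isP1.isProb
  have hC := h.gap.const_pos
  have hγ := h.gap.rate_pos
  have hB := h.bound_nonneg
  have hχL := h.gap.lipschitzWith_potential h.lipschitz h.centered
  set χ := potential P f with hχ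
  set M : ℝ := C * K + C * K / γ with hM
  have hM0 : 0 ≤ M := by positivity
  have hfM : ∀ x, |f x| ≤ M * (1 + dist x x₀) := fun x =>
    (h.gap.abs_le h.semigroup h.lipschitz h.centered x).trans (by
      gcongr; rw [hM]; linarith [show 0 ≤ C * K / γ by positivity])
  have hχM : ∀ x, |χ x| ≤ M * (1 + dist x x₀) := fun x =>
    (h.gap.abs_potential_le h.lipschitz h.centered x).trans (by
      gcongr; rw [hM]; linarith [show 0 ≤ C * K by positivity])
  -- The shift by one keeps the clipping level positive, since `e n` divides by a power of it.
  set N : ℕ → ℝ≥0 := fun n => n + 1 with hN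
  have hNpos : ∀ n, (0 : ℝ) < N n := fun n => by simp only [hN]; positivity
  set q : ℕ → E → ℝ := fun n x => clip (N n) (f x) * clip (N n) (χ x) with hq
  have hqL := fun n => h.lipschitz.clip_mul_clip hχL (N n)
  have hqb : ∀ n x, |q n x| ≤ N n * N n := fun n x => by
    simp only [hq, abs_mul]
    exact mul_le_mul (abs_clip_le (hNpos n).le _) (abs_clip_le (hNpos n).le _) (abs_nonneg _)
      (hNpos n).le
  set e : ℕ → ℝ := fun n => 2 * M ^ p * A / (N n : ℝ) ^ (p - 2) with he
  have hA0 : 0 ≤ A := (integral_nonneg fun ω => by positivity).trans (hVA 0)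
  have he0 : ∀ n, 0 ≤ e n := fun n => by have := hNpos n; positivity
  have helim : Tendsto e atTop (𝓝 0) := by
    refine Tendsto.const_div_atTop ?_ _
    refine (tendsto_rpow_atTop (by linarith : 0 < p - 2)).comp ?_
    simp only [hN, NNReal.coe_add, NNReal.coe_natCast, NNReal.coe_one]
    exact tendsto_atTop_add_const_right _ _ tendsto_natCast_atTop_atTop
  have heanti : ∀ n k, n ≤ k → e k ≤ e n := fun n k hnk => by
    simp only [he]
    have h1 := hNpos n
    have h2 : (N n : ℝ) ≤ N k := by simp only [hN]; push_cast; exact_mod_cast Nat.succ_le_succ hnk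
    refine div_le_div_of_nonneg_left (by positivity) (by positivity) ?_
    exact Real.rpow_le_rpow h1.le h2 (by linarith)
  have hqi : ∀ n t (W : Ω → ℝ), Measurable W → (∀ ω, |W ω| ≤ 1) →
      Integrable (fun ω => q n (X t ω) * W ω) Pr := fun n t W hWm hW1 =>
    (integrable_const ((N n : ℝ) * N n)).mono' ((((hqL n).continuous.measurable.comp
      (h.markov.measurable_apply t))).mul hWm).aestronglyMeasurable (ae_of_all _ fun ω => by
      rw [Real.norm_eq_abs, abs_mul]
      exact (mul_le_of_le_one_right (abs_nonneg _) (hW1 _)).trans (hqb _ _))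
  have hqq : ∀ n t (W : Ω → ℝ), Measurable W → (∀ ω, |W ω| ≤ 1) →
      |(∫ ω, f (X t ω) * χ (X t ω) * W ω ∂Pr) - ∫ ω, q n (X t ω) * W ω ∂Pr| ≤ e n := by
    intro n t W hWm hW1
    have j1 := (h.integrable_mul_and_integral_abs_le h.measurable_potential
      (h.gap.abs_potential_le h.lipschitz h.centered) hWm.aestronglyMeasurable hW1 t).1
    rw [← integral_sub j1 (hqi n t W hWm hW1), ← Real.norm_eq_abs]
    have hle : ∀ ω, ‖f (X t ω) * χ (X t ω) * W ω - q n (X t ω) * W ω‖ ≤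
        2 * M ^ p / (N n : ℝ) ^ (p - 2) * (1 + dist (X t ω) x₀) ^ p := fun ω => by
      rw [← sub_mul, Real.norm_eq_abs, abs_mul]
      refine (mul_le_of_le_one_right (abs_nonneg _) (hW1 _)).trans
        ((abs_mul_sub_clip_mul_clip_le hp (hNpos n) (hfM _) (hχM _)).trans (le_of_eq ?_))
      rw [Real.mul_rpow hM0 (by positivity)]
      ring
    refine (norm_integral_le_of_norm_le ((hV t).const_mul _) (ae_of_all _ hle)).trans ?_
    rw [integral_const_mul]
    have := hNpos n
    calc 2 * M ^ p / (N n : ℝ) ^ (p - 2) * ∫ ω, (1 + dist (X t ω) x₀) ^ p ∂Pr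
        ≤ 2 * M ^ p / (N n : ℝ) ^ (p - 2) * A := by gcongr; exact hVA t
      _ = e n := by simp only [he]; ring
  have hdi : Integrable (fun ω => dist (X 0 ω) x₀) Pr := by
    refine ((h.integrable_weight 0).1.sub (integrable_const (1 : ℝ))).congr
      (ae_of_all _ fun ω => ?_)
    simp
  set mn : ℕ → ℝ := fun n => ∫ z, q n z ∂μs with hmn
  -- `mn n` is recovered as a limit of expectations along the process, so that the moment bound on
  -- `X` alone shows that `mn` is Cauchy; no moment of `μs` beyond the first is required.
  have hlim : ∀ n, Tendsto (fun k : ℕ => ∫ ω, q n (X k ω) * (1 : ℝ) ∂Pr) atTop (𝓝 (mn n)) := by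
    intro n
    rw [tendsto_iff_norm_sub_tendsto_zero]
    refine squeeze_zero (fun _ => norm_nonneg _) (fun k => ?_)
      (((tendsto_exp_neg_mul_nat hγ).const_mul
        (C * (N n * K + N n * (C * K / γ).toNNReal : ℝ≥0))).mul_const
        (∫ ω, (1 + dist (X 0 ω) x₀) ∂Pr) |>.trans (by simp))
    simp only [mul_one]
    exact (h.markov.abs_integral_sub_le h.semigroup h.gap hdi k (hqL n)).2
  have hmm : ∀ n k, |mn n - mn k| ≤ e n + e k := by
    intro n k
    refine le_of_tendsto (((hlim n).sub (hlim k)).abs) (Eventually.of_forall fun j => ?_)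
    have h1 := hqq n j (fun _ => 1) measurable_const (fun _ => by simp)
    have h2 := hqq k j (fun _ => 1) measurable_const (fun _ => by simp)
    rw [abs_sub_comm] at h1
    exact (abs_sub_le _ _ _).trans (add_le_add h1 h2)
  obtain ⟨m, hm⟩ := cauchySeq_tendsto_of_complete (cauchySeq_of_le_tendsto_0 (fun n => e n + e n)
    (fun n k j hn hk => by
      rw [Real.dist_eq]
      exact (hmm n k).trans (add_le_add (heanti _ _ hn) (heanti _ _ hk)))
    (by simpa using helim.add helim) : CauchySeq mn)
  have hmnm : ∀ n, |mn n - m| ≤ 2 * e n := by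
    intro n
    refine le_of_tendsto (((tendsto_const_nhds (x := mn n)).sub hm).abs) ?_
    filter_upwards [eventually_ge_atTop n] with k hk
    linarith [hmm n k, heanti n k hk]
  refine ⟨m, fun ε hε => ?_⟩
  -- Truncation is paid three times, once in `k1` and twice in `k5`; the remaining `ε / 2` pays for
  -- the lag `r₀`.
  obtain ⟨n, hn⟩ := (helim.eventually_lt_const (show 0 < ε / 6 by positivity)).exists
  set L0 : ℝ≥0 := N n * K + N n * (C * K / γ).toNNReal with hL0
  obtain ⟨r₀, hr₀0, hr₀⟩ : ∃ r₀ : ℝ, 0 ≤ r₀ ∧ C * L0 * B * Real.exp (-γ * r₀) ≤ ε / 2 := by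
    have := (tendsto_exp_neg_mul_nat hγ).const_mul (C * L0 * B)
    rw [mul_zero] at this
    obtain ⟨k, hk⟩ := (this.eventually_lt_const (half_pos hε)).exists
    exact ⟨((k : ℝ≥0) : ℝ), NNReal.coe_nonneg _, hk.le⟩
  set A0 : ℝ := (N n : ℝ) * N n + |mn n| with hA0def
  have hA00 : 0 ≤ A0 := by positivity
  refine ⟨A0 * r₀ * B + C * L0 * B, by positivity, fun u lam β hu => ?_⟩
  set w : ℝ → ℝ := fun x => Real.cos (lam * x + β) with hw
  have hwc : Continuous w := by fun_prop
  have hw1 : ∀ x, |w x| ≤ 1 := fun x => Real.abs_cos_le_one _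
  have hwL : ∀ x y, |w x - w y| ≤ |lam| * |x - y| := fun x y => by
    have h1 : |Real.cos (lam * x + β) - Real.cos (lam * y + β)| ≤
        |lam * x + β - (lam * y + β)| := Real.abs_cos_sub_cos_le _ _
    refine h1.trans (le_of_eq ?_)
    rw [← abs_mul]; congr 1; ring
  set W : Ω → ℝ := fun ω => w (∫ s in (0 : ℝ)..u, f (X s.toNNReal ω)) with hW
  have hWm : Measurable W := h.measurable_comp_integral hwc u
  have hWi : Integrable W Pr := (integrable_const (1 : ℝ)).mono' hWm.aestronglyMeasurable
    (ae_of_all _ fun ω => hw1 _)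
  set g : E → ℝ := fun x => q n x - mn n with hg
  have hgL : LipschitzWith L0 g := LipschitzWith.of_dist_le_mul fun x y => by
    rw [Real.dist_eq, show g x - g y = q n x - q n y by simp only [hg]; ring]
    exact (hqL n).abs_sub_le_mul_dist x y
  have hg0 : ∫ z, g z ∂μs = 0 := by
    simp only [hg]
    rw [integral_sub (h.gap.isP1.integrable_of_lipschitz (hqL n)) (integrable_const _),
      integral_const, probReal_univ, one_smul, sub_self]
  have hgA : ∀ x, |g x| ≤ A0 := fun x =>
    (abs_sub _ _).trans (add_le_add (hqb _ _) le_rfl)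
  have k1 := hqq n u.toNNReal W hWm (fun ω => hw1 _)
  -- The lag may not exceed `u`. For `u < r₀` the lag is `u` itself, and this is the origin of the
  -- term `exp (-γ * u)` in the bound.
  have k2 := h.abs_integral_mul_comp_le hgL hg0 hgA hwc hw1 hwL (le_min hu hr₀0)
    (min_le_left u r₀)
  change |∫ ω, g (X u.toNNReal ω) * W ω ∂Pr| ≤ _ at k2
  have k3 : ∫ ω, g (X u.toNNReal ω) * W ω ∂Pr =
      (∫ ω, q n (X u.toNNReal ω) * W ω ∂Pr) - mn n * ∫ ω, W ω ∂Pr := by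
    rw [← integral_const_mul, ← integral_sub (hqi n _ W hWm fun ω => hw1 _) (hWi.const_mul _)]
    simp only [hg, sub_mul]
  have k4 : |∫ ω, W ω ∂Pr| ≤ 1 := by
    simpa using norm_integral_le_of_norm_le_const (μ := Pr) (f := W) (C := 1)
      (ae_of_all _ fun ω => hw1 _)
  have k5 : |mn n * (∫ ω, W ω ∂Pr) - m * ∫ ω, W ω ∂Pr| ≤ 2 * e n := by
    rw [← sub_mul, abs_mul]
    exact (mul_le_of_le_one_right (abs_nonneg _) k4).trans (hmnm n)
  have k6 : Real.exp (-γ * min u r₀) ≤ Real.exp (-γ * r₀) + Real.exp (-γ * u) := by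
    rcases min_choice u r₀ with h1 | h1 <;> rw [h1]
    · linarith [Real.exp_pos (-γ * r₀)]
    · linarith [Real.exp_pos (-γ * u)]
  have k7 : A0 * |lam| * min u r₀ * B ≤ A0 * r₀ * B * |lam| := by
    calc A0 * |lam| * min u r₀ * B ≤ A0 * |lam| * r₀ * B := by gcongr; exact min_le_right _ _
      _ = _ := by ring
  have k8 : C * L0 * B * Real.exp (-γ * min u r₀) ≤
      C * L0 * B * Real.exp (-γ * r₀) + C * L0 * B * Real.exp (-γ * u) := by
    rw [← mul_add]; gcongr
  have k9 : 0 ≤ A0 * r₀ * B * Real.exp (-γ * u) := by positivity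
  have k10 : 0 ≤ C * L0 * B * |lam| := by positivity
  change |(∫ ω, f (X u.toNNReal ω) * χ (X u.toNNReal ω) * W ω ∂Pr) - m * ∫ ω, W ω ∂Pr| ≤ _
  rw [k3] at k2
  have k11 := (abs_sub_le (∫ ω, f (X u.toNNReal ω) * χ (X u.toNNReal ω) * W ω ∂Pr)
    (∫ ω, q n (X u.toNNReal ω) * W ω ∂Pr) (m * ∫ ω, W ω ∂Pr)).trans (add_le_add k1
    ((abs_sub_le _ (mn n * ∫ ω, W ω ∂Pr) _).trans (add_le_add k2 k5)))
  refine k11.trans ?_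
  have k12 : (A0 * r₀ * B + C * L0 * B) * (|lam| + Real.exp (-γ * u)) =
      A0 * r₀ * B * |lam| + A0 * r₀ * B * Real.exp (-γ * u) + C * L0 * B * |lam| +
        C * L0 * B * Real.exp (-γ * u) := by ring
  rw [k12]
  linarith

end IsCenteredObservable

/-! ### Asymptotic variance and limit of the trigonometric moments. -/

theorem tendsto_of_forall_abs_sub_le {F : ℝ → ℝ} {l M : ℝ} (hM : 0 ≤ M)
    (h : ∀ ε > (0 : ℝ), ∃ g : ℝ → ℝ, Tendsto g atTop (𝓝 0) ∧
      ∀ᶠ T in atTop, |F T - l| ≤ M * ε + g T) : Tendsto F atTop (𝓝 l) := by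
  rw [Metric.tendsto_nhds]
  intro ε hε
  obtain ⟨g, hg, hb⟩ := h (ε / (2 * (M + 1))) (by positivity)
  filter_upwards [hb, hg.eventually_lt_const (half_pos hε)] with T h1 h2
  have h3 : M * (ε / (2 * (M + 1))) ≤ ε / 2 := by
    rw [mul_div_assoc', div_le_div_iff₀ (by positivity) (by positivity)]
    nlinarith
  rw [Real.dist_eq]
  linarith

/-- A perturbed linear integral equation with rate `κ ≥ 0`. -/
theorem abs_sub_exp_le_of_integral_equation {a : ℝ → ℝ} (ha : Continuous a) {c κ η T : ℝ}
    (hκ : 0 ≤ κ) (hT : 0 ≤ T)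
    (h : ∀ t ∈ Set.Icc 0 T, |a t - c + κ * ∫ s in (0 : ℝ)..t, a s| ≤ η) :
    |a T - c * Real.exp (-κ * T)| ≤ η * Real.exp (κ * T) := by
  set e : ℝ → ℝ := fun t => a t - c * Real.exp (-κ * t) with he
  have hec : Continuous e := by fun_prop
  have hexp : ∀ t : ℝ, κ * ∫ s in (0 : ℝ)..t, c * Real.exp (-κ * s) =
      c - c * Real.exp (-κ * t) := by
    intro t
    rw [← intervalIntegral.integral_const_mul,
      intervalIntegral.integral_eq_sub_of_hasDerivAt (f := fun s => -(c * Real.exp (-κ * s)))]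
    · simp; ring
    · intro s _
      have h1 : HasDerivAt (fun s : ℝ => -κ * s) (-κ) s := by
        simpa using (hasDerivAt_id s).const_mul (-κ)
      have := (h1.exp.const_mul c).neg
      convert! this using 1
      ring
    · exact (by fun_prop : Continuous fun s => κ * (c * Real.exp (-κ * s))).intervalIntegrable _ _
  have hJ : ∀ t, κ * ∫ s in (0 : ℝ)..t, e s =
      κ * (∫ s in (0 : ℝ)..t, a s) - (c - c * Real.exp (-κ * t)) := by
    intro t
    rw [← hexp t, ← mul_sub, ← intervalIntegral.integral_sub (ha.intervalIntegrable _ _)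
      ((by fun_prop : Continuous fun s => c * Real.exp (-κ * s)).intervalIntegrable _ _)]
  have hb : ∀ t ∈ Set.Icc 0 T, |e t + κ * ∫ s in (0 : ℝ)..t, e s| ≤ η := by
    intro t ht
    rw [hJ t]
    convert h t ht using 2
    simp only [he]; ring
  have hb' : ∀ t ∈ Set.Icc 0 T, |e t| ≤ κ * |∫ s in (0 : ℝ)..t, e s| + η := by
    intro t ht
    have h1 := abs_sub (e t + κ * ∫ s in (0 : ℝ)..t, e s) (κ * ∫ s in (0 : ℝ)..t, e s)
    rw [add_sub_cancel_right, abs_mul κ, abs_of_nonneg hκ] at h1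
    linarith [hb t ht]
  have hd : ∀ t, HasDerivAt (fun t => ∫ s in (0 : ℝ)..t, e s) (e t) t := fun t =>
    hec.integral_hasStrictDerivAt 0 t |>.hasDerivAt
  -- Gronwall's lemma is applied to the primitive of `e`: its derivative is `e`, and `hb'` bounds
  -- `e` by the primitive. No differentiability of `a` is needed.
  have hG := norm_le_gronwallBound_of_norm_deriv_right_le
    (f := fun t => ∫ s in (0 : ℝ)..t, e s) (f' := e) (δ := 0) (K := κ) (ε := η) (a := 0) (b := T)
    (fun t _ => (hd t).continuousAt.continuousWithinAt) (fun t _ => (hd t).hasDerivWithinAt)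
    (by simp) (fun t ht => hb' t ⟨ht.1, ht.2.le⟩) T ⟨hT, le_rfl⟩
  have h2 := hb' T ⟨hT, le_rfl⟩
  -- The closed form of the Gronwall bound divides by `κ`; for `κ = 0` the hypothesis at `t = T`
  -- already is the claim.
  rcases hκ.eq_or_lt with h0 | h0
  · rw [← h0] at h2 ⊢
    simpa [he, ← h0] using h2
  · rw [gronwallBound_of_K_ne_0 h0.ne', Real.norm_eq_abs, sub_zero] at hG
    simp only [zero_mul, zero_add] at hG
    refine h2.trans ?_
    calc κ * |∫ s in (0 : ℝ)..T, e s| + η ≤ κ * (η / κ * (Real.exp (κ * T) - 1)) + η := by gcongr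
      _ = _ := by field_simp; ring

namespace IsCenteredObservable

variable {E Ω : Type*} [MetricSpace E] [SecondCountableTopology E] [MeasurableSpace E]
  [BorelSpace E] [MeasurableSpace Ω] {P : ℝ≥0 → Kernel E E} {X : ℝ≥0 → Ω → E} {Pr : Measure Ω}
  [IsProbabilityMeasure Pr] {μs : Measure E} {x₀ : E} {C γ : ℝ} {f : E → ℝ} {K : ℝ≥0} {B : ℝ}

theorem ae_continuous_integral (h : IsCenteredObservable P X Pr μs x₀ C γ f K B) :
    ∀ᵐ ω ∂Pr, Continuous fun t : ℝ => ∫ s in (0 : ℝ)..t, f (X s.toNNReal ω) := by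
  filter_upwards [h.isSquareBounded.ae_intervalIntegrable] with ω hω
  have h0 : ∀ t : ℝ, IntervalIntegrable (fun s : ℝ => f (X s.toNNReal ω)) volume 0 t := by
    intro t
    rcases le_total 0 t with ht | ht
    · exact (hω t ht).1
    -- At negative times `toNNReal` freezes the process at `X 0`.
    · refine (intervalIntegrable_const (c := f (X 0 ω))).congr fun s hs => ?_
      rw [Set.uIoc_of_ge ht] at hs
      simp only [Real.toNNReal_of_nonpos hs.2]
  exact intervalIntegral.continuous_primitive (fun a b => (h0 a).symm.trans (h0 b)) 0

theorem continuous_integral_cos (h : IsCenteredObservable P X Pr μs x₀ C γ f K B) (lam β : ℝ) :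
    Continuous fun t : ℝ =>
      ∫ ω, Real.cos (lam * (∫ s in (0 : ℝ)..t, f (X s.toNNReal ω)) + β) ∂Pr := by
  have hw : Continuous fun x => Real.cos (lam * x + β) := by fun_prop
  refine continuous_of_dominated (bound := fun _ => 1)
    (fun t => (h.measurable_comp_integral hw t).aestronglyMeasurable)
    (fun t => ae_of_all _ fun ω => Real.abs_cos_le_one _) (integrable_const _) ?_
  filter_upwards [h.ae_continuous_integral] with ω hω
  exact hw.comp hω

/-- The averaging estimate, integrated over `u` in `key`, serves twice: with `lam = β = 0` it gives
the variance, and with `lam = θ / √T` it turns `abs_integral_cos_sub_le` into a perturbed linear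
equation with rate `lam ^ 2 * m`. -/
theorem exists_asymptotic_variance (h : IsCenteredObservable P X Pr μs x₀ C γ f K B) {p : ℝ}
    (hp : 2 < p) {A : ℝ} (hV : ∀ t, Integrable (fun ω => (1 + dist (X t ω) x₀) ^ p) Pr)
    (hVA : ∀ t, ∫ ω, (1 + dist (X t ω) x₀) ^ p ∂Pr ≤ A) :
    ∃ m : ℝ, 0 ≤ m ∧
      Tendsto (fun T : ℝ => 1 / T * ∫ ω, (∫ s in (0 : ℝ)..T, f (X s.toNNReal ω)) ^ 2 ∂Pr) atTop
        (𝓝 (2 * m)) ∧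
      ∀ θ β : ℝ, Tendsto (fun T : ℝ =>
        ∫ ω, Real.cos (θ / √T * (∫ s in (0 : ℝ)..T, f (X s.toNNReal ω)) + β) ∂Pr) atTop
        (𝓝 (Real.cos β * Real.exp (-(θ ^ 2 * m)))) := by
  obtain ⟨m, hm⟩ := h.exists_average_mul_potential hp hV hVA
  have hγ := h.gap.rate_pos
  have hCK : 0 ≤ C * K := mul_nonneg h.gap.const_pos.le K.2
  have hB := h.bound_nonneg
  have key : ∀ ε > (0 : ℝ), ∃ L : ℝ, 0 ≤ L ∧ ∀ T lam β : ℝ, 0 ≤ T →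
      |(∫ u in (0 : ℝ)..T, ∫ ω, f (X u.toNNReal ω) * potential P f (X u.toNNReal ω) *
          Real.cos (lam * (∫ s in (0 : ℝ)..u, f (X s.toNNReal ω)) + β) ∂Pr) -
        m * ∫ u in (0 : ℝ)..T,
          ∫ ω, Real.cos (lam * (∫ s in (0 : ℝ)..u, f (X s.toNNReal ω)) + β) ∂Pr| ≤
      (ε + L * |lam|) * T + L / γ := by
    intro ε hε
    obtain ⟨L, hL, hb⟩ := hm ε hε
    refine ⟨L, hL, fun T lam β hT => ?_⟩
    have hw : Continuous fun x => Real.cos (lam * x + β) := by fun_prop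
    have hei : IntervalIntegrable (fun u => L * Real.exp (-γ * u)) volume 0 T :=
      (by fun_prop : Continuous fun u => L * Real.exp (-γ * u)).intervalIntegrable _ _
    rw [← intervalIntegral.integral_const_mul, ← intervalIntegral.integral_sub
      (h.intervalIntegrable_integral_mul_potential hw (fun x => Real.abs_cos_le_one _) 0 T)
      (((h.continuous_integral_cos lam β).intervalIntegrable 0 T).const_mul m),
      ← Real.norm_eq_abs]
    refine (intervalIntegral.norm_integral_le_of_norm_le hT
      (g := fun u => (ε + L * |lam|) + L * Real.exp (-γ * u))
      (ae_of_all _ fun u hu => ?_) (intervalIntegrable_const.add hei)).trans ?_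
    · refine (hb u lam β hu.1.le).trans (le_of_eq ?_)
      ring
    · rw [intervalIntegral.integral_add intervalIntegrable_const hei,
        intervalIntegral.integral_const, intervalIntegral.integral_const_mul, sub_zero, smul_eq_mul,
        mul_comm T, div_eq_mul_one_div L]
      gcongr
      exact integral_exp_neg_mul_le hγ hT
  set D : ℝ := C * K / γ * B with hD
  have hvar : Tendsto (fun T : ℝ => 1 / T *
      ∫ ω, (∫ s in (0 : ℝ)..T, f (X s.toNNReal ω)) ^ 2 ∂Pr) atTop (𝓝 (2 * m)) := by
    refine tendsto_of_forall_abs_sub_le zero_le_two fun ε hε => ?_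
    obtain ⟨L, hL, hb⟩ := key ε hε
    refine ⟨fun T => (2 * (D / γ) + 2 * (L / γ)) / T, tendsto_const_nhds.div_atTop tendsto_id, ?_⟩
    filter_upwards [eventually_gt_atTop 0] with T hT
    have h1 := h.abs_integral_sq_integral_sub_le hT.le
    have h2 := hb T 0 0 hT.le
    simp only [mul_one, zero_mul, add_zero, Real.cos_zero, abs_zero, mul_zero, integral_const,
      probReal_univ, intervalIntegral.integral_const, sub_zero, smul_eq_mul] at h1 h2
    rw [← hD] at h1
    set Q := ∫ u in (0 : ℝ)..T, ∫ ω, f (X u.toNNReal ω) * potential P f (X u.toNNReal ω) ∂Pr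
    set V := ∫ ω, (∫ s in (0 : ℝ)..T, f (X s.toNNReal ω)) ^ 2 ∂Pr
    have h3 : |V - 2 * m * T| ≤ 2 * (D / γ) + 2 * (ε * T + L / γ) := by
      rw [abs_le] at *
      constructor <;> linarith [h1.1, h1.2, h2.1, h2.2]
    have h4 : 1 / T * V - 2 * m = (V - 2 * m * T) / T := by field_simp
    rw [h4, abs_div, abs_of_pos hT, div_le_iff₀ hT]
    refine h3.trans (le_of_eq ?_)
    field_simp
    ring
  have hm0 : 0 ≤ m := by
    have : 0 ≤ 2 * m := ge_of_tendsto hvar (by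
      filter_upwards [eventually_gt_atTop 0] with T hT
      have : 0 ≤ ∫ ω, (∫ s in (0 : ℝ)..T, f (X s.toNNReal ω)) ^ 2 ∂Pr :=
        integral_nonneg fun ω => sq_nonneg _
      positivity)
    linarith
  refine ⟨m, hm0, hvar, fun θ β => ?_⟩
  refine tendsto_of_forall_abs_sub_le (M := θ ^ 2 * Real.exp (θ ^ 2 * m)) (by positivity)
    fun ε hε => ?_
  obtain ⟨L, hL, hb⟩ := key ε hε
  have hs : Tendsto (fun T : ℝ => θ / √T) atTop (𝓝 0) :=
    tendsto_const_nhds.div_atTop Real.tendsto_sqrt_atTop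
  refine ⟨fun T => (|θ / √T| * D + (θ / √T) ^ 2 * (D / γ) + θ ^ 2 * (L * |θ / √T|) +
    (θ / √T) ^ 2 * (L / γ)) * Real.exp (θ ^ 2 * m), ?_, ?_⟩
  · have h1 := hs.abs
    have h2 := hs.pow 2
    have := ((((h1.mul_const D).add (h2.mul_const (D / γ))).add
      ((h1.const_mul L).const_mul (θ ^ 2))).add (h2.mul_const (L / γ))).mul_const
        (Real.exp (θ ^ 2 * m))
    simpa using this
  · filter_upwards [eventually_gt_atTop 0] with T hT
    set lam : ℝ := θ / √T with hlam
    have hlT : lam ^ 2 * T = θ ^ 2 := by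
      rw [hlam, div_pow, Real.sq_sqrt hT.le]; field_simp
    -- Since `lam ^ 2 * T = θ ^ 2`, the perturbation is `θ ^ 2 * ε` plus terms that vanish as `T →
    -- ∞`, while the Gronwall factor `exp (lam ^ 2 * m * T)` stays equal to `exp (θ ^ 2 * m)`.
    have hbd : ∀ t ∈ Set.Icc 0 T,
        |(∫ ω, Real.cos (lam * (∫ s in (0 : ℝ)..t, f (X s.toNNReal ω)) + β) ∂Pr) - Real.cos β +
          lam ^ 2 * m * ∫ u in (0 : ℝ)..t,
            ∫ ω, Real.cos (lam * (∫ s in (0 : ℝ)..u, f (X s.toNNReal ω)) + β) ∂Pr| ≤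
        |lam| * D + lam ^ 2 * (D / γ) + lam ^ 2 * ((ε + L * |lam|) * T + L / γ) := by
      intro t ht
      have h1 := h.abs_integral_cos_sub_le ht.1 lam β
      have h2 := hb t lam β ht.1
      rw [← hD] at h1
      have h3 : (ε + L * |lam|) * t + L / γ ≤ (ε + L * |lam|) * T + L / γ := by
        gcongr; exact ht.2
      have h4 := mul_le_mul_of_nonneg_left (h2.trans h3) (sq_nonneg lam)
      rw [← abs_of_nonneg (sq_nonneg lam), ← abs_mul, abs_of_nonneg (sq_nonneg lam)] at h4
      have h5 := (abs_sub _ _).trans (add_le_add h1 h4)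
      refine le_trans (le_of_eq ?_) h5
      congr 1
      ring
    have h1 := abs_sub_exp_le_of_integral_equation (h.continuous_integral_cos lam β)
      (κ := lam ^ 2 * m) (by positivity) hT.le hbd
    have e1 : lam ^ 2 * m * T = θ ^ 2 * m := by rw [← hlT]; ring
    rw [neg_mul, e1] at h1
    refine h1.trans (le_of_eq ?_)
    rw [← hlT]
    ring

theorem measurable_integral (h : IsCenteredObservable P X Pr μs x₀ C γ f K B) (T : ℝ) :
    Measurable fun ω => ∫ s in (0 : ℝ)..T, f (X s.toNNReal ω) :=
  measurable_intervalIntegral h.isSquareBounded.measurable 0 T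

end IsCenteredObservable

/-! ### From trigonometric moments to distribution functions. -/

/-- The sine is written as a cosine with phase `-π / 2`, so that real cosine moments determine the
characteristic function. -/
theorem charFun_map_eq {Ω : Type*} [MeasurableSpace Ω] {Pr : Measure Ω} [IsFiniteMeasure Pr]
    {Y : Ω → ℝ} (hY : Measurable Y) (t : ℝ) :
    charFun (Pr.map Y) t = ((∫ ω, Real.cos (t * Y ω) ∂Pr : ℝ) : ℂ) +
      ((∫ ω, Real.cos (t * Y ω + -(Real.pi / 2)) ∂Pr : ℝ) : ℂ) * Complex.I := by
  rw [charFun_apply_real, integral_map hY.aemeasurable (by fun_prop)]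
  have i1 : Integrable (fun ω => (Real.cos (t * Y ω) : ℂ)) Pr :=
    (integrable_const (1 : ℝ)).mono' (by fun_prop) (ae_of_all _ fun ω => by
      rw [Complex.norm_real]; exact Real.abs_cos_le_one _)
  have i2 : Integrable (fun ω => (Real.cos (t * Y ω + -(Real.pi / 2)) : ℂ)) Pr :=
    (integrable_const (1 : ℝ)).mono' (by fun_prop) (ae_of_all _ fun ω => by
      rw [Complex.norm_real]; exact Real.abs_cos_le_one _)
  rw [← integral_complex_ofReal, ← integral_complex_ofReal, ← integral_mul_const,
    ← integral_add i1 (i2.mul_const _)]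
  refine integral_congr_ae (ae_of_all _ fun ω => ?_)
  simp only [← sub_eq_add_neg, Real.cos_sub_pi_div_two]
  rw [← Complex.ofReal_mul, Complex.exp_mul_I, ← Complex.ofReal_cos, ← Complex.ofReal_sin]

/-- Convergence of trigonometric moments to those of a centered Gaussian law implies convergence
of distribution functions at the continuity points. -/
theorem tendsto_measureReal_lt_of_tendsto_integral_cos {Ω : Type*} [MeasurableSpace Ω]
    {Pr : Measure Ω} [IsProbabilityMeasure Pr] {Y : ℝ → Ω → ℝ} (hY : ∀ T, Measurable (Y T))
    {v : ℝ≥0} (h : ∀ θ β : ℝ, Tendsto (fun T => ∫ ω, Real.cos (θ * Y T ω + β) ∂Pr) atTop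
      (𝓝 (Real.cos β * Real.exp (-(v * θ ^ 2 / 2))))) {ξ : ℝ} (hξ : v ≠ 0 ∨ ξ ≠ 0) :
    Tendsto (fun T => Pr.real {ω | Y T ω < ξ}) atTop (𝓝 (cdf (gaussianReal 0 v) ξ)) := by
  -- The limit law has no atom at `ξ`: this is where `ξ = 0` must be excluded in the degenerate
  -- case. It also makes the strict and the large inequality interchangeable in the limit.
  have hnull : gaussianReal 0 v {ξ} = 0 := by
    by_cases hv : v = 0
    · rw [hv, gaussianReal_zero_var, Measure.dirac_apply' _ (measurableSet_singleton _)]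
      exact Set.indicator_of_notMem (fun h0 => hξ.resolve_left (by simpa using hv) h0.symm) _
    · have := nullSingletonClass_gaussianReal (μ := 0) hv
      exact measure_singleton ξ
  have hpr : ∀ T, IsProbabilityMeasure (Pr.map (Y T)) := fun T =>
    Measure.isProbabilityMeasure_map (hY T).aemeasurable
  set ν : ℝ → ProbabilityMeasure ℝ := fun T => ⟨Pr.map (Y T), hpr T⟩ with hν
  set ν₀ : ProbabilityMeasure ℝ := ⟨gaussianReal 0 v, inferInstance⟩ with hν₀
  have hchar : ∀ θ, Tendsto (fun T => charFun (ν T : Measure ℝ) θ) atTop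
      (𝓝 (charFun (ν₀ : Measure ℝ) θ)) := by
    intro θ
    have e0 : charFun (ν₀ : Measure ℝ) θ = ((Real.cos 0 * Real.exp (-(v * θ ^ 2 / 2)) : ℝ) : ℂ) +
        ((Real.cos (-(Real.pi / 2)) * Real.exp (-(v * θ ^ 2 / 2)) : ℝ) : ℂ) * Complex.I := by
      change charFun (gaussianReal 0 v) θ = _
      rw [charFun_gaussianReal]
      simp
    rw [e0]
    have h1 := (Complex.continuous_ofReal.tendsto _).comp (h θ 0)
    have h2 := (Complex.continuous_ofReal.tendsto _).comp (h θ (-(Real.pi / 2)))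
    refine (h1.add (h2.mul_const Complex.I)).congr fun T => ?_
    simp only [hν, ProbabilityMeasure.coe_mk, charFun_map_eq (hY T), Function.comp_apply, add_zero]
  -- Lévy's continuity theorem is applied along sequences, which suffice because `atTop` on `ℝ` is
  -- countably generated.
  have hlim : Tendsto ν atTop (𝓝 ν₀) := tendsto_of_seq_tendsto fun x hx =>
    ProbabilityMeasure.tendsto_iff_tendsto_charFun.2 fun θ => (hchar θ).comp hx
  have hfr := ProbabilityMeasure.tendsto_measure_of_null_frontier_of_tendsto' hlim
    (E := Set.Iio ξ) (by rw [frontier_Iio]; exact hnull)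
  have hlast := (ENNReal.tendsto_toReal (measure_ne_top _ _)).comp hfr
  have e1 : ((ν₀ : Measure ℝ) (Set.Iio ξ)).toReal = cdf (gaussianReal 0 v) ξ := by
    rw [cdf_eq_real, measureReal_def]
    congr 1
    change gaussianReal 0 v (Set.Iio ξ) = _
    rw [← Set.Iic_sdiff_right, measure_sdiff_null hnull]
  rw [← e1]
  refine hlast.congr fun T => ?_
  simp only [Function.comp_apply, hν, ProbabilityMeasure.coe_mk]
  rw [Measure.map_apply (hY T) measurableSet_Iio]
  rfl

/-! ### Moment hypotheses and conclusion. -/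

theorem HypH3.exists_integral_rpow_le {E Ω : Type*} [MetricSpace E] [SecondCountableTopology E]
    [MeasurableSpace E] [BorelSpace E] [MeasurableSpace Ω] {Pr : Measure Ω}
    [IsProbabilityMeasure Pr] {X : ℝ≥0 → Ω → E} (hX : ∀ t, Measurable (X t)) (h3 : HypH3 X Pr) :
    ∃ (x₀ : E) (p A : ℝ), 2 < p ∧ ∀ t, Integrable (fun ω => (1 + dist (X t ω) x₀) ^ p) Pr ∧
      ∫ ω, (1 + dist (X t ω) x₀) ^ p ∂Pr ≤ A := by
  obtain ⟨x₀, δ, hδ, hfin⟩ := h3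
  set p : ℝ := 2 + δ with hp
  have hp2 : 2 < p := by linarith
  set S := ⨆ t : ℝ≥0, ∫⁻ ω, edist (X t ω) x₀ ^ p ∂Pr with hS
  have hle : ∀ d : ℝ, 0 ≤ d → (1 + d) ^ p ≤ 2 ^ p * (1 + d ^ p) := by
    intro d hd
    have hdp := Real.rpow_nonneg hd p
    rcases le_total d 1 with h1 | h1
    · calc (1 + d) ^ p ≤ 2 ^ p := Real.rpow_le_rpow (by positivity) (by linarith) (by linarith)
        _ ≤ _ := le_mul_of_one_le_right (by positivity) (by linarith)
    · calc (1 + d) ^ p ≤ (2 * d) ^ p :=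
            Real.rpow_le_rpow (by positivity) (by linarith) (by linarith)
        _ = 2 ^ p * d ^ p := Real.mul_rpow zero_le_two hd
        _ ≤ _ := by gcongr; linarith
  have hdm : ∀ t, Measurable fun ω => dist (X t ω) x₀ := fun t =>
    (continuous_id.dist continuous_const).measurable.comp (hX t)
  have hd : ∀ t, Integrable (fun ω => dist (X t ω) x₀ ^ p) Pr ∧
      ∫ ω, dist (X t ω) x₀ ^ p ∂Pr ≤ S.toReal := by
    intro t
    have e1 : ∀ ω, ENNReal.ofReal (dist (X t ω) x₀ ^ p) = edist (X t ω) x₀ ^ p := fun ω => by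
      rw [edist_dist, ENNReal.ofReal_rpow_of_nonneg dist_nonneg (by linarith)]
    have hm : AEStronglyMeasurable (fun ω => dist (X t ω) x₀ ^ p) Pr :=
      ((hdm t).pow_const p).aestronglyMeasurable
    have hl : ∫⁻ ω, ENNReal.ofReal (dist (X t ω) x₀ ^ p) ∂Pr ≤ S := by
      simp only [e1]
      exact le_iSup (fun t : ℝ≥0 => ∫⁻ ω, edist (X t ω) x₀ ^ p ∂Pr) t
    have hnn : 0 ≤ᵐ[Pr] fun ω => dist (X t ω) x₀ ^ p :=
      ae_of_all _ fun ω => Real.rpow_nonneg dist_nonneg _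
    refine ⟨⟨hm, (hasFiniteIntegral_iff_ofReal hnn).2 (hl.trans_lt hfin)⟩, ?_⟩
    rw [integral_eq_lintegral_of_nonneg_ae hnn hm]
    exact ENNReal.toReal_mono hfin.ne hl
  refine ⟨x₀, p, 2 ^ p * (1 + S.toReal), hp2, fun t => ?_⟩
  have hi : Integrable (fun ω => (2 : ℝ) ^ p * (1 + dist (X t ω) x₀ ^ p)) Pr :=
    ((integrable_const _).add (hd t).1).const_mul _
  have hi' : Integrable (fun ω => (1 + dist (X t ω) x₀) ^ p) Pr :=
    hi.mono' ((measurable_const.add (hdm t)).pow_const p).aestronglyMeasurable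
      (ae_of_all _ fun ω => by
        rw [Real.norm_of_nonneg (by positivity)]
        exact hle _ dist_nonneg)
  refine ⟨hi', (integral_mono hi' hi fun ω => hle _ dist_nonneg).trans ?_⟩
  rw [integral_const_mul, integral_add (integrable_const _) (hd t).1, integral_const,
    probReal_univ, one_smul]
  gcongr
  exact (hd t).2

/-- A centered Lipschitz `f` satisfies `|f x| ≤ C K (1 + dist x x₀)`, so the mixed moment is at most
quadratic in the weight and `p ≥ 2` covers it. -/
theorem IsMarkovProcess.isCenteredObservable_of_rpow_moment {E Ω : Type*} [MetricSpace E]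
    [SecondCountableTopology E] [MeasurableSpace E] [BorelSpace E] [MeasurableSpace Ω]
    {P : ℝ≥0 → Kernel E E} {X : ℝ≥0 → Ω → E} {Pr : Measure Ω} {μs : Measure E} {x₀ : E}
    {C γ : ℝ} (hX : IsMarkovProcess P X Pr) (hP : IsTransitionSemigroup P)
    (hG : SpectralGap P μs x₀ C γ) {K : ℝ≥0} {f : E → ℝ} (hf : LipschitzWith K f)
    (h0 : ∫ z, f z ∂μs = 0) {p A : ℝ} (hp : 2 ≤ p)
    (hV : ∀ t, Integrable (fun ω => (1 + dist (X t ω) x₀) ^ p) Pr)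
    (hVA : ∀ t, ∫ ω, (1 + dist (X t ω) x₀) ^ p ∂Pr ≤ A) :
    IsCenteredObservable P X Pr μs x₀ C γ f K ((1 + C * K) * A) := by
  have hCK : 0 ≤ C * K := mul_nonneg hG.const_pos.le K.2
  have hle : ∀ x, (1 + dist x x₀) * (1 + |f x|) ≤ (1 + C * K) * (1 + dist x x₀) ^ p := by
    intro x
    have h1 : (1 : ℝ) ≤ 1 + dist x x₀ := by linarith [dist_nonneg (x := x) (y := x₀)]
    have h2 : (1 + dist x x₀) ^ (2 : ℕ) ≤ (1 + dist x x₀) ^ p := by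
      rw [← Real.rpow_natCast]
      exact Real.rpow_le_rpow_of_exponent_le h1 (by exact_mod_cast hp)
    calc (1 + dist x x₀) * (1 + |f x|)
        ≤ (1 + dist x x₀) * ((1 + dist x x₀) + C * K * (1 + dist x x₀)) := by
          gcongr
          exact hG.abs_le hP hf h0 x
      _ = (1 + C * K) * (1 + dist x x₀) ^ 2 := by ring
      _ ≤ _ := by gcongr
  have hi : ∀ t, Integrable (fun ω => (1 + dist (X t ω) x₀) * (1 + |f (X t ω)|)) Pr := by
    intro t
    have hc := hf.continuous
    have hm : Measurable fun ω => (1 + dist (X t ω) x₀) * (1 + |f (X t ω)|) :=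
      (by fun_prop : Continuous fun x => (1 + dist x x₀) * (1 + |f x|)).measurable.comp
        (hX.measurable_apply t)
    refine ((hV t).const_mul (1 + C * K)).mono' hm.aestronglyMeasurable (ae_of_all _ fun ω => ?_)
    rw [Real.norm_of_nonneg (by positivity)]
    exact hle _
  refine ⟨hP, hX, hG, hf, h0, hi, fun t => ?_⟩
  refine (integral_mono (hi t) ((hV t).const_mul _) fun ω => hle _).trans ?_
  rw [integral_const_mul]
  gcongr
  exact hVA t

theorem theorem1 {E : Type*} [MetricSpace E] [CompleteSpace E] [SecondCountableTopology E]
    [MeasurableSpace E] [BorelSpace E] {Ω : Type*} [MeasurableSpace Ω]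
    (Pr : Measure Ω) [IsProbabilityMeasure Pr]
    (P : ℝ≥0 → Kernel E E) (hP : IsTransitionSemigroup P)
    (X : ℝ≥0 → Ω → E) (hX : IsMarkovProcess P X Pr) (hμ₀ : IsP1 (Pr.map (X 0)))
    (ψ : E → ℝ) (hψ : ∃ K : ℝ≥0, LipschitzWith K ψ)
    (h0 : HypH0 P) (h1 : HypH1 P) :
    ∃ μs : Measure E,
      -- the unique invariant probability measure, which lies in the class with first moment
      IsP1 μs ∧ (∀ t, Kernel.Invariant (P t) μs) ∧
      (∀ ν : Measure E, IsProbabilityMeasure ν → (∀ t, Kernel.Invariant (P t) ν) → ν = μs) ∧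
      -- the weak law of large numbers (the time integrals converge almost surely)
      (∀ᵐ ω ∂Pr, ∀ T : ℝ, 0 ≤ T →
        IntervalIntegrable (fun s : ℝ => ψ (X s.toNNReal ω)) volume 0 T) ∧
      TendstoInMeasure Pr (fun (T : ℝ) ω => 1 / T * additiveFunctional X ψ T ω) atTop
        (fun _ => ∫ x, ψ x ∂μs) ∧
      (HypH2 P → HypH3 X Pr → ∃ σ : ℝ≥0,
        -- the asymptotic variance
        (∀ T : ℝ, 0 ≤ T →
          MemLp (additiveFunctional X (fun x => ψ x - ∫ y, ψ y ∂μs) T) 2 Pr) ∧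
        Tendsto (fun T : ℝ =>
            1 / T * ∫ ω, (additiveFunctional X (fun x => ψ x - ∫ y, ψ y ∂μs) T ω) ^ 2 ∂Pr)
          atTop (𝓝 ((σ : ℝ) ^ 2)) ∧
        -- the central limit theorem (for `σ = 0` the limit law is the point mass at `0`)
        ∀ ξ : ℝ, (σ ≠ 0 ∨ ξ ≠ 0) →
          Tendsto (fun T : ℝ => Pr.real
              {ω | 1 / √T * additiveFunctional X (fun x => ψ x - ∫ y, ψ y ∂μs) T ω < ξ})
            atTop (𝓝 (cdf (gaussianReal 0 (σ ^ 2)) ξ))) := by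
  obtain ⟨K, hψ⟩ := hψ
  obtain ⟨x₁, -⟩ := hμ₀.moment
  obtain ⟨μs, hμs, hinv⟩ := exists_invariant_isP1 hP h0 h1 hμ₀
  have hp := hμs.isProb
  obtain ⟨C₁, γ₁, hG₁⟩ := exists_spectralGap hP h0 h1 hμs hinv x₁
  have hi : Integrable (fun ω => dist (X 0 ω) x₁) Pr :=
    (hμ₀.integrable_of_lipschitz (LipschitzWith.dist_left x₁)).comp_measurable
      (hX.measurable_apply 0)
  refine ⟨μs, hμs, hinv, fun ν hν hνi => hG₁.eq_of_invariant hP hνi,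
    hX.ae_intervalIntegrable_of_lipschitz hP hG₁ hi hψ,
    hX.tendstoInMeasure_average hP hG₁ hi hψ, fun _ h3 => ?_⟩
  obtain ⟨x₀, p, A, hp2, hVA⟩ := h3.exists_integral_rpow_le hX.measurable_apply
  -- The gap is taken anew with the base point of H3, since its weight has to match the moment
  -- bound.
  obtain ⟨C, γ, hG⟩ := exists_spectralGap hP h0 h1 hμs hinv x₀
  have hf : LipschitzWith K fun x => ψ x - ∫ y, ψ y ∂μs :=
    LipschitzWith.of_dist_le_mul fun x y => by simpa using hψ.dist_le_mul x y
  have hf0 : ∫ x, (ψ x - ∫ y, ψ y ∂μs) ∂μs = 0 := by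
    rw [integral_sub (hμs.integrable_of_lipschitz hψ) (integrable_const _), integral_const,
      probReal_univ, one_smul, sub_self]
  have h := hX.isCenteredObservable_of_rpow_moment hP hG hf hf0 hp2.le (fun t => (hVA t).1)
    fun t => (hVA t).2
  obtain ⟨m, hm, hvar, hcos⟩ := h.exists_asymptotic_variance hp2 (fun t => (hVA t).1)
    fun t => (hVA t).2
  -- With `σ² = 2m` the Gaussian exponent `σ² θ² / 2` is the `m θ²` found for the cosine moments.
  have hσ : ((Real.toNNReal √(2 * m) : ℝ≥0) : ℝ) ^ 2 = 2 * m := by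
    rw [Real.coe_toNNReal _ (Real.sqrt_nonneg _), Real.sq_sqrt (by positivity)]
  refine ⟨Real.toNNReal √(2 * m), fun T hT => h.isSquareBounded.memLp_integral hT, ?_,
    fun ξ hξ => ?_⟩
  · rw [hσ]
    exact hvar
  · refine tendsto_measureReal_lt_of_tendsto_integral_cos
      (fun T => (h.measurable_integral T).const_mul _) (fun θ β => ?_)
      (hξ.imp_left (pow_ne_zero 2))
    have e : -(((Real.toNNReal √(2 * m) ^ 2 : ℝ≥0) : ℝ) * θ ^ 2 / 2) = -(θ ^ 2 * m) := by
      rw [NNReal.coe_pow, hσ]; ring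
    rw [e]
    refine (hcos θ β).congr fun T => ?_
    simp only [div_eq_mul_one_div θ, mul_assoc]
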